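/- Let $\alpha\in(0,1)$, $p>1$ and $c>0$ be real, let $\mathbb T=\mathbb R/2\pi\mathbb Z$, and let $n$ be one of the two nonlinearities $n(x)=|x|^p$ (case abs) or $n(x)=x|x|^{p-1}$ (case sgn). For zero-mean functions on $\mathbb T$ let $|\mathrm D|^{-\alpha}$ be the Fourier multiplier $\widehat{|\mathrm D|^{-\alpha}u}(k)=|k|^{-\alpha}\,\widehat u(k)$ for $k\in\mathbb Z\setminus\{0\}$, with $\widehat{|\mathrm D|^{-\alpha}u}(0)=0$. Put $\mu=(c/p)^{1/(p-1)}$. Let $\varphi\colon\mathbb T\to\mathbb R$ be a nontrivial (not identically zero) continuous, even function with zero mean that solves the steady equation $$|\mathrm D|^{-\alpha}\varphi = c\,\varphi-n(\varphi)+\frac1{2\pi}\int_{\mathbb T}n(\varphi(y))\,\mathrm dy ,$$ is increasing (that is, nondecreasing) on $(-\pi,0)$, satisfies $n'(\varphi)\le c$ everywhere, and has maximum $\varphi(0)=\mu$. Then: 1. $\varphi$ is strictly increasing on $(-\pi,0)$ and has exactly one zero there. It is smooth ($C^\infty$) in a neighbourhood of every point of $\mathbb T$ other than $0$, the zeros of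 $\varphi$ and, in case sgn only, points where $\varphi=-\mu$ (this can happen only at $\pi$). Around each of its zeros, $\varphi$ has at least the Hölder regularity of $n$ around $0$: for all integers $m\ge0$ and all $\beta\in(0,1]$, if $n$ is of class $C^{m,\beta}$ in a neighbourhood of $0$, then $\varphi$ is of class $C^{m,\beta}$ in a neighbourhood of each of its zeros. 2. $\varphi\in C^\alpha(\mathbb T)$, that is, $\varphi$ is globally $\alpha$-Hölder continuous. 3. $\varphi$ is exactly $\alpha$-Hölder continuous at $0$: there are constants $r,C_1,C_2>0$ (which may depend on $\varphi$) such that $$C_1|x|^\alpha\le \mu-\varphi(x)\le C_2|x|^\alpha\qquad\text{for all }|x|<r .$$ -/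

import Mathlib

open scoped ContDiff

/-- Functions on the torus `𝕋 = ℝ / 2πℤ` are identified with `2π`-periodic functions on `ℝ`. This is
the space of continuous functions on `𝕋` that are even and have zero mean. -/
structure IsEvenZeroMeanContinuous (φ : ℝ → ℝ) : Prop where
  continuous : Continuous φ
  periodic : Function.Periodic φ (2 * Real.pi)
  even : Function.Even φ
  zero_mean : ∫ x in (-Real.pi)..Real.pi, φ x = 0

/-- The `k`-th Fourier coefficient of a real function over one period `(-π, π]`
(Mathlib's normalisation, with the factor `1 / (2π)`). -/
noncomputable def torusFourierCoeff (u : ℝ → ℝ) (k : ℤ) : ℂ :=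
  fourierCoeffOn (neg_lt_self Real.pi_pos) (fun x : ℝ => (u x : ℂ)) k

/-- `v = |D|^{-α} u` on `𝕋`: `v` is the continuous periodic function whose `k`-th Fourier coefficient
is `|k|^{-α}` times that of `u` for `k ≠ 0`, where both `u` and `v` have zero mean. As a continuous
periodic function is determined by its Fourier coefficients, there is at most one such `v`. -/
structure IsInvFracD (α : ℝ) (u v : ℝ → ℝ) : Prop where
  continuous : Continuous v
  periodic : Function.Periodic v (2 * Real.pi)
  zero_mean_left : torusFourierCoeff u 0 = 0
  zero_mean_right : torusFourierCoeff v 0 = 0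
  multiplier : ∀ k : ℤ, k ≠ 0 →
    torusFourierCoeff v k = (((|(k : ℝ)| ^ (-α) : ℝ)) : ℂ) * torusFourierCoeff u k

/-- The two kinds of nonlinearity: `|x|^p` and `x |x|^(p-1)`. -/
inductive NonlinearityKind : Type
  | abs
  | sgn

/-- The nonlinearity `n`. -/
noncomputable def nonlinearity (κ : NonlinearityKind) (p x : ℝ) : ℝ :=
  match κ with
  | NonlinearityKind.abs => |x| ^ p
  | NonlinearityKind.sgn => x * |x| ^ (p - 1)

/-- `φ` solves the steady equation `|D|^{-α} φ = c φ - n(φ) + (1 / 2π) ∫_𝕋 n(φ)`. -/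
def IsSteadySolution (κ : NonlinearityKind) (α p c : ℝ) (φ : ℝ → ℝ) : Prop :=
  IsInvFracD α φ (fun x => c * φ x - nonlinearity κ p (φ x) +
    (1 / (2 * Real.pi)) * ∫ y in (-Real.pi)..Real.pi, nonlinearity κ p (φ y))

/-- The highest value `μ = (c / p)^(1 / (p - 1))`. -/
noncomputable def highestValue (p c : ℝ) : ℝ := (c / p) ^ (1 / (p - 1))

/-- `f` is of Hölder class `C^{m,β}` in a neighbourhood of `x₀`. -/
def IsHolderNear (m : ℕ) (β : ℝ) (f : ℝ → ℝ) (x₀ : ℝ) : Prop :=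
  ∃ δ > 0, ContDiffOn ℝ m f (Set.Ioo (x₀ - δ) (x₀ + δ)) ∧
    ∃ C : ℝ, ∀ x ∈ Set.Ioo (x₀ - δ) (x₀ + δ), ∀ y ∈ Set.Ioo (x₀ - δ) (x₀ + δ),
      |iteratedDeriv m f x - iteratedDeriv m f y| ≤ C * |x - y| ^ β

/-! Write `g t = c * t - n t`, so that the steady equation reads `g ∘ φ = K * φ + const`. The kernel
`K` is explicit. The function `sinh t / (cosh t - cos x)` is the Poisson kernel at radius `e^{-t}`,
and integrating it, minus its mean, against `t^(α-1)` turns `e^{-kt}` into `Γ(α) k^(-α)`. Hence `K x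
= G (cos x) / (2πΓ(α))`, where `G` is smooth, increasing and convex on `[-1, 1)`, and `G'` is
comparable to `(1 - w)^((α-3)/2)` there (`kerProfileD_two_le`, `le_kerProfileD_two`). Uniqueness of
Fourier coefficients identifies the operator with this convolution (`IsInvFracD.eq_fracInt`).

Monotonicity. Evenness and periodicity give `g(φ(x-h)) - g(φ(x+h)) = ∫_0^π (K(x-y) - K(x+y)) (φ(y-h)
- φ(y+h)) dy` (`fracInt_sub_fracInt`), with a positive kernel and a nonnegative second factor. If
`φ` takes equal values at `x-h` and `x+h`, the second factor vanishes, so `φ` has period `2h`, is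
constant, and is zero by its mean (`strictAntiOn_of_steady`).

Interior regularity. Where `g' = c - n'` does not vanish, `g` can be inverted locally. Convolution
with `K` gains `α` derivatives, so regularity climbs until it meets that of `n` at the value of `φ`
(`LocHolder.of_steady`). The exceptional heights are `μ` and, for the odd nonlinearity, `-μ`.

Crest. Put `u = μ - φ`. Near `μ` the function `g` is quadratically degenerate, so the symmetrised
identity compares a quantity quadratic in `u` with an integral linear in `u`; this balance selects
the exponent `α`. Evaluating it at a minimum of `u / x^α` gives the lower bound
(`IsCrest.exists_lower`), and at a maximum over `[ε, π]` the upper bound, uniformly in `ε`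
(`IsCrest.exists_upper`). For Hölder continuity, `D = φ(y-h) - φ(y+h)` is maximised over `y`. By the
lower bound the left side is at least a constant times `D y^α`; the part of the integral with `|y -
z| ≤ θ y` is at most `C₁ θ^α D y^α`, absorbed for small `θ`, and the rest is `O(h^α y^α)`
(`IsCrest.exists_sub_le`). An inverted crest at `π` reduces to this case through `y ↦ -φ(y + π)`.
Compactness and periodicity make the local estimates global. -/

open Set MeasureTheory Filter Topology

/-! ### The kernel profile and its derivatives. -/

/-- The profile `G` of the kernel of `|D|^{-α}`, which is `G (cos x)` up to normalisation. -/
noncomputable def kerProfile (α w : ℝ) : ℝ :=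
  ∫ t in Ioi (0 : ℝ), t ^ (α - 1) * (Real.sinh t / (Real.cosh t - w) - 1)

/-- The derivatives of `kerProfile`, up to factorials. -/
noncomputable def kerProfileD (α : ℝ) (j : ℕ) (w : ℝ) : ℝ :=
  ∫ t in Ioi (0 : ℝ), t ^ (α - 1) * (Real.sinh t / (Real.cosh t - w) ^ j)

lemma cosh_sub_lower {w t : ℝ} : min 1 (1 - w) * Real.cosh t ≤ Real.cosh t - w := by
  have h1 := Real.one_le_cosh t
  rcases le_total w 0 with hw | hw
  · rw [min_eq_left (by linarith)]; linarith
  · rw [min_eq_right (by linarith)]; nlinarith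

lemma cosh_sub_pos {w : ℝ} (hw : w < 1) (t : ℝ) : 0 < Real.cosh t - w := by
  linarith [Real.one_le_cosh t]

lemma exp_le_two_cosh (t : ℝ) : Real.exp t ≤ 2 * Real.cosh t := by
  rw [Real.cosh_eq]; linarith [Real.exp_pos (-t)]

lemma inv_cosh_le (t : ℝ) : (Real.cosh t)⁻¹ ≤ 2 * Real.exp (-t) := by
  rw [Real.exp_neg, ← div_eq_mul_inv, inv_eq_one_div, div_le_div_iff₀ (Real.cosh_pos t)
    (Real.exp_pos t)]
  linarith [exp_le_two_cosh t]

/-- This form shows the decay gained by removing the mean: the numerator stays bounded for `t > 0`,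
while the denominator grows like `e^t`. -/
lemma sinh_div_sub_one {w t : ℝ} (hw : w < 1) :
    Real.sinh t / (Real.cosh t - w) - 1 = (w - Real.exp (-t)) / (Real.cosh t - w) := by
  have := (cosh_sub_pos hw t).ne'
  field_simp
  rw [Real.sinh_eq, Real.cosh_eq]; ring

lemma sinh_div_sub_one_bound {w t : ℝ} (hw : w < 1) (ht : 0 < t) :
    |Real.sinh t / (Real.cosh t - w) - 1| ≤
      2 * (|w| + 1) / min 1 (1 - w) * Real.exp (-t) := by
  have hd : 0 < min 1 (1 - w) := lt_min one_pos (by linarith)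
  have hc := Real.cosh_pos t
  rw [sinh_div_sub_one hw, abs_div, abs_of_pos (cosh_sub_pos hw t)]
  have h1 : |w - Real.exp (-t)| ≤ |w| + 1 := by
    refine (abs_sub _ _).trans ?_
    rw [abs_of_pos (Real.exp_pos _)]
    have := Real.exp_le_one_iff.2 (by linarith : -t ≤ 0)
    linarith
  calc |w - Real.exp (-t)| / (Real.cosh t - w)
      ≤ (|w| + 1) / (min 1 (1 - w) * Real.cosh t) := by
        gcongr; exact cosh_sub_lower
    _ = (|w| + 1) / min 1 (1 - w) * (Real.cosh t)⁻¹ := by field_simp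
    _ ≤ (|w| + 1) / min 1 (1 - w) * (2 * Real.exp (-t)) := by
        gcongr; exact inv_cosh_le t
    _ = _ := by ring

/-- One power of `cosh` is spent on `sinh`, and a second one yields the exponential decay. For `j =
1` nothing would be left, which is why the profile itself needs the subtracted `1`. -/
lemma sinh_div_pow_bound {w t : ℝ} {j : ℕ} (hj : 2 ≤ j) (hw : w < 1) (ht : 0 < t) :
    |Real.sinh t / (Real.cosh t - w) ^ j| ≤
      2 / min 1 (1 - w) ^ j * Real.exp (-t) := by
  have hd : 0 < min 1 (1 - w) := lt_min one_pos (by linarith)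
  have hc := Real.cosh_pos t
  have hs := (Real.sinh_pos_iff.2 ht).le
  rw [abs_of_nonneg (div_nonneg hs (pow_nonneg (cosh_sub_pos hw t).le _))]
  have hpow : Real.cosh t ^ 2 ≤ Real.cosh t ^ j := pow_le_pow_right₀ (Real.one_le_cosh t) hj
  calc Real.sinh t / (Real.cosh t - w) ^ j
      ≤ Real.cosh t / (min 1 (1 - w) * Real.cosh t) ^ j := by
        gcongr
        · exact (Real.sinh_lt_cosh t).le
        · exact cosh_sub_lower
    _ = Real.cosh t / (min 1 (1 - w) ^ j * Real.cosh t ^ j) := by rw [mul_pow]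
    _ ≤ Real.cosh t / (min 1 (1 - w) ^ j * Real.cosh t ^ 2) := by gcongr
    _ = 1 / min 1 (1 - w) ^ j * (Real.cosh t)⁻¹ := by field_simp
    _ ≤ 1 / min 1 (1 - w) ^ j * (2 * Real.exp (-t)) := by
        gcongr; exact inv_cosh_le t
    _ = _ := by ring

lemma integrableOn_rpow_mul_exp {α : ℝ} (hα : 0 < α) (C : ℝ) :
    IntegrableOn (fun t : ℝ => t ^ (α - 1) * (C * Real.exp (-t))) (Ioi 0) := by
  have h : IntegrableOn (fun t : ℝ => C * (Real.exp (-t) * t ^ (α - 1))) (Ioi 0) :=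
    (Real.GammaIntegral_convergent hα).const_mul C
  refine h.congr_fun (fun t _ => ?_) measurableSet_Ioi
  simp only; ring

lemma measurable_sinh_div_pow (α w : ℝ) (j : ℕ) :
    Measurable (fun t : ℝ => t ^ (α - 1) * (Real.sinh t / (Real.cosh t - w) ^ j)) := by
  have h1 := Real.continuous_sinh.measurable
  have h2 := Real.continuous_cosh.measurable
  fun_prop

lemma measurable_sinh_div_sub (α w : ℝ) :
    Measurable (fun t : ℝ => t ^ (α - 1) * (Real.sinh t / (Real.cosh t - w) - 1)) := by
  have h1 := Real.continuous_sinh.measurable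
  have h2 := Real.continuous_cosh.measurable
  fun_prop

lemma norm_rpow_mul_le {t a x y : ℝ} (ht : 0 < t) (h : |x| ≤ y) :
    ‖t ^ a * x‖ ≤ t ^ a * y := by
  rw [Real.norm_eq_abs, abs_mul, abs_of_pos (Real.rpow_pos_of_pos ht _)]
  exact mul_le_mul_of_nonneg_left h (Real.rpow_pos_of_pos ht _).le

lemma integrableOn_kerProfile {α w : ℝ} (hα : 0 < α) (hw : w < 1) :
    IntegrableOn (fun t : ℝ => t ^ (α - 1) * (Real.sinh t / (Real.cosh t - w) - 1)) (Ioi 0) := by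
  refine (integrableOn_rpow_mul_exp hα (2 * (|w| + 1) / min 1 (1 - w))).mono'
    (measurable_sinh_div_sub α w).aestronglyMeasurable ?_
  refine (ae_restrict_iff' measurableSet_Ioi).2 (ae_of_all _ fun t ht => ?_)
  exact norm_rpow_mul_le ht (sinh_div_sub_one_bound hw ht)

lemma integrableOn_kerProfileD {α w : ℝ} {j : ℕ} (hα : 0 < α) (hj : 2 ≤ j) (hw : w < 1) :
    IntegrableOn (fun t : ℝ => t ^ (α - 1) * (Real.sinh t / (Real.cosh t - w) ^ j)) (Ioi 0) := by
  refine (integrableOn_rpow_mul_exp hα (2 / min 1 (1 - w) ^ j)).mono'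
    (measurable_sinh_div_pow α w j).aestronglyMeasurable ?_
  refine (ae_restrict_iff' measurableSet_Ioi).2 (ae_of_all _ fun t ht => ?_)
  exact norm_rpow_mul_le ht (sinh_div_pow_bound hj hw ht)

lemma hasDerivAt_sinh_div_pow {t w : ℝ} (j : ℕ) (hw : w < 1) :
    HasDerivAt (fun w => Real.sinh t / (Real.cosh t - w) ^ j)
      (j * (Real.sinh t / (Real.cosh t - w) ^ (j + 1))) w := by
  have hne := (cosh_sub_pos hw t).ne'
  have h := (((hasDerivAt_id w).const_sub (Real.cosh t)).pow j)
  have h2 := (h.inv (pow_ne_zero j hne)).const_mul (Real.sinh t)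
  refine h2.congr_deriv ?_
  simp only [id, Pi.pow_apply]
  cases j with
  | zero => simp
  | succ n =>
    simp only [Nat.add_sub_cancel]
    field_simp
    ring

/-- Differentiation under the integral sign. The constant `e` covers both the profile (`j = 1`, `e =
1`) and its derivatives (`e = 0`). -/
lemma hasDerivAt_kerProfile_aux {α w : ℝ} (hα : 0 < α) (hw : w < 1) (j : ℕ) (hj : 1 ≤ j) (e : ℝ)
    (hint : IntegrableOn
      (fun t : ℝ => t ^ (α - 1) * (Real.sinh t / (Real.cosh t - w) ^ j - e)) (Ioi 0)) :
    HasDerivAt (fun w => ∫ t in Ioi (0 : ℝ),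
      t ^ (α - 1) * (Real.sinh t / (Real.cosh t - w) ^ j - e))
      (j * kerProfileD α (j + 1) w) w := by
  -- The differentiated integrand increases with `w`, so its value at this point between `w` and `1`
  -- dominates it on a neighbourhood of `w`.
  set w₀ := (1 + w) / 2 with hw₀
  have hw₀1 : w₀ < 1 := by linarith
  have key := hasDerivAt_integral_of_dominated_loc_of_deriv_le
    (μ := volume.restrict (Ioi (0 : ℝ))) (s := Iio w₀) (x₀ := w)
    (F := fun w t => t ^ (α - 1) * (Real.sinh t / (Real.cosh t - w) ^ j - e))
    (F' := fun w t => t ^ (α - 1) * (j * (Real.sinh t / (Real.cosh t - w) ^ (j + 1))))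
    (bound := fun t => j * (t ^ (α - 1) * (Real.sinh t / (Real.cosh t - w₀) ^ (j + 1))))
    (Iio_mem_nhds (by linarith)) ?_ hint ?_ ?_ ?_ ?_
  · refine key.2.congr_deriv ?_
    rw [kerProfileD, ← integral_const_mul]
    congr 1; ext t; ring
  · refine Eventually.of_forall fun x => Measurable.aestronglyMeasurable ?_
    have h1 := Real.continuous_sinh.measurable
    have h2 := Real.continuous_cosh.measurable
    fun_prop
  · refine Measurable.aestronglyMeasurable ?_
    have h1 := Real.continuous_sinh.measurable
    have h2 := Real.continuous_cosh.measurable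
    fun_prop
  · refine (ae_restrict_iff' measurableSet_Ioi).2 (ae_of_all _ fun t ht x hx => ?_)
    have hs := (Real.sinh_pos_iff.2 ht).le
    have hp := (Real.rpow_pos_of_pos ht (α - 1)).le
    have hx1 : x < w₀ := hx
    have hc := cosh_sub_pos (hx1.trans hw₀1) t
    have hc0 := cosh_sub_pos hw₀1 t
    rw [Real.norm_of_nonneg (by positivity)]
    have : Real.sinh t / (Real.cosh t - x) ^ (j + 1) ≤
        Real.sinh t / (Real.cosh t - w₀) ^ (j + 1) := by gcongr
    calc _ = j * (t ^ (α - 1) * (Real.sinh t / (Real.cosh t - x) ^ (j + 1))) := by ring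
      _ ≤ _ := by gcongr
  · exact (integrableOn_kerProfileD hα (by omega) hw₀1).const_mul _
  · refine (ae_restrict_iff' measurableSet_Ioi).2 (ae_of_all _ fun t ht x hx => ?_)
    exact ((hasDerivAt_sinh_div_pow j (lt_trans hx hw₀1)).sub_const e).const_mul _

lemma hasDerivAt_kerProfile {α w : ℝ} (hα : 0 < α) (hw : w < 1) :
    HasDerivAt (kerProfile α) (kerProfileD α 2 w) w := by
  have := hasDerivAt_kerProfile_aux hα hw 1 le_rfl 1
    (by simpa using integrableOn_kerProfile hα hw)
  simp only [pow_one, Nat.cast_one, one_mul] at this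
  exact this

lemma hasDerivAt_kerProfileD {α w : ℝ} (hα : 0 < α) {j : ℕ} (hj : 2 ≤ j) (hw : w < 1) :
    HasDerivAt (kerProfileD α j) (j * kerProfileD α (j + 1) w) w := by
  have := hasDerivAt_kerProfile_aux hα hw j (by omega) 0
    (by simpa using integrableOn_kerProfileD hα hj hw)
  simp only [sub_zero] at this
  exact this

lemma contDiffOn_kerProfileD {α : ℝ} (hα : 0 < α) (n : ℕ) :
    ∀ j : ℕ, 2 ≤ j → ContDiffOn ℝ n (kerProfileD α j) (Iio 1) := by
  induction n with
  | zero =>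
    intro j hj
    exact contDiffOn_zero.2 fun w hw =>
      (hasDerivAt_kerProfileD hα hj hw).continuousAt.continuousWithinAt
  | succ n ih =>
    intro j hj
    rw [Nat.cast_succ, contDiffOn_succ_iff_deriv_of_isOpen isOpen_Iio]
    refine ⟨fun w hw => (hasDerivAt_kerProfileD hα hj hw).differentiableAt.differentiableWithinAt,
      by simp, ?_⟩
    exact ((ih (j + 1) (by omega)).const_smul (j : ℝ)).congr
      fun w hw => (hasDerivAt_kerProfileD hα hj hw).deriv

lemma contDiffOn_kerProfile {α : ℝ} (hα : 0 < α) : ContDiffOn ℝ ∞ (kerProfile α) (Iio 1) := by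
  rw [contDiffOn_infty]
  intro n
  refine ContDiffOn.of_le (n := (n : WithTop ℕ∞) + 1) ?_ le_self_add
  rw [contDiffOn_succ_iff_deriv_of_isOpen isOpen_Iio]
  refine ⟨fun w hw => (hasDerivAt_kerProfile hα hw).differentiableAt.differentiableWithinAt,
      by simp, ?_⟩
  exact (contDiffOn_kerProfileD hα n 2 le_rfl).congr fun w hw => (hasDerivAt_kerProfile hα hw).deriv

/-! ### Size of the profile and its derivatives near `w = 1`. -/

lemma kerProfileD_nonneg {α w : ℝ} (hw : w < 1) (j : ℕ) : 0 ≤ kerProfileD α j w := by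
  refine setIntegral_nonneg measurableSet_Ioi fun t ht => ?_
  have hs := (Real.sinh_pos_iff.2 ht).le
  have hp := (Real.rpow_pos_of_pos ht (α - 1)).le
  have := (cosh_sub_pos hw t).le
  positivity

lemma kerProfileD_mono {α w w' : ℝ} (hα : 0 < α) (hw : w < 1) (h : w' ≤ w) {j : ℕ} (hj : 2 ≤ j) :
    kerProfileD α j w' ≤ kerProfileD α j w := by
  refine setIntegral_mono_on (integrableOn_kerProfileD hα hj (h.trans_lt hw))
    (integrableOn_kerProfileD hα hj hw) measurableSet_Ioi fun t ht => ?_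
  have hs := (Real.sinh_pos_iff.2 ht).le
  have hp := (Real.rpow_pos_of_pos ht (α - 1)).le
  have := cosh_sub_pos hw t
  gcongr

/-- Since `cosh t ≥ 1`, one denominator is at least `1 - w`. In the second derivative of the kernel
this loss is cancelled by the factor `sin² y`. -/
lemma kerProfileD_three_le {α w : ℝ} (hα : 0 < α) (hw : w < 1) :
    kerProfileD α 3 w ≤ kerProfileD α 2 w / (1 - w) := by
  rw [kerProfileD, kerProfileD, ← integral_div]
  refine setIntegral_mono_on (integrableOn_kerProfileD hα (by norm_num) hw)
    ((integrableOn_kerProfileD hα le_rfl hw).div_const _) measurableSet_Ioi fun t ht => ?_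
  have hs := (Real.sinh_pos_iff.2 ht).le
  have hp := (Real.rpow_pos_of_pos ht (α - 1)).le
  have hc := cosh_sub_pos hw t
  have h1 : 1 - w ≤ Real.cosh t - w := by linarith [Real.one_le_cosh t]
  have h2 : 0 < 1 - w := by linarith
  rw [mul_div_assoc, div_div, pow_succ _ 2]
  gcongr

lemma sinh_le_mul_cosh {t : ℝ} (ht : 0 ≤ t) : Real.sinh t ≤ t * Real.cosh t := by
  have hd : ∀ x : ℝ, HasDerivAt (fun x => x * Real.cosh x - Real.sinh x) (x * Real.sinh x) x := by
    intro x
    refine (((hasDerivAt_id x).mul (Real.hasDerivAt_cosh x)).sub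
      (Real.hasDerivAt_sinh x)).congr_deriv ?_
    simp
  have hm : MonotoneOn (fun x => x * Real.cosh x - Real.sinh x) (Ici 0) := by
    refine monotoneOn_of_deriv_nonneg (convex_Ici 0)
      (fun x _ => (hd x).continuousAt.continuousWithinAt)
      (fun x _ => (hd x).differentiableAt.differentiableWithinAt) fun x hx => ?_
    rw [interior_Ici] at hx
    rw [(hd x).deriv]
    exact mul_nonneg (le_of_lt hx) (Real.sinh_nonneg_iff.2 (le_of_lt hx))
  have := hm self_mem_Ici (mem_Ici.2 ht) ht
  simp at this
  linarith

lemma cosh_sub_one_eq (t : ℝ) : Real.cosh t - 1 = 2 * Real.sinh (t / 2) ^ 2 := by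
  have h := Real.cosh_two_mul (t / 2)
  rw [show 2 * (t / 2) = t by ring] at h
  have := Real.cosh_sq (t / 2)
  linarith

lemma sinh_div_cosh_sub_one_sq_le {t : ℝ} (ht : 0 < t) :
    Real.sinh t / (Real.cosh t - 1) ^ 2 ≤ 4 * t ^ (-3 : ℝ) + 2 * t ^ (-2 : ℝ) := by
  have h1 := Real.sinh_two_mul (t / 2)
  rw [show 2 * (t / 2) = t by ring] at h1
  rw [cosh_sub_one_eq, h1]
  have hh : t / 2 < Real.sinh (t / 2) := Real.self_lt_sinh_iff.2 (by linarith)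
  set h := Real.sinh (t / 2) with hdef
  have hpos : 0 < h := by linarith
  have hc : Real.cosh (t / 2) ≤ 1 + h := by
    have h3 := Real.cosh_sq (t / 2)
    nlinarith [Real.cosh_pos (t / 2)]
  have e3 : t ^ (-3 : ℝ) = (t ^ 3)⁻¹ := by
    rw [Real.rpow_neg ht.le]; norm_cast
  have e2 : t ^ (-2 : ℝ) = (t ^ 2)⁻¹ := by
    rw [Real.rpow_neg ht.le]; norm_cast
  rw [e3, e2]
  calc 2 * h * Real.cosh (t / 2) / (2 * h ^ 2) ^ 2
      = Real.cosh (t / 2) / (2 * h ^ 3) := by field_simp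
    _ ≤ (1 + h) / (2 * h ^ 3) := by gcongr
    _ = 1 / (2 * h ^ 3) + 1 / (2 * h ^ 2) := by field_simp
    _ ≤ 1 / (2 * (t / 2) ^ 3) + 1 / (2 * (t / 2) ^ 2) := by gcongr
    _ = _ := by field_simp; ring

/-- The integral is split at `r = √(1 - w)`, the scale at which `cosh t - 1` overtakes `1 - w` in
the denominator. Below `r` the denominator is bounded by `1 - w`, above `r` by `cosh t - 1`; both
parts are of order `r ^ (α - 3)`. -/
lemma kerProfileD_two_le {α : ℝ} (hα : 0 < α) (hα1 : α < 1) :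
    ∃ C > 0, ∀ w, -1 ≤ w → w < 1 → kerProfileD α 2 w ≤ C * (1 - w) ^ ((α - 3) / 2) := by
  set M := Real.cosh 2
  have hM : 0 < M := Real.cosh_pos 2
  refine ⟨M + 4 + 4, by positivity, fun w hw1 hw => ?_⟩
  set s := 1 - w with hs
  have hs0 : 0 < s := by linarith
  have hs2 : s ≤ 2 := by linarith
  set r := √s with hr
  have hr0 : 0 < r := Real.sqrt_pos.2 hs0
  have hr2 : r ≤ 2 := Real.sqrt_le_iff.2 ⟨by norm_num, by linarith⟩
  have hrs : r ^ 2 = s := Real.sq_sqrt hs0.le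
  have hsr : s ^ ((α - 3) / 2) = r ^ (α - 3) := by
    rw [← hrs, ← Real.rpow_natCast, ← Real.rpow_mul hr0.le]; congr 1; push_cast; ring
  have hint := integrableOn_kerProfileD hα le_rfl hw
  rw [kerProfileD, ← Ioc_union_Ioi_eq_Ioi hr0.le, setIntegral_union (Ioc_disjoint_Ioi le_rfl)
    measurableSet_Ioi (hint.mono_set Ioc_subset_Ioi_self) (hint.mono_set (Ioi_subset_Ioi hr0.le))]
  have I1 : ∫ t in Ioc 0 r, t ^ (α - 1) * (Real.sinh t / (Real.cosh t - w) ^ 2) ≤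
      M * r ^ (α - 3) := by
    have hi : IntervalIntegrable (fun t : ℝ => t ^ α) volume 0 r :=
      intervalIntegral.intervalIntegrable_rpow' (by linarith)
    calc _ ≤ ∫ t in Ioc 0 r, M / s ^ 2 * t ^ α := by
          refine setIntegral_mono_on (hint.mono_set Ioc_subset_Ioi_self)
            ((hi.const_mul _).1) measurableSet_Ioc fun t ht => ?_
          have hsinh : Real.sinh t ≤ t * M := by
            refine (sinh_le_mul_cosh ht.1.le).trans ?_
            have : Real.cosh t ≤ M := Real.cosh_le_cosh.2 (by
              rw [abs_of_pos ht.1, abs_of_pos two_pos]; exact ht.2.trans hr2)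
            have := ht.1
            gcongr
          have hden : s ≤ Real.cosh t - w := by linarith [Real.one_le_cosh t]
          have hp := (Real.rpow_pos_of_pos ht.1 (α - 1)).le
          have hs' := ht.1
          calc t ^ (α - 1) * (Real.sinh t / (Real.cosh t - w) ^ 2)
              ≤ t ^ (α - 1) * (t * M / s ^ 2) := by gcongr
            _ = M / s ^ 2 * (t ^ (α - 1) * t) := by ring
            _ = _ := by rw [← Real.rpow_add_one ht.1.ne']; ring_nf
      _ = M / s ^ 2 * (r ^ (α + 1) / (α + 1)) := by
          rw [integral_const_mul, ← intervalIntegral.integral_of_le hr0.le,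
            integral_rpow (Or.inl (by linarith)), Real.zero_rpow (by linarith), sub_zero]
      _ = M * r ^ (α - 3) / (α + 1) := by
          have : r ^ (α + 1) = r ^ (α - 3) * s ^ 2 := by
            rw [← hrs, ← pow_mul, ← Real.rpow_natCast, ← Real.rpow_add hr0]; congr 1; push_cast; ring
          rw [this]; field_simp
      _ ≤ M * r ^ (α - 3) / 1 := by gcongr; linarith
      _ = _ := by ring
  have I2 : ∫ t in Ioi r, t ^ (α - 1) * (Real.sinh t / (Real.cosh t - w) ^ 2) ≤
      8 * r ^ (α - 3) := by
    have hi1 : IntegrableOn (fun t : ℝ => t ^ (α - 4)) (Ioi r) :=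
      integrableOn_Ioi_rpow_of_lt (by linarith) hr0
    have hi2 : IntegrableOn (fun t : ℝ => t ^ (α - 3)) (Ioi r) :=
      integrableOn_Ioi_rpow_of_lt (by linarith) hr0
    calc _ ≤ ∫ t in Ioi r, (4 * t ^ (α - 4) + 2 * t ^ (α - 3)) := by
          refine setIntegral_mono_on (hint.mono_set (Ioi_subset_Ioi hr0.le))
            ((hi1.const_mul _).add (hi2.const_mul _)) measurableSet_Ioi fun t ht => ?_
          have ht0 : 0 < t := hr0.trans ht
          have hsinh := (Real.sinh_pos_iff.2 ht0).le
          have hp := (Real.rpow_pos_of_pos ht0 (α - 1)).le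
          have h1 : 0 < Real.cosh t - 1 := by linarith [Real.one_lt_cosh.2 ht0.ne']
          calc t ^ (α - 1) * (Real.sinh t / (Real.cosh t - w) ^ 2)
              ≤ t ^ (α - 1) * (Real.sinh t / (Real.cosh t - 1) ^ 2) := by gcongr
            _ ≤ t ^ (α - 1) * (4 * t ^ (-3 : ℝ) + 2 * t ^ (-2 : ℝ)) := by
                gcongr; exact sinh_div_cosh_sub_one_sq_le ht0
            _ = 4 * (t ^ (α - 1) * t ^ (-3 : ℝ)) + 2 * (t ^ (α - 1) * t ^ (-2 : ℝ)) := by ring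
            _ = _ := by
                rw [← Real.rpow_add ht0, ← Real.rpow_add ht0]; ring_nf
      _ = 4 * (-r ^ (α - 4 + 1) / (α - 4 + 1)) + 2 * (-r ^ (α - 3 + 1) / (α - 3 + 1)) := by
          rw [integral_add (hi1.const_mul _) (hi2.const_mul _), integral_const_mul,
            integral_const_mul, integral_Ioi_rpow_of_lt (by linarith) hr0,
            integral_Ioi_rpow_of_lt (by linarith) hr0]
      _ = 4 * (r ^ (α - 3) / (3 - α)) + 2 * (r ^ (α - 3) * r / (2 - α)) := by
          rw [show α - 4 + 1 = α - 3 by ring, show α - 3 + 1 = α - 2 by ring,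
            show r ^ (α - 3) * r = r ^ (α - 2) by rw [← Real.rpow_add_one hr0.ne']; ring_nf,
            ← neg_div_neg_eq (-r ^ (α - 3)), ← neg_div_neg_eq (-r ^ (α - 2))]
          ring_nf
      _ ≤ 4 * (r ^ (α - 3) / 1) + 2 * (r ^ (α - 3) * 2 / 1) := by
          gcongr <;> linarith
      _ = _ := by ring
  rw [hsr]
  calc _ ≤ M * r ^ (α - 3) + 8 * r ^ (α - 3) := add_le_add I1 I2
    _ = _ := by ring

/-- The single block `r < t ≤ 2r` with `r = √(1 - w)` already has the right size, because there the
denominator is comparable to `1 - w` and `sinh t ≥ t`. -/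
lemma le_kerProfileD_two {α : ℝ} (hα : 0 < α) :
    ∃ c > 0, ∀ w, -1 ≤ w → w < 1 → c * (1 - w) ^ ((α - 3) / 2) ≤ kerProfileD α 2 w := by
  set M := Real.cosh 2
  have hM : 0 < M := Real.cosh_pos 2
  refine ⟨1 / (2 * M ^ 2 + 1) ^ 2, by positivity, fun w hw1 hw => ?_⟩
  set s := 1 - w with hs
  have hs0 : 0 < s := by linarith
  have hs2 : s ≤ 2 := by linarith
  set r := √s with hr
  have hr0 : 0 < r := Real.sqrt_pos.2 hs0
  have hr2 : r ≤ 2 := Real.sqrt_le_iff.2 ⟨by norm_num, by linarith⟩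
  have hrs : r ^ 2 = s := Real.sq_sqrt hs0.le
  have hsr : s ^ ((α - 3) / 2) = r ^ (α - 3) := by
    rw [← hrs, ← Real.rpow_natCast, ← Real.rpow_mul hr0.le]; congr 1; push_cast; ring
  have hint := integrableOn_kerProfileD hα le_rfl hw
  set b := r ^ α / ((2 * M ^ 2 + 1) * s) ^ 2 with hb
  calc 1 / (2 * M ^ 2 + 1) ^ 2 * s ^ ((α - 3) / 2) = ∫ t in Ioc r (2 * r), b := by
        rw [setIntegral_const, Measure.real, Real.volume_Ioc, ENNReal.toReal_ofReal (by linarith),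
          smul_eq_mul, hsr, hb]
        have : r ^ α = r ^ (α - 3) * r ^ 3 := by
          rw [← Real.rpow_natCast, ← Real.rpow_add hr0]; congr 1; push_cast; ring
        rw [this, ← hrs]
        field_simp
        ring
    _ ≤ ∫ t in Ioc r (2 * r), t ^ (α - 1) * (Real.sinh t / (Real.cosh t - w) ^ 2) := by
        refine setIntegral_mono_on (by simp) (hint.mono_set
          (Ioc_subset_Ioi_self.trans (Ioi_subset_Ioi hr0.le))) measurableSet_Ioc fun t ht => ?_
        have ht0 : 0 < t := hr0.trans ht.1
        have hp := (Real.rpow_pos_of_pos ht0 (α - 1)).le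
        have hc := cosh_sub_pos hw t
        have hden : Real.cosh t - w ≤ (2 * M ^ 2 + 1) * s := by
          have h1 : Real.cosh t - 1 ≤ 2 * (r * M) ^ 2 := by
            rw [cosh_sub_one_eq]
            have h2 : Real.sinh (t / 2) ≤ r * M := by
              refine (sinh_le_mul_cosh (by linarith)).trans ?_
              have : Real.cosh (t / 2) ≤ M := Real.cosh_le_cosh.2 (by
                rw [abs_of_pos (by linarith), abs_of_pos two_pos]; linarith [ht.2])
              have := ht.2
              gcongr
              linarith
            have h3 := Real.sinh_nonneg_iff.2 (by linarith : 0 ≤ t / 2)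
            gcongr
          rw [mul_pow, hrs] at h1
          linarith
        have h4 : t ≤ Real.sinh t := (Real.self_lt_sinh_iff.2 ht0).le
        calc b ≤ t ^ α / ((2 * M ^ 2 + 1) * s) ^ 2 := by
              rw [hb]; gcongr; exact ht.1.le
          _ = t ^ (α - 1) * (t / ((2 * M ^ 2 + 1) * s) ^ 2) := by
              rw [← mul_div_assoc, ← Real.rpow_add_one ht0.ne']; ring_nf
          _ ≤ _ := by gcongr
    _ ≤ kerProfileD α 2 w := by
        refine setIntegral_mono_set hint ?_
          (Ioc_subset_Ioi_self.trans (Ioi_subset_Ioi hr0.le)).eventuallyLE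
        refine (ae_restrict_iff' measurableSet_Ioi).2 (ae_of_all _ fun t ht => ?_)
        have hs := (Real.sinh_pos_iff.2 ht).le
        have hp := (Real.rpow_pos_of_pos ht (α - 1)).le
        have := (cosh_sub_pos hw t).le
        simp only [Pi.zero_apply]
        positivity

/-- This integrates the bound on the derivative: `B (1 - w)^((α-1)/2) - G` is monotone. The value at
`-1` is absorbed because the power is bounded below on `[-1, 1)`. -/
lemma abs_kerProfile_le {α : ℝ} (hα : 0 < α) (hα1 : α < 1) :
    ∃ C > 0, ∀ w, -1 ≤ w → w < 1 → |kerProfile α w| ≤ C * (1 - w) ^ ((α - 1) / 2) := by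
  obtain ⟨C, hC, hG⟩ := kerProfileD_two_le hα hα1
  set B := C * (2 / (1 - α)) with hB
  have hB0 : 0 < B := by have : 0 < 1 - α := by linarith
                         positivity
  have hder : ∀ w < 1, HasDerivAt (fun w => B * (1 - w) ^ ((α - 1) / 2) - kerProfile α w)
      (C * (1 - w) ^ ((α - 3) / 2) - kerProfileD α 2 w) w := by
    intro w hw
    have h1 := ((hasDerivAt_id w).const_sub 1).rpow_const (p := (α - 1) / 2)
      (Or.inl (by simp only [id]; linarith))
    refine ((h1.const_mul B).sub (hasDerivAt_kerProfile hα hw)).congr_deriv ?_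
    simp only [id]
    rw [show (α - 1) / 2 - 1 = (α - 3) / 2 by ring, hB]
    have : 1 - α ≠ 0 := by linarith
    field_simp
    ring
  have hmono : MonotoneOn (fun w => B * (1 - w) ^ ((α - 1) / 2) - kerProfile α w) (Ico (-1) 1) := by
    refine monotoneOn_of_deriv_nonneg (convex_Ico _ _)
      (fun x hx => (hder x hx.2).continuousAt.continuousWithinAt)
      (fun x hx => (hder x (interior_subset hx).2).differentiableAt.differentiableWithinAt)
      fun x hx => ?_
    have hx' := interior_subset hx
    rw [(hder x hx'.2).deriv]
    linarith [hG x hx'.1 hx'.2]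
  have hmono2 : MonotoneOn (kerProfile α) (Ico (-1) 1) := by
    refine monotoneOn_of_deriv_nonneg (convex_Ico _ _)
      (fun x hx => (hasDerivAt_kerProfile hα hx.2).continuousAt.continuousWithinAt)
      (fun x hx => (hasDerivAt_kerProfile hα
        (interior_subset hx).2).differentiableAt.differentiableWithinAt)
      fun x hx => ?_
    rw [(hasDerivAt_kerProfile hα (interior_subset hx).2).deriv]
    exact kerProfileD_nonneg (interior_subset hx).2 2
  set m := |kerProfile α (-1)|
  have h2 : 0 < (2 : ℝ) ^ ((α - 1) / 2) := by positivity
  refine ⟨B + m / 2 ^ ((α - 1) / 2), by positivity, fun w hw1 hw => ?_⟩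
  have e1 := hmono (left_mem_Ico.2 (by norm_num)) ⟨hw1, hw⟩ hw1
  have e2 := hmono2 (left_mem_Ico.2 (by norm_num)) ⟨hw1, hw⟩ hw1
  have hs : 0 < 1 - w := by linarith
  have h3 : (2 : ℝ) ^ ((α - 1) / 2) ≤ (1 - w) ^ ((α - 1) / 2) :=
    Real.rpow_le_rpow_of_nonpos hs (by linarith) (by linarith)
  have h4 : m ≤ m / 2 ^ ((α - 1) / 2) * (1 - w) ^ ((α - 1) / 2) := by
    rw [div_mul_eq_mul_div, le_div_iff₀ h2]
    have : 0 ≤ m := abs_nonneg _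
    gcongr
  simp only at e1
  have h5 : 0 ≤ B * (1 - -1 : ℝ) ^ ((α - 1) / 2) := by
    have : (0 : ℝ) ≤ (1 - -1 : ℝ) ^ ((α - 1) / 2) := by norm_num; positivity
    positivity
  have h6 : 0 ≤ B * (1 - w) ^ ((α - 1) / 2) := by positivity
  rw [abs_le]
  constructor
  · linarith [neg_abs_le (kerProfile α (-1))]
  · linarith [le_abs_self (kerProfile α (-1))]

/-! ### The convolution kernel on the torus. -/

/-- The convolution kernel of `|D|^{-α}` on the torus. -/
noncomputable def fracKernel (α x : ℝ) : ℝ :=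
  1 / (2 * Real.pi * Real.Gamma α) * kerProfile α (Real.cos x)

/-- Convolution with `fracKernel`. -/
noncomputable def fracInt (α : ℝ) (φ : ℝ → ℝ) (x : ℝ) : ℝ :=
  ∫ y in (-Real.pi)..Real.pi, fracKernel α y * φ (x - y)

lemma fracKernel_neg (α x : ℝ) : fracKernel α (-x) = fracKernel α x := by simp [fracKernel]

lemma fracKernel_periodic (α : ℝ) : Function.Periodic (fracKernel α) (2 * Real.pi) := fun x => by
  simp [fracKernel]

lemma one_sub_cos_lower {x : ℝ} (hx : |x| ≤ Real.pi) : 2 / Real.pi ^ 2 * x ^ 2 ≤ 1 - Real.cos x := by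
  linarith [Real.cos_le_one_sub_mul_cos_sq hx]

lemma cos_lt_one_of_abs_le {x : ℝ} (hx : |x| ≤ Real.pi) (h0 : x ≠ 0) : Real.cos x < 1 := by
  have := one_sub_cos_lower hx
  have : 0 < 2 / Real.pi ^ 2 * x ^ 2 := by positivity
  linarith

lemma one_sub_cos_rpow_le {a x : ℝ} (ha : a ≤ 0) (hx : |x| ≤ Real.pi) (h0 : x ≠ 0) :
    (1 - Real.cos x) ^ (a / 2) ≤ (2 / Real.pi ^ 2) ^ (a / 2) * |x| ^ a := by
  have h1 : |x| ^ a = (x ^ 2) ^ (a / 2) := by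
    rw [← sq_abs, ← Real.rpow_natCast, ← Real.rpow_mul (abs_nonneg x)]
    congr 1; push_cast; ring
  rw [h1, ← Real.mul_rpow (by positivity) (by positivity)]
  exact Real.rpow_le_rpow_of_nonpos (by positivity) (one_sub_cos_lower hx) (by linarith)

lemma le_one_sub_cos_rpow {a x : ℝ} (ha : a ≤ 0) (hx : |x| ≤ Real.pi) (h0 : x ≠ 0) :
    |x| ^ a ≤ (1 - Real.cos x) ^ (a / 2) := by
  have h1 : |x| ^ a = (x ^ 2) ^ (a / 2) := by
    rw [← sq_abs, ← Real.rpow_natCast, ← Real.rpow_mul (abs_nonneg x)]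
    congr 1; push_cast; ring
  rw [h1]
  refine Real.rpow_le_rpow_of_nonpos (by linarith [cos_lt_one_of_abs_le hx h0]) ?_ (by linarith)
  nlinarith [Real.one_sub_sq_div_two_le_cos (x := x), sq_nonneg x]

lemma abs_fracKernel_le {α : ℝ} (hα : 0 < α) (hα1 : α < 1) :
    ∃ C > 0, ∀ x, |x| ≤ Real.pi → x ≠ 0 → |fracKernel α x| ≤ C * |x| ^ (α - 1) := by
  obtain ⟨C, hC, h⟩ := abs_kerProfile_le hα hα1
  have hΓ := Real.Gamma_pos_of_pos hα
  have hπ := Real.pi_pos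
  refine ⟨1 / (2 * Real.pi * Real.Gamma α) * (C * (2 / Real.pi ^ 2) ^ ((α - 1) / 2)),
    by positivity, fun x hx h0 => ?_⟩
  rw [fracKernel, abs_mul, abs_of_pos (by positivity), mul_assoc (1 / _)]
  refine mul_le_mul_of_nonneg_left ?_ (by positivity)
  refine (h _ (Real.neg_one_le_cos x) (cos_lt_one_of_abs_le hx h0)).trans ?_
  rw [mul_assoc]
  exact mul_le_mul_of_nonneg_left (one_sub_cos_rpow_le (by linarith) hx h0) hC.le

lemma measurable_kerProfile (α : ℝ) : Measurable (kerProfile α) := by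
  have h1 := Real.continuous_sinh.measurable
  have h2 := Real.continuous_cosh.measurable
  have : StronglyMeasurable (fun q : ℝ × ℝ =>
      q.2 ^ (α - 1) * (Real.sinh q.2 / (Real.cosh q.2 - q.1) - 1)) := by
    refine Measurable.stronglyMeasurable ?_
    fun_prop
  exact (this.integral_prod_right' (ν := volume.restrict (Ioi (0 : ℝ)))).measurable

lemma measurable_fracKernel (α : ℝ) : Measurable (fracKernel α) :=
  ((measurable_kerProfile α).comp Real.measurable_cos).const_mul _

lemma intervalIntegrable_abs_rpow {a : ℝ} (ha : -1 < a) (x y : ℝ) :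
    IntervalIntegrable (fun t : ℝ => |t| ^ a) volume x y := by
  have h0 : ∀ z, 0 ≤ z → IntervalIntegrable (fun t : ℝ => |t| ^ a) volume 0 z := by
    intro z hz
    refine (intervalIntegral.intervalIntegrable_rpow' (a := 0) (b := z) ha).congr ?_
    intro t ht
    rw [uIoc_of_le hz] at ht
    simp only [abs_of_pos ht.1]
  have h1 : ∀ z, IntervalIntegrable (fun t : ℝ => |t| ^ a) volume 0 z := by
    intro z
    rcases le_total 0 z with hz | hz
    · exact h0 z hz
    · have := (h0 (-z) (by linarith)).comp_sub_left 0
      simpa using this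
  exact (h1 x).symm.trans (h1 y)

lemma intervalIntegrable_fracKernel {α : ℝ} (hα : 0 < α) (hα1 : α < 1) :
    IntervalIntegrable (fracKernel α) volume (-Real.pi) Real.pi := by
  obtain ⟨C, hC, h⟩ := abs_fracKernel_le hα hα1
  have hi := (intervalIntegrable_abs_rpow (a := α - 1) (by linarith)
    (-Real.pi) Real.pi).const_mul C
  refine hi.mono_fun (measurable_fracKernel α).aestronglyMeasurable ?_
  rw [uIoc_of_le (by linarith [Real.pi_pos])]
  refine (ae_restrict_iff' measurableSet_Ioc).2 ?_
  filter_upwards [compl_mem_ae_iff.2 (measure_singleton (0 : ℝ))] with x hx hx2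
  refine (h x (abs_le.2 ⟨hx2.1.le, hx2.2⟩) hx).trans (le_abs_self _)

/-! ### Poisson integrals and the Fourier coefficients of the kernel. -/

lemma continuous_poisson {t : ℝ} (ht : 0 < t) :
    Continuous (fun y => Real.sinh t / (Real.cosh t - Real.cos y)) := by
  refine continuous_const.div (by fun_prop) fun y => ?_
  have := Real.one_lt_cosh.2 ht.ne'
  linarith [Real.cos_le_one y]

lemma continuous_poisson_mul_cos {t : ℝ} (ht : 0 < t) (m : ℕ) : Continuous (fun y =>
    Real.sinh t / (Real.cosh t - Real.cos y) * Real.cos (m * y)) :=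
  (continuous_poisson ht).mul (by fun_prop)

/-- Poisson's formula for `z ^ m` at the point `e^{-t}` of the unit disc. Dividing the Poisson
kernel `(1 - r²) / |e^{iθ} - r|²`, `r = e^{-t}`, through by `2r` gives the hyperbolic form. -/
lemma integral_poisson_mul_cos {t : ℝ} (ht : 0 < t) (m : ℕ) :
    ∫ y in (-Real.pi)..Real.pi, Real.sinh t / (Real.cosh t - Real.cos y) * Real.cos (m * y) =
      2 * Real.pi * Real.exp (-(m * t)) := by
  have hd : DiffContOnCl ℂ (fun z : ℂ => z ^ m) (Metric.ball 0 1) :=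
    DifferentiableOn.diffContOnCl (by fun_prop)
  have hw : ((Real.exp (-t) : ℝ) : ℂ) ∈ Metric.ball (0 : ℂ) 1 := by
    rw [mem_ball_zero_iff, Complex.norm_real, Real.norm_of_nonneg (Real.exp_pos _).le]
    exact (Real.exp_lt_exp.2 (by linarith : -t < 0)).trans_eq Real.exp_zero
  have key := hd.circleAverage_poissonKernel_smul' hw
  rw [Real.circleAverage] at key
  have hker : ∀ θ : ℝ, ((‖circleMap 0 1 θ - 0‖ ^ 2 - ‖((Real.exp (-t) : ℝ) : ℂ) - 0‖ ^ 2) /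
      ‖(circleMap 0 1 θ - 0) - (((Real.exp (-t) : ℝ) : ℂ) - 0)‖ ^ 2) =
      Real.sinh t / (Real.cosh t - Real.cos θ) := by
    intro θ
    have h1 : ‖circleMap 0 1 θ‖ = 1 := by simp
    have h2 : ‖((Real.exp (-t) : ℝ) : ℂ)‖ = Real.exp (-t) := by
      rw [Complex.norm_real, Real.norm_of_nonneg (Real.exp_pos _).le]
    have h3 : ‖circleMap 0 1 θ - ((Real.exp (-t) : ℝ) : ℂ)‖ ^ 2 =
        1 - 2 * Real.exp (-t) * Real.cos θ + Real.exp (-t) ^ 2 := by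
      rw [← Complex.normSq_eq_norm_sq, Complex.normSq_apply]
      simp only [circleMap, Complex.ofReal_one, one_mul, zero_add, Complex.sub_re, Complex.sub_im,
        Complex.exp_ofReal_mul_I_re, Complex.exp_ofReal_mul_I_im, Complex.ofReal_re,
        Complex.ofReal_im]
      nlinarith [Real.sin_sq_add_cos_sq θ]
    rw [sub_zero, sub_zero, h1, h2, h3, Real.sinh_eq, Real.cosh_eq]
    have he : Real.exp t * Real.exp (-t) = 1 := by rw [← Real.exp_add]; simp
    set e := Real.exp (-t)
    have hepos : 0 < e := Real.exp_pos _
    have het : Real.exp t = 1 / e := by field_simp; exact he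
    have he1 : e < 1 := (Real.exp_lt_exp.2 (by linarith : -t < 0)).trans_eq Real.exp_zero
    have hne : 1 - 2 * e * Real.cos θ + e ^ 2 ≠ 0 := by
      nlinarith [Real.cos_le_one θ, mul_pos hepos hepos]
    have hne2 : (1 / e + e) / 2 - Real.cos θ ≠ 0 := by
      have : (1 / e + e) / 2 - Real.cos θ = (1 - 2 * e * Real.cos θ + e ^ 2) / (2 * e) := by
        field_simp; ring
      rw [this]; positivity
    rw [het, div_eq_div_iff hne hne2]
    field_simp
    ring
  simp only [hker] at key
  have key2 := congrArg Complex.re key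
  have hpow : ∀ θ : ℝ, ((Real.sinh t / (Real.cosh t - Real.cos θ)) • circleMap 0 1 θ ^ m : ℂ).re =
      Real.sinh t / (Real.cosh t - Real.cos θ) * Real.cos (m * θ) := by
    intro θ
    rw [Complex.smul_re, smul_eq_mul]
    congr 1
    simp only [circleMap, Complex.ofReal_one, one_mul, zero_add]
    rw [← Complex.exp_nat_mul, ← mul_assoc]
    have := Complex.exp_ofReal_mul_I_re (m * θ)
    push_cast at this
    exact this
  have hint : IntervalIntegrable (fun θ : ℝ => ((Real.sinh t / (Real.cosh t - Real.cos θ)) •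
      circleMap 0 1 θ ^ m : ℂ)) volume 0 (2 * Real.pi) := by
    refine Continuous.intervalIntegrable ?_ _ _
    exact (continuous_poisson ht).smul ((continuous_circleMap 0 1).pow m)
  rw [Complex.smul_re] at key2
  have hre : (∫ θ in (0 : ℝ)..2 * Real.pi, ((Real.sinh t / (Real.cosh t - Real.cos θ)) •
      circleMap 0 1 θ ^ m : ℂ)).re = ∫ θ in (0 : ℝ)..2 * Real.pi,
      Real.sinh t / (Real.cosh t - Real.cos θ) * Real.cos (m * θ) := by
    rw [← Complex.reCLM_apply, ← Complex.reCLM.intervalIntegral_comp_comm hint]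
    simp only [Complex.reCLM_apply, hpow]
  rw [hre] at key2
  have hper : Function.Periodic (fun y : ℝ =>
      Real.sinh t / (Real.cosh t - Real.cos y) * Real.cos (m * y)) (2 * Real.pi) := by
    intro y
    simp only [Real.cos_add_two_pi]
    rw [mul_add, Real.cos_add_nat_mul_two_pi]
  have hs := hper.intervalIntegral_add_eq (-Real.pi) 0
  rw [show -Real.pi + 2 * Real.pi = Real.pi by ring, zero_add] at hs
  rw [hs]
  have hrhs : ((((Real.exp (-t) : ℝ) : ℂ)) ^ m).re = Real.exp (-(m * t)) := by
    rw [← Complex.ofReal_pow, Complex.ofReal_re, ← Real.exp_nat_mul]; ring_nf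
  rw [hrhs, smul_eq_mul] at key2
  rw [← key2]
  have := Real.pi_pos
  field_simp

/-- This justifies exchanging the `t` and `y` integrals. It rests on the `L¹` norm in `y` of the
Poisson kernel minus its mean being `O(e^{-t})`. -/
lemma integrable_prod_poisson {α : ℝ} (hα : 0 < α) {g : ℝ → ℝ} (hg : Continuous g)
    (hg1 : ∀ y, |g y| ≤ 1) :
    Integrable (fun q : ℝ × ℝ => q.1 ^ (α - 1) *
      ((Real.sinh q.1 / (Real.cosh q.1 - Real.cos q.2) - 1) * g q.2))
      ((volume.restrict (Ioi 0)).prod (volume.restrict (Ioc (-Real.pi) Real.pi))) := by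
  have h1 := Real.continuous_sinh.measurable
  have h2 := Real.continuous_cosh.measurable
  have h3 := hg.measurable
  have hmeas : AEStronglyMeasurable (fun q : ℝ × ℝ => q.1 ^ (α - 1) *
      ((Real.sinh q.1 / (Real.cosh q.1 - Real.cos q.2) - 1) * g q.2))
      ((volume.restrict (Ioi 0)).prod (volume.restrict (Ioc (-Real.pi) Real.pi))) := by
    refine Measurable.aestronglyMeasurable ?_
    fun_prop
  have hπ := Real.pi_pos
  have hii : ∀ t : ℝ, 0 < t → IntegrableOn (fun y =>
      (Real.sinh t / (Real.cosh t - Real.cos y) - 1) * g y) (Ioc (-Real.pi) Real.pi) :=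
    fun t ht => ((((continuous_poisson ht).sub continuous_const).mul hg).integrableOn_Icc).mono_set
      Ioc_subset_Icc_self
  rw [integrable_prod_iff hmeas]
  refine ⟨(ae_restrict_iff' measurableSet_Ioi).2 (ae_of_all _ fun t ht => (hii t ht).const_mul (t ^ (α - 1))),
    ?_⟩
  obtain ⟨D, hD⟩ : ∃ D, ∀ t : ℝ, 0 < t →
      ∫ y in Ioc (-Real.pi) Real.pi, |(Real.sinh t / (Real.cosh t - Real.cos y) - 1) * g y| ≤
        D * Real.exp (-t) := by
    have hc1 : 0 < Real.cosh 1 - 1 := by linarith [Real.one_lt_cosh.2 one_ne_zero]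
    refine ⟨max (4 * Real.pi * Real.exp 1) (8 * Real.pi / (1 - 1 / Real.cosh 1)), fun t ht => ?_⟩
    have hct := Real.one_lt_cosh.2 ht.ne'
    rcases le_total t 1 with ht1 | ht1
    -- For `t ≤ 1` no uniform pointwise bound is available, but the Poisson kernel is positive with
    -- total mass `2π`, and the subtracted constant contributes another `2π`.
    · calc _ ≤ ∫ y in Ioc (-Real.pi) Real.pi,
              (Real.sinh t / (Real.cosh t - Real.cos y) * Real.cos ((0 : ℕ) * y) + 1) := by
            refine setIntegral_mono_on (hii t ht).abs ?_ measurableSet_Ioc fun y _ => ?_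
            · refine (Continuous.integrableOn_Icc ?_).mono_set Ioc_subset_Icc_self
              exact (continuous_poisson_mul_cos ht 0).add continuous_const
            · rw [abs_mul]
              have hpos : 0 ≤ Real.sinh t / (Real.cosh t - Real.cos y) :=
                div_nonneg (Real.sinh_pos_iff.2 ht).le (by linarith [Real.cos_le_one y])
              calc _ ≤ |Real.sinh t / (Real.cosh t - Real.cos y) - 1| * 1 := by
                    gcongr; exact hg1 y
                _ ≤ _ := by
                  simp only [Nat.cast_zero, zero_mul, Real.cos_zero, mul_one]
                  rw [abs_le]; constructor <;> linarith
        _ = 4 * Real.pi := by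
            rw [← intervalIntegral.integral_of_le (by linarith), intervalIntegral.integral_add
              ((continuous_poisson_mul_cos ht 0).intervalIntegrable _ _) (by simp),
              integral_poisson_mul_cos ht 0]
            simp; ring
        _ ≤ 4 * Real.pi * Real.exp 1 * Real.exp (-t) := by
            rw [mul_assoc, ← Real.exp_add]
            have : 1 ≤ Real.exp (1 + -t) := Real.one_le_exp (by linarith)
            nlinarith
        _ ≤ _ := by gcongr; exact le_max_left _ _
    · have hc1t : Real.cosh 1 ≤ Real.cosh t := Real.cosh_le_cosh.2 (by
        rw [abs_of_pos ht, abs_one]; exact ht1)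
      have hb : ∀ y, |(Real.sinh t / (Real.cosh t - Real.cos y) - 1) * g y| ≤
          4 / (1 - 1 / Real.cosh 1) * Real.exp (-t) := by
        intro y
        have hc := Real.cosh_pos t
        have hcc := Real.cosh_pos 1
        rw [abs_mul]
        have e : Real.sinh t / (Real.cosh t - Real.cos y) - 1 =
            (Real.cos y - Real.exp (-t)) / (Real.cosh t - Real.cos y) := by
          have : Real.cosh t - Real.cos y ≠ 0 := by linarith [Real.cos_le_one y]
          field_simp
          rw [Real.sinh_eq, Real.cosh_eq]; ring
        have hcpos : 0 < 1 - 1 / Real.cosh 1 := by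
          rw [sub_pos, div_lt_one hcc]; linarith
        calc _ ≤ |Real.sinh t / (Real.cosh t - Real.cos y) - 1| * 1 := by gcongr; exact hg1 y
          _ ≤ 2 / ((1 - 1 / Real.cosh 1) * Real.cosh t) := by
            rw [mul_one, e, abs_div, abs_of_pos (by linarith [Real.cos_le_one y] :
              0 < Real.cosh t - Real.cos y)]
            gcongr
            · have := Real.exp_le_one_iff.2 (by linarith : -t ≤ 0)
              rw [abs_le]; constructor <;>
                linarith [Real.cos_le_one y, Real.neg_one_le_cos y, Real.exp_pos (-t)]
            · have : 1 ≤ Real.cosh t / Real.cosh 1 := by rw [le_div_iff₀ hcc]; linarith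
              calc (1 - 1 / Real.cosh 1) * Real.cosh t
                  = Real.cosh t - Real.cosh t / Real.cosh 1 := by ring
                _ ≤ _ := by linarith [Real.cos_le_one y]
          _ = 2 / (1 - 1 / Real.cosh 1) * (Real.cosh t)⁻¹ := by field_simp
          _ ≤ 2 / (1 - 1 / Real.cosh 1) * (2 * Real.exp (-t)) := by
            gcongr; exact inv_cosh_le t
          _ = _ := by ring
      calc _ ≤ ∫ y in Ioc (-Real.pi) Real.pi, 4 / (1 - 1 / Real.cosh 1) * Real.exp (-t) :=
            setIntegral_mono_on (hii t ht).abs (integrableOn_const (by simp)) measurableSet_Ioc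
            fun y _ => hb y
        _ = 8 * Real.pi / (1 - 1 / Real.cosh 1) * Real.exp (-t) := by
            rw [setIntegral_const, Measure.real, Real.volume_Ioc,
              ENNReal.toReal_ofReal (by linarith), smul_eq_mul]; ring
        _ ≤ _ := by gcongr; exact le_max_right _ _
  refine (integrableOn_rpow_mul_exp hα D).mono' hmeas.norm.integral_prod_right' ?_
  refine (ae_restrict_iff' measurableSet_Ioi).2 (ae_of_all _ fun t ht => ?_)
  have hp := (Real.rpow_pos_of_pos ht (α - 1)).le
  rw [Real.norm_of_nonneg (integral_nonneg fun y => norm_nonneg _)]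
  simp only [norm_mul, Real.norm_eq_abs, abs_of_nonneg hp]
  rw [integral_const_mul]
  have := hD t ht
  simp only [abs_mul] at this
  gcongr

/-- After exchanging the integrals, the inner one is `2π e^{-mt}` for `m ≠ 0` and vanishes for `m =
0` thanks to the subtracted mean. The outer one is then a Gamma integral, whose value cancels the
normalisation. -/
lemma integral_fracKernel_mul_cos {α : ℝ} (hα : 0 < α) (m : ℕ) :
    ∫ y in (-Real.pi)..Real.pi, fracKernel α y * Real.cos (m * y) =
      if m = 0 then 0 else (m : ℝ) ^ (-α) := by
  have hπ := Real.pi_pos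
  have hΓ := Real.Gamma_pos_of_pos hα
  have hsw := integral_integral_swap (f := fun t y => t ^ (α - 1) *
      ((Real.sinh t / (Real.cosh t - Real.cos y) - 1) * Real.cos (m * y)))
    (integrable_prod_poisson hα
    (g := fun y => Real.cos (m * y)) (by fun_prop) (fun y => Real.abs_cos_le_one _))
  have hK : ∀ y, fracKernel α y * Real.cos (m * y) = 1 / (2 * Real.pi * Real.Gamma α) *
      ∫ t in Ioi (0 : ℝ), t ^ (α - 1) *
        ((Real.sinh t / (Real.cosh t - Real.cos y) - 1) * Real.cos (m * y)) := by
    intro y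
    rw [fracKernel, kerProfile, mul_assoc, ← integral_mul_const]
    simp only [mul_assoc]
  simp only [hK]
  rw [intervalIntegral.integral_const_mul, intervalIntegral.integral_of_le (by linarith), ← hsw]
  have hin : ∀ t ∈ Ioi (0 : ℝ), (∫ y in Ioc (-Real.pi) Real.pi, t ^ (α - 1) *
      ((Real.sinh t / (Real.cosh t - Real.cos y) - 1) * Real.cos (m * y))) =
      if m = 0 then 0 else 2 * Real.pi * (t ^ (α - 1) * Real.exp (-(m * t))) := by
    intro t ht
    rw [integral_const_mul, ← intervalIntegral.integral_of_le (by linarith)]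
    simp only [sub_mul, one_mul]
    rw [intervalIntegral.integral_sub ((continuous_poisson_mul_cos ht m).intervalIntegrable
      _ _) ((by fun_prop : Continuous fun y : ℝ => Real.cos (m * y)).intervalIntegrable _ _),
      integral_poisson_mul_cos ht m]
    split_ifs with hm
    · subst hm; simp; right; ring
    · have hm' : (m : ℝ) ≠ 0 := by exact_mod_cast hm
      rw [intervalIntegral.integral_comp_mul_left (fun y => Real.cos y) hm', integral_cos]
      have h1 : Real.sin (m * Real.pi) = 0 := Real.sin_nat_mul_pi m
      simp [h1]
      ring
  rw [setIntegral_congr_fun measurableSet_Ioi hin]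
  split_ifs with hm
  · simp
  · have hm' : (0 : ℝ) < m := by exact_mod_cast Nat.pos_of_ne_zero hm
    rw [integral_const_mul, Real.integral_rpow_mul_exp_neg_mul_Ioi hα hm', Real.rpow_neg hm'.le,
      Real.div_rpow zero_le_one hm'.le, Real.one_rpow]
    field_simp

/-! ### The Fourier multiplier as a convolution. -/

lemma torusFourierCoeff_eq (u : ℝ → ℝ) (k : ℤ) :
    torusFourierCoeff u k = ((1 / (2 * Real.pi) : ℝ) : ℂ) *
      ∫ x in (-Real.pi)..Real.pi, Complex.exp (-(k * x : ℝ) * Complex.I) * u x := by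
  rw [torusFourierCoeff, fourierCoeffOn_eq_integral, Complex.real_smul]
  congr 1
  · norm_num; ring
  · refine intervalIntegral.integral_congr fun x _ => ?_
    simp only [smul_eq_mul]
    congr 1
    rw [fourier_coe_apply]
    congr 1
    have := Real.pi_pos.ne'
    have h2 : ((Real.pi - -Real.pi : ℝ) : ℂ) = 2 * Real.pi := by push_cast; ring
    rw [h2]
    have h3 : (Real.pi : ℂ) ≠ 0 := by exact_mod_cast this
    push_cast
    field_simp

lemma exists_bound_of_periodic {f : ℝ → ℝ} (hf : Continuous f)
    (hp : Function.Periodic f (2 * Real.pi)) : ∃ B > 0, ∀ x, |f x| ≤ B := by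
  obtain ⟨B, hB⟩ := (isCompact_Icc (a := (0 : ℝ)) (b := 2 * Real.pi)).exists_bound_of_continuousOn
    hf.continuousOn
  refine ⟨max B 1, by positivity, fun x => ?_⟩
  obtain ⟨y, hy, hxy⟩ := hp.exists_mem_Ico₀ (by positivity) x
  rw [hxy]
  exact (hB y ⟨hy.1, hy.2.le⟩).trans (le_max_left _ _)

/-- The difference is continuous with vanishing, hence summable, Fourier coefficients, so its
Fourier series converges to it pointwise and is zero. -/
lemma eq_of_torusFourierCoeff_eq {f g : ℝ → ℝ} (hf : Continuous f) (hg : Continuous g)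
    (hfp : Function.Periodic f (2 * Real.pi)) (hgp : Function.Periodic g (2 * Real.pi))
    (h : ∀ k, torusFourierCoeff f k = torusFourierCoeff g k) : f = g := by
  have hT : Real.pi - -Real.pi = 2 * Real.pi := by ring
  have : Fact (0 < 2 * Real.pi) := ⟨by positivity⟩
  let d : ℝ → ℂ := fun x => ((f x - g x : ℝ) : ℂ)
  have hd : Continuous d := Complex.continuous_ofReal.comp (hf.sub hg)
  have hdp : Function.Periodic d (2 * Real.pi) := fun x => by simp only [d, hfp x, hgp x]
  let F : C(AddCircle (2 * Real.pi), ℂ) :=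
    ⟨hdp.lift, continuous_coinduced_dom.2 (by exact hd)⟩
  have hFd : ∀ x : ℝ, F (x : AddCircle (2 * Real.pi)) = d x := fun x => hdp.lift_coe x
  have hc : ∀ k, fourierCoeff F k = 0 := by
    intro k
    have e := h k
    rw [torusFourierCoeff_eq, torusFourierCoeff_eq] at e
    have hne : ((1 / (2 * Real.pi) : ℝ) : ℂ) ≠ 0 := by
      have := Real.pi_pos
      exact_mod_cast (by positivity : (1 / (2 * Real.pi) : ℝ) ≠ 0)
    have e2 := mul_left_cancel₀ hne e
    rw [fourierCoeff_eq_intervalIntegral _ _ (-Real.pi),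
      show -Real.pi + 2 * Real.pi = Real.pi by ring]
    have e3 : ∫ x in (-Real.pi)..Real.pi, fourier (-k) (x : AddCircle (2 * Real.pi)) • F x =
        (∫ x in (-Real.pi)..Real.pi, Complex.exp (-(k * x : ℝ) * Complex.I) * f x) -
        ∫ x in (-Real.pi)..Real.pi, Complex.exp (-(k * x : ℝ) * Complex.I) * g x := by
      rw [← intervalIntegral.integral_sub
        (Continuous.intervalIntegrable (by fun_prop) _ _)
        (Continuous.intervalIntegrable (by fun_prop) _ _)]
      refine intervalIntegral.integral_congr fun x _ => ?_
      simp only [smul_eq_mul]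
      rw [hFd, fourier_coe_apply, ← mul_sub]
      have h3 : (Real.pi : ℂ) ≠ 0 := by exact_mod_cast Real.pi_pos.ne'
      congr 1
      · congr 1
        push_cast
        field_simp
      · simp [d]
    rw [e3, e2, sub_self, smul_zero]
  have hsum : Summable (fourierCoeff F) := by
    rw [show fourierCoeff F = 0 from funext hc]; exact summable_zero
  funext x
  have h1 := has_pointwise_sum_fourier_series_of_summable hsum (x : AddCircle (2 * Real.pi))
  simp only [hc, zero_smul] at h1
  have h2 := h1.unique hasSum_zero
  rw [hFd] at h2
  have h3 : f x - g x = 0 := Complex.ofReal_eq_zero.1 h2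
  linarith

lemma continuous_fracInt {α : ℝ} (hα : 0 < α) (hα1 : α < 1) {φ : ℝ → ℝ} (hφ : Continuous φ)
    (hp : Function.Periodic φ (2 * Real.pi)) : Continuous (fracInt α φ) := by
  obtain ⟨B, hB, hb⟩ := exists_bound_of_periodic hφ hp
  refine intervalIntegral.continuous_of_dominated_interval
    (bound := fun y => |fracKernel α y| * B) (fun x => ?_) (fun x => ?_) ?_ ?_
  · exact ((measurable_fracKernel α).mul (hφ.measurable.comp
      (measurable_const.sub measurable_id))).aestronglyMeasurable
  · refine ae_of_all _ fun y _ => ?_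
    rw [norm_mul]
    exact mul_le_mul_of_nonneg_left (hb _) (norm_nonneg _)
  · exact (intervalIntegrable_fracKernel hα hα1).abs.mul_const B
  · exact ae_of_all _ fun y _ => by fun_prop

lemma fracInt_periodic (α : ℝ) {φ : ℝ → ℝ} (hp : Function.Periodic φ (2 * Real.pi)) :
    Function.Periodic (fracInt α φ) (2 * Real.pi) := by
  intro x
  refine intervalIntegral.integral_congr fun y _ => ?_
  rw [show x + 2 * Real.pi - y = x - y + 2 * Real.pi by ring, hp]

lemma integral_fracKernel_mul_exp {α : ℝ} (hα : 0 < α) (hα1 : α < 1) (k : ℤ) :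
    ∫ y in (-Real.pi)..Real.pi, Complex.exp (-(k * y : ℝ) * Complex.I) * fracKernel α y =
      ((if k = 0 then 0 else |(k : ℝ)| ^ (-α) : ℝ) : ℂ) := by
  have hK := intervalIntegrable_fracKernel hα hα1
  have hc : ∀ g : ℝ → ℝ, Continuous g →
      IntervalIntegrable (fun y => fracKernel α y * g y) volume (-Real.pi) Real.pi :=
    fun g hg => hK.mul_continuousOn hg.continuousOn
  have hsin : ∫ y in (-Real.pi)..Real.pi, fracKernel α y * Real.sin (k * y) = 0 := by
    have h := intervalIntegral.integral_comp_neg (a := -Real.pi) (b := Real.pi)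
      (fun y => fracKernel α y * Real.sin (k * y))
    simp only [fracKernel_neg, mul_neg, Real.sin_neg, neg_neg, intervalIntegral.integral_neg] at h
    linarith
  have hcos : ∫ y in (-Real.pi)..Real.pi, fracKernel α y * Real.cos (k * y) =
      if k = 0 then 0 else |(k : ℝ)| ^ (-α) := by
    have h := integral_fracKernel_mul_cos hα k.natAbs
    have hn : ((k.natAbs : ℕ) : ℝ) = |(k : ℝ)| := by
      rw [← Int.cast_abs, Int.abs_eq_natAbs]; simp
    rw [hn, ] at h
    simp only [Int.natAbs_eq_zero] at h
    rw [← h]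
    refine intervalIntegral.integral_congr fun y _ => ?_
    congr 1
    rcases abs_choice (k : ℝ) with h | h <;> rw [h]
    rw [neg_mul, Real.cos_neg]
  have e : ∀ y : ℝ, Complex.exp (-(k * y : ℝ) * Complex.I) * fracKernel α y =
      ((fracKernel α y * Real.cos (k * y) : ℝ) : ℂ) -
        ((fracKernel α y * Real.sin (k * y) : ℝ) : ℂ) * Complex.I := by
    intro y
    rw [← Complex.ofReal_neg, Complex.exp_mul_I, ← Complex.ofReal_cos, ← Complex.ofReal_sin,
      Real.cos_neg, Real.sin_neg]
    push_cast; ring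
  have hc' : ∀ g : ℝ → ℝ, Continuous g →
      IntervalIntegrable (fun y => ((fracKernel α y * g y : ℝ) : ℂ)) volume (-Real.pi) Real.pi :=
    fun g hg => ⟨(hc g hg).1.ofReal, (hc g hg).2.ofReal⟩
  simp only [e]
  rw [intervalIntegral.integral_sub (hc' _ (by fun_prop)) ((hc' _ (by fun_prop)).mul_const _), intervalIntegral.integral_mul_const,
    intervalIntegral.integral_ofReal, intervalIntegral.integral_ofReal, hsin, hcos]
  simp

/-- The convolution theorem: Fubini, followed by translation invariance of integrals over a period.
Boundedness of `φ` makes the double integral absolutely convergent. -/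
lemma torusFourierCoeff_fracInt {α : ℝ} (hα : 0 < α) (hα1 : α < 1) {φ : ℝ → ℝ}
    (hφ : Continuous φ) (hp : Function.Periodic φ (2 * Real.pi)) (k : ℤ) :
    torusFourierCoeff (fracInt α φ) k =
      ((if k = 0 then 0 else |(k : ℝ)| ^ (-α) : ℝ) : ℂ) * torusFourierCoeff φ k := by
  have hπ := Real.pi_pos
  obtain ⟨B, hB, hb⟩ := exists_bound_of_periodic hφ hp
  rw [torusFourierCoeff_eq, torusFourierCoeff_eq, ← integral_fracKernel_mul_exp hα hα1]
  have hle : -Real.pi ≤ Real.pi := by linarith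
  set E : ℝ → ℂ := fun x => Complex.exp (-(k * x : ℝ) * Complex.I) with hE
  have hEc : Continuous E := by rw [hE]; fun_prop
  have hEn : ∀ x, ‖E x‖ = 1 := fun x => by
    rw [hE]; simp only; rw [← Complex.ofReal_neg]; exact Complex.norm_exp_ofReal_mul_I _
  have hint : Integrable (Function.uncurry fun x y => E x * ((fracKernel α y : ℂ) * φ (x - y)))
      ((volume.restrict (Ioc (-Real.pi) Real.pi)).prod
        (volume.restrict (Ioc (-Real.pi) Real.pi))) := by
    have h1 : Integrable (fun q : ℝ × ℝ => (fracKernel α q.2 : ℂ))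
        ((volume.restrict (Ioc (-Real.pi) Real.pi)).prod
          (volume.restrict (Ioc (-Real.pi) Real.pi))) := by
      have := (intervalIntegrable_fracKernel hα hα1).1.ofReal (𝕜 := ℂ)
      exact this.comp_snd _
    have h2 := h1.bdd_mul (f := fun q : ℝ × ℝ => E q.1 * φ (q.1 - q.2)) (c := B)
      (Continuous.aestronglyMeasurable (by fun_prop)) (ae_of_all _ fun q => by
        rw [norm_mul, hEn, one_mul, Complex.norm_real]; exact hb _)
    refine h2.congr (ae_of_all _ fun q => ?_)
    simp only [Function.uncurry]; ring
  have hsw := integral_integral_swap hint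
  have e1 : ∫ x in (-Real.pi)..Real.pi, E x * (fracInt α φ x : ℂ) =
      ∫ x in Ioc (-Real.pi) Real.pi, ∫ y in Ioc (-Real.pi) Real.pi,
        E x * ((fracKernel α y : ℂ) * φ (x - y)) := by
    rw [intervalIntegral.integral_of_le hle]
    congr 1
    ext x
    rw [fracInt, ← intervalIntegral.integral_ofReal, intervalIntegral.integral_of_le hle,
      ← integral_const_mul]
    push_cast
    rfl
  rw [e1, hsw]
  have e2 : ∀ y : ℝ, ∫ x in Ioc (-Real.pi) Real.pi, E x * ((fracKernel α y : ℂ) * φ (x - y)) =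
      E y * fracKernel α y * ∫ x in (-Real.pi)..Real.pi, E x * φ x := by
    intro y
    rw [← intervalIntegral.integral_of_le hle]
    have hper : Function.Periodic (fun x => E x * (φ x : ℂ)) (2 * Real.pi) := by
      intro x
      simp only [hp x]
      congr 1
      rw [hE]
      simp only
      have : (-((k * (x + 2 * Real.pi) : ℝ) : ℂ) * Complex.I) =
          -((k * x : ℝ) : ℂ) * Complex.I + ((-k : ℤ) : ℂ) * (2 * Real.pi * Complex.I) := by
        push_cast; ring
      rw [this, Complex.exp_add, Complex.exp_int_mul_two_pi_mul_I, mul_one]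
    have h1 : ∫ x in (-Real.pi)..Real.pi, E x * φ x =
        ∫ x in (-Real.pi)..Real.pi, E (x - y) * φ (x - y) := by
      rw [intervalIntegral.integral_comp_sub_right (fun x => E x * (φ x : ℂ))]
      have h := hper.intervalIntegral_add_eq (-Real.pi) (-Real.pi - y)
      rw [show -Real.pi + 2 * Real.pi = Real.pi by ring,
        show -Real.pi - y + 2 * Real.pi = Real.pi - y by ring] at h
      exact h
    rw [h1, ← intervalIntegral.integral_const_mul]
    refine intervalIntegral.integral_congr fun x _ => ?_
    have : E x = E y * E (x - y) := by
      rw [hE]; simp only; rw [← Complex.exp_add]; congr 1; push_cast; ring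
    rw [this]; ring
  simp only [e2]
  rw [integral_mul_const, ← intervalIntegral.integral_of_le hle]
  ring

/-- `|D|^{-α}` is convolution with `fracKernel`. -/
theorem IsInvFracD.eq_fracInt {α : ℝ} (hα : 0 < α) (hα1 : α < 1) {φ v : ℝ → ℝ}
    (hφ : Continuous φ) (hp : Function.Periodic φ (2 * Real.pi)) (h : IsInvFracD α φ v) :
    v = fracInt α φ := by
  refine eq_of_torusFourierCoeff_eq h.continuous (continuous_fracInt hα hα1 hφ hp) h.periodic
    (fracInt_periodic α hp) fun k => ?_
  rw [torusFourierCoeff_fracInt hα hα1 hφ hp]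
  by_cases hk : k = 0
  · subst hk; simp [h.zero_mean_right]
  · rw [h.multiplier k hk, if_neg hk]

/-! ### Calculus of local Hölder classes, by induction on the order. -/

/-- `f` is of Hölder class `C^{m,β}` near `x`, in a recursive form. -/
def LocHolder : ℕ → ℝ → (ℝ → ℝ) → ℝ → Prop
  | 0, β, f, x => ∃ C, ∀ᶠ q in 𝓝 x ×ˢ 𝓝 x, |f q.1 - f q.2| ≤ C * |q.1 - q.2| ^ β
  | m + 1, β, f, x => (∀ᶠ y in 𝓝 x, DifferentiableAt ℝ f y) ∧ LocHolder m β (deriv f) x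

namespace LocHolder

variable {f g : ℝ → ℝ} {x β γ : ℝ} {m : ℕ}

lemma of_zero_nonneg (h : LocHolder 0 β f x) :
    ∃ C ≥ 0, ∀ᶠ q in 𝓝 x ×ˢ 𝓝 x, |f q.1 - f q.2| ≤ C * |q.1 - q.2| ^ β := by
  obtain ⟨C, hC⟩ := h
  refine ⟨max C 0, le_max_right _ _, hC.mono fun q hq => hq.trans ?_⟩
  gcongr; exact le_max_left _ _

lemma eventually_close (x : ℝ) : ∀ᶠ q in 𝓝 x ×ˢ 𝓝 x, |q.1 - q.2| ≤ 1 := by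
  have : Tendsto (fun q : ℝ × ℝ => |q.1 - q.2|) (𝓝 (x, x)) (𝓝 0) := by
    have : Continuous (fun q : ℝ × ℝ => |q.1 - q.2|) := by fun_prop
    simpa using this.tendsto (x, x)
  rw [nhds_prod_eq] at this
  filter_upwards [this.eventually (Iio_mem_nhds one_pos)] with q hq using le_of_lt hq

lemma congr (h : LocHolder m β f x) (hfg : f =ᶠ[𝓝 x] g) : LocHolder m β g x := by
  induction m generalizing f g with
  | zero =>
    obtain ⟨C, hC⟩ := h
    refine ⟨C, ?_⟩
    filter_upwards [hC, hfg.prod_inl (𝓝 x), hfg.prod_inr (𝓝 x)] with q hq h1 h2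
    rwa [← h1, ← h2]
  | succ m ih =>
    refine ⟨?_, ih h.2 hfg.deriv⟩
    filter_upwards [h.1, hfg.eventuallyEq_nhds] with y hy h2
    exact hy.congr_of_eventuallyEq h2.symm

lemma anti (h : LocHolder m β f x) (hγ : γ ≤ β) : LocHolder m γ f x := by
  induction m generalizing f with
  | zero =>
    obtain ⟨C, hC0, hC⟩ := h.of_zero_nonneg
    refine ⟨C, ?_⟩
    filter_upwards [hC, eventually_close x] with q hq h1
    rcases eq_or_ne q.1 q.2 with h0 | h0
    · rw [h0]; simp; positivity
    · refine hq.trans (mul_le_mul_of_nonneg_left ?_ hC0)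
      exact Real.rpow_le_rpow_of_exponent_ge (abs_pos.2 (sub_ne_zero.2 h0)) h1 hγ
  | succ m ih => exact ⟨h.1, ih h.2⟩

lemma bounded_zero (h : LocHolder 0 β f x) (hβ : 0 ≤ β) : ∃ C ≥ 0, ∀ᶠ y in 𝓝 x, |f y| ≤ C := by
  obtain ⟨C, hC0, hC⟩ := h.of_zero_nonneg
  refine ⟨|f x| + C, by positivity, ?_⟩
  have h1 : Tendsto (fun y : ℝ => (y, x)) (𝓝 x) (𝓝 x ×ˢ 𝓝 x) := by
    rw [← nhds_prod_eq]; exact Continuous.tendsto (by fun_prop) _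
  filter_upwards [h1.eventually hC, h1.eventually (eventually_close x)] with y hy hy2
  have h3 : |y - x| ^ β ≤ 1 := Real.rpow_le_one (abs_nonneg _) hy2 hβ
  have h4 := abs_sub_abs_le_abs_sub (f y) (f x)
  nlinarith

lemma lipschitz_of_one (h : LocHolder 1 β f x) (hβ : 0 ≤ β) : LocHolder 0 1 f x := by
  obtain ⟨hd, h2⟩ := h
  obtain ⟨C, hC0, hC⟩ := bounded_zero h2 hβ
  obtain ⟨δ, hδ, hb⟩ := Metric.eventually_nhds_iff_ball.1 (hd.and hC)
  refine ⟨C, ?_⟩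
  have hm : ∀ᶠ y in 𝓝 x, y ∈ Metric.ball x δ := Metric.ball_mem_nhds x hδ
  filter_upwards [hm.prod_inl (𝓝 x), hm.prod_inr (𝓝 x)] with q h3 h4
  have := (convex_ball x δ).norm_image_sub_le_of_norm_deriv_le (fun y hy => (hb y hy).1)
    (fun y hy => (hb y hy).2) h4 h3
  simpa [Real.norm_eq_abs] using this

lemma of_succ (h : LocHolder (m + 1) β f x) (hβ : 0 ≤ β) : LocHolder m 1 f x := by
  induction m generalizing f with
  | zero => exact h.lipschitz_of_one hβ
  | succ m ih => exact ⟨h.1, ih h.2⟩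

lemma of_succ' (h : LocHolder (m + 1) β f x) (hβ : 0 ≤ β) (hβ1 : β ≤ 1) : LocHolder m β f x :=
  (h.of_succ hβ).anti hβ1

lemma zero_of (h : LocHolder m β f x) (hβ : 0 ≤ β) (hβ1 : β ≤ 1) : LocHolder 0 β f x := by
  induction m with
  | zero => exact h
  | succ m ih => exact ih (h.of_succ' hβ hβ1)

lemma lipschitz_of_succ (h : LocHolder (m + 1) β f x) (hβ : 0 ≤ β) : LocHolder 0 1 f x :=
  (h.of_succ hβ).zero_of zero_le_one le_rfl

lemma continuousAt_of_zero (h : LocHolder 0 β f x) (hβ : 0 < β) : ContinuousAt f x := by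
  obtain ⟨C, hC0, hC⟩ := h.of_zero_nonneg
  have h1 : Tendsto (fun y : ℝ => (y, x)) (𝓝 x) (𝓝 x ×ˢ 𝓝 x) := by
    rw [← nhds_prod_eq]; exact Continuous.tendsto (by fun_prop) _
  have h2 : Tendsto (fun y => C * |y - x| ^ β) (𝓝 x) (𝓝 0) := by
    have : ContinuousAt (fun y => C * |y - x| ^ β) x :=
      continuousAt_const.mul ((by fun_prop : ContinuousAt (fun y => |y - x|) x).rpow_const
        (Or.inr hβ.le))
    simpa [ContinuousAt, Real.zero_rpow hβ.ne'] using this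
  rw [ContinuousAt, tendsto_iff_norm_sub_tendsto_zero]
  exact squeeze_zero' (Eventually.of_forall fun _ => norm_nonneg _) (h1.eventually hC) h2

lemma continuousAt (h : LocHolder m β f x) (hβ : 0 < β) : ContinuousAt f x := by
  cases m with
  | zero => exact h.continuousAt_of_zero hβ
  | succ m => exact h.1.self_of_nhds.continuousAt

lemma const (m : ℕ) (β c x : ℝ) : LocHolder m β (fun _ => c) x := by
  induction m generalizing c with
  | zero => exact ⟨0, by simp⟩
  | succ m ih =>
    refine ⟨by simp, ?_⟩
    simpa using ih 0

lemma add (hf : LocHolder m β f x) (hg : LocHolder m β g x) :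
    LocHolder m β (fun y => f y + g y) x := by
  induction m generalizing f g with
  | zero =>
    obtain ⟨C, hC⟩ := hf
    obtain ⟨D, hD⟩ := hg
    refine ⟨C + D, ?_⟩
    filter_upwards [hC, hD] with q h1 h2
    calc _ = |(f q.1 - f q.2) + (g q.1 - g q.2)| := by ring_nf
      _ ≤ _ := (abs_add_le _ _).trans (by linarith)
  | succ m ih =>
    refine ⟨hf.1.and hg.1 |>.mono fun y hy => hy.1.add hy.2, (ih hf.2 hg.2).congr ?_⟩
    filter_upwards [hf.1, hg.1] with y h1 h2 using (deriv_fun_add h1 h2).symm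

lemma mul (hf : LocHolder m β f x) (hg : LocHolder m β g x) (hβ : 0 ≤ β) (hβ1 : β ≤ 1) :
    LocHolder m β (fun y => f y * g y) x := by
  induction m generalizing f g with
  | zero =>
    obtain ⟨C, hC0, hC⟩ := hf.of_zero_nonneg
    obtain ⟨D, hD0, hD⟩ := hg.of_zero_nonneg
    obtain ⟨A, hA0, hA⟩ := hf.bounded_zero hβ
    obtain ⟨B, hB0, hB⟩ := hg.bounded_zero hβ
    refine ⟨A * D + B * C, ?_⟩
    filter_upwards [hC, hD, hA.prod_inl (𝓝 x), hB.prod_inr (𝓝 x)] with q h1 h2 h3 h4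
    calc _ = |f q.1 * (g q.1 - g q.2) + g q.2 * (f q.1 - f q.2)| := by ring_nf
      _ ≤ |f q.1| * |g q.1 - g q.2| + |g q.2| * |f q.1 - f q.2| := by
          rw [← abs_mul, ← abs_mul]; exact abs_add_le _ _
      _ ≤ A * (D * |q.1 - q.2| ^ β) + B * (C * |q.1 - q.2| ^ β) := by gcongr
      _ = _ := by ring
  | succ m ih =>
    refine ⟨hf.1.and hg.1 |>.mono fun y hy => hy.1.mul hy.2,
      ((ih hf.2 (hg.of_succ' hβ hβ1)).add (ih (hf.of_succ' hβ hβ1) hg.2)).congr ?_⟩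
    filter_upwards [hf.1, hg.1] with y h1 h2 using (deriv_fun_mul h1 h2).symm

lemma const_mul (c : ℝ) (hf : LocHolder m β f x) : LocHolder m β (fun y => c * f y) x := by
  induction m generalizing f with
  | zero =>
    obtain ⟨C, hC⟩ := hf
    refine ⟨|c| * C, ?_⟩
    filter_upwards [hC] with q h1
    rw [← mul_sub, abs_mul, mul_assoc]
    gcongr
  | succ m ih =>
    refine ⟨hf.1.mono fun y hy => hy.const_mul c, (ih hf.2).congr ?_⟩
    filter_upwards [hf.1] with y h1 using (deriv_const_mul c h1).symm

lemma inv (hf : LocHolder m β f x) (hβ : 0 < β) (hβ1 : β ≤ 1) (h0 : f x ≠ 0) :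
    LocHolder m β (fun y => (f y)⁻¹) x := by
  have hne : ∀ᶠ y in 𝓝 x, f y ≠ 0 := (hf.continuousAt hβ).eventually_ne h0
  induction m with
  | zero =>
    obtain ⟨C, hC0, hC⟩ := hf.of_zero_nonneg
    obtain ⟨d, hd, hlow⟩ : ∃ d > 0, ∀ᶠ y in 𝓝 x, d ≤ |f y| := by
      refine ⟨|f x| / 2, by positivity, ?_⟩
      have := (hf.continuousAt hβ).abs.eventually (Ioi_mem_nhds (a := |f x| / 2)
        (by have := abs_pos.2 h0; linarith))
      exact this.mono fun y hy => le_of_lt hy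
    refine ⟨C / d ^ 2, ?_⟩
    filter_upwards [hC, hlow.prod_inl (𝓝 x), hlow.prod_inr (𝓝 x)] with q h1 h2 h3
    have n1 : f q.1 ≠ 0 := abs_pos.1 (hd.trans_le h2)
    have n2 : f q.2 ≠ 0 := abs_pos.1 (hd.trans_le h3)
    rw [inv_sub_inv n1 n2, abs_div, abs_mul, abs_sub_comm]
    calc _ ≤ (C * |q.1 - q.2| ^ β) / (d * d) := by gcongr
      _ = _ := by ring
  | succ m ih =>
    have hi := ih (hf.of_succ' hβ.le hβ1)
    refine ⟨(hf.1.and hne).mono fun y hy => hy.1.inv hy.2,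
      (((hf.2.mul hi hβ.le hβ1).mul hi hβ.le hβ1).const_mul (-1)).congr ?_⟩
    filter_upwards [hf.1, hne] with y h1 h2
    rw [deriv_fun_inv'' h1 h2]
    field_simp

/-- The inner function is required to be Lipschitz as well: at order `0`, composing two `β`-Hölder
functions would only give the exponent `β²`. -/
lemma comp {F : ℝ → ℝ} (hF : LocHolder m β F (f x)) (hf : LocHolder m β f x)
    (hL : LocHolder 0 1 f x) (hβ : 0 ≤ β) (hβ1 : β ≤ 1) :
    LocHolder m β (fun y => F (f y)) x := by
  have hc : ContinuousAt f x := hL.continuousAt one_pos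
  induction m generalizing F with
  | zero =>
    obtain ⟨C, hC0, hC⟩ := hF.of_zero_nonneg
    obtain ⟨D, hD0, hD⟩ := hL.of_zero_nonneg
    refine ⟨C * D ^ β, ?_⟩
    have ht : Tendsto (fun q : ℝ × ℝ => (f q.1, f q.2)) (𝓝 x ×ˢ 𝓝 x) (𝓝 (f x) ×ˢ 𝓝 (f x)) :=
      Tendsto.prodMap hc hc
    filter_upwards [ht.eventually hC, hD] with q h1 h2
    refine h1.trans ?_
    rw [mul_assoc, ← Real.mul_rpow hD0 (abs_nonneg _)]
    rw [Real.rpow_one] at h2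
    gcongr
  | succ m ih =>
    have hFd : ∀ᶠ y in 𝓝 x, DifferentiableAt ℝ F (f y) := hc.eventually hF.1
    refine ⟨(hFd.and hf.1).mono fun y hy => hy.1.comp y hy.2,
      ((ih hF.2 (hf.of_succ' hβ hβ1)).mul hf.2 hβ hβ1).congr ?_⟩
    filter_upwards [hFd, hf.1] with y h1 h2 using (deriv_comp y h1 h2).symm

lemma isHolderNear (h : LocHolder m β f x) (hβ : 0 < β) : IsHolderNear m β f x := by
  suffices H : ∃ δ > 0, ContDiffOn ℝ m f (Ioo (x - δ) (x + δ)) ∧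
      ∃ C ≥ 0, ∀ y ∈ Ioo (x - δ) (x + δ), ∀ z ∈ Ioo (x - δ) (x + δ),
      |iteratedDeriv m f y - iteratedDeriv m f z| ≤ C * |y - z| ^ β by
    obtain ⟨δ, h1, h2, C, -, h3⟩ := H
    exact ⟨δ, h1, h2, C, h3⟩
  induction m generalizing f with
  | zero =>
    obtain ⟨C, hC0, hC⟩ := h.of_zero_nonneg
    rw [← nhds_prod_eq, Metric.eventually_nhds_iff_ball] at hC
    obtain ⟨δ, hδ, hb⟩ := hC
    have hq : ∀ y ∈ Ioo (x - δ) (x + δ), ∀ z ∈ Ioo (x - δ) (x + δ),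
        |f y - f z| ≤ C * |y - z| ^ β := by
      intro y hy z hz
      refine hb (y, z) ?_
      rw [← ball_prod_same, Real.ball_eq_Ioo]
      exact ⟨hy, hz⟩
    refine ⟨δ, hδ, ?_, C, hC0, by simpa using hq⟩
    simp only [Nat.cast_zero, contDiffOn_zero]
    intro y hy
    have : LocHolder 0 β f y := by
      refine ⟨C, ?_⟩
      have hm : ∀ᶠ z in 𝓝 y, z ∈ Ioo (x - δ) (x + δ) := isOpen_Ioo.mem_nhds hy
      filter_upwards [hm.prod_inl (𝓝 y), hm.prod_inr (𝓝 y)] with q h3 h4 using hq _ h3 _ h4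
    exact (this.continuousAt hβ).continuousWithinAt
  | succ m ih =>
    obtain ⟨δ, hδ, hcd, C, hC0, hC⟩ := ih h.2
    obtain ⟨δ', hδ', hd⟩ := Metric.eventually_nhds_iff_ball.1 h.1
    rw [Real.ball_eq_Ioo] at hd
    have hsub1 : Ioo (x - min δ δ') (x + min δ δ') ⊆ Ioo (x - δ) (x + δ) :=
      Ioo_subset_Ioo (by linarith [min_le_left δ δ']) (by linarith [min_le_left δ δ'])
    have hsub2 : Ioo (x - min δ δ') (x + min δ δ') ⊆ Ioo (x - δ') (x + δ') :=
      Ioo_subset_Ioo (by linarith [min_le_right δ δ']) (by linarith [min_le_right δ δ'])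
    refine ⟨min δ δ', by positivity, ?_, C, hC0, ?_⟩
    · rw [Nat.cast_succ, contDiffOn_succ_iff_deriv_of_isOpen isOpen_Ioo]
      exact ⟨fun y hy => (hd y (hsub2 hy)).differentiableWithinAt, by simp, hcd.mono hsub1⟩
    · intro y hy z hz
      rw [iteratedDeriv_succ']
      exact hC y (hsub1 hy) z (hsub1 hz)

lemma contDiffAt (h : LocHolder m β f x) (hβ : 0 < β) : ContDiffAt ℝ m f x := by
  obtain ⟨δ, hδ, hcd, -⟩ := h.isHolderNear hβ
  exact hcd.contDiffAt (Ioo_mem_nhds (by linarith) (by linarith))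

end LocHolder

lemma IsHolderNear.locHolder {m : ℕ} {β x : ℝ} {f : ℝ → ℝ} (h : IsHolderNear m β f x) :
    LocHolder m β f x := by
  obtain ⟨δ, hδ, hcd, C, hC⟩ := h
  have hx : x ∈ Ioo (x - δ) (x + δ) := ⟨by linarith, by linarith⟩
  have hm : ∀ᶠ y in 𝓝 x, y ∈ Ioo (x - δ) (x + δ) := isOpen_Ioo.mem_nhds hx
  induction m generalizing f with
  | zero =>
    refine ⟨C, ?_⟩
    filter_upwards [hm.prod_inl (𝓝 x), hm.prod_inr (𝓝 x)] with q h3 h4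
    simpa using hC _ h3 _ h4
  | succ m ih =>
    rw [Nat.cast_succ, contDiffOn_succ_iff_deriv_of_isOpen isOpen_Ioo] at hcd
    refine ⟨hm.mono fun y hy => (hcd.1 y hy).differentiableAt (isOpen_Ioo.mem_nhds hy),
      ih hcd.2.2 ?_⟩
    intro y hy z hz
    rw [← iteratedDeriv_succ']
    exact hC y hy z hz

lemma LocHolder.of_contDiffAt {m : ℕ} {x : ℝ} {f : ℝ → ℝ} (h : ContDiffAt ℝ (m + 1 : ℕ) f x) :
    LocHolder m 1 f x := by
  induction m generalizing f with
  | zero =>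
    obtain ⟨K, t, ht, hK⟩ := ContDiffAt.exists_lipschitzOnWith (by simpa using h)
    have hm : ∀ᶠ y in 𝓝 x, y ∈ t := ht
    refine ⟨K, ?_⟩
    filter_upwards [hm.prod_inl (𝓝 x), hm.prod_inr (𝓝 x)] with q h3 h4
    simpa [Real.dist_eq] using hK.dist_le_mul _ h3 _ h4
  | succ m ih =>
    obtain ⟨u, hu, hxu, hcd⟩ := ContDiffWithinAt.contDiffOn' (s := univ) le_rfl (by simp) h
    rw [insert_eq_of_mem (mem_univ x), univ_inter, Nat.cast_succ,
      contDiffOn_succ_iff_deriv_of_isOpen hu] at hcd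
    have hm : ∀ᶠ y in 𝓝 x, y ∈ u := hu.mem_nhds hxu
    exact ⟨hm.mono fun y hy => (hcd.1 y hy).differentiableAt (hu.mem_nhds hy),
      ih (hcd.2.2.contDiffAt (hu.mem_nhds hxu))⟩

/-- Continuity keeps `φ` near `φ x`, where `g` has a Lipschitz local inverse, so `φ` is this inverse
applied to `w` and inherits its modulus of continuity. -/
lemma LocHolder.of_comp_eq_zero {β x : ℝ} {φ g w : ℝ → ℝ}
    (hφ : ContinuousAt φ x) (hw : LocHolder 0 β w x) (hgw : ∀ y, g (φ y) = w y)
    (hg1 : ContDiffAt ℝ 1 g (φ x)) (hd : deriv g (φ x) ≠ 0) : LocHolder 0 β φ x := by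
  have hs := hg1.hasStrictDerivAt one_ne_zero
  have hinv := hs.to_localInverse hd
  obtain ⟨L, s, hs1, hs2⟩ := (HasStrictFDerivAt.exists_lipschitzOnWith
    hinv.hasStrictFDerivAt)
  obtain ⟨C, hC0, hC⟩ := hw.of_zero_nonneg
  have hl := hφ.eventually (hs.eventually_left_inverse hd)
  have hgc : Tendsto (fun y => g (φ y)) (𝓝 x) (𝓝 (g (φ x))) := hg1.continuousAt.tendsto.comp hφ
  have hms : ∀ᶠ y in 𝓝 x, g (φ y) ∈ s := hgc.eventually hs1
  refine ⟨L * C, ?_⟩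
  filter_upwards [hC, hl.prod_inl (𝓝 x), hl.prod_inr (𝓝 x), hms.prod_inl (𝓝 x),
    hms.prod_inr (𝓝 x)] with q h1 h2 h3 h4 h5
  have := hs2.dist_le_mul _ h4 _ h5
  rw [h2, h3, Real.dist_eq, Real.dist_eq, hgw, hgw] at this
  refine this.trans ?_
  rw [mul_assoc]
  gcongr

/-- Regularity of a continuous solution `φ` of `g ∘ φ = w` where `g' ≠ 0`. -/
lemma LocHolder.of_comp_eq {m : ℕ} {β x : ℝ} {φ g w : ℝ → ℝ} (hβ : 0 < β) (hβ1 : β ≤ 1)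
    (hφ : Continuous φ) (hw : LocHolder m β w x) (hgw : ∀ y, g (φ y) = w y)
    (hg : LocHolder m β g (φ x)) (hg1 : ContDiffAt ℝ 1 g (φ x)) (hd : deriv g (φ x) ≠ 0) :
    LocHolder m β φ x := by
  have hφx : Tendsto φ (𝓝 x) (𝓝 (φ x)) := hφ.tendsto x
  induction m with
  | zero => exact LocHolder.of_comp_eq_zero hφx hw hgw hg1 hd
  | succ m ih =>
    have hev : ∀ᶠ z in 𝓝 (φ x), ContDiffAt ℝ 1 g z ∧ deriv g z ≠ 0 := by
      have h1 := hg1.eventually (by simp)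
      have h2 : ContinuousAt (deriv g) (φ x) := hg.2.continuousAt hβ
      exact h1.and (h2.eventually_ne hd)
    -- With `φ' = w' / g'(φ)`, order `m` for `φ` on the right gives order `m + 1` on the left.
    have hder : ∀ᶠ y in 𝓝 x, HasDerivAt φ ((deriv g (φ y))⁻¹ * deriv w y) y := by
      filter_upwards [hφx.eventually hev, hw.1] with y h1 h2
      have hs := h1.1.hasStrictDerivAt one_ne_zero
      have hinv := (hs.to_localInverse h1.2).hasDerivAt
      rw [hgw] at hinv
      have hcomp := hinv.comp y h2.hasDerivAt
      refine hcomp.congr_of_eventuallyEq ?_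
      filter_upwards [(hφ.tendsto y).eventually (hs.eventually_left_inverse h1.2)] with z hz
      rw [Function.comp_apply, ← hgw, hz]
    have hφm : LocHolder m β φ x := ih (hw.of_succ' hβ.le hβ1) (hg.of_succ' hβ.le hβ1)
    have hlip : LocHolder 0 1 φ x :=
      LocHolder.of_comp_eq_zero hφx (hw.lipschitz_of_succ hβ.le) hgw hg1 hd
    have h1 : LocHolder m β (fun y => deriv g (φ y)) x := hg.2.comp hφm hlip hβ.le hβ1
    refine ⟨hder.mono fun y hy => hy.differentiableAt,
      ((h1.inv hβ hβ1 hd).mul hw.2 hβ.le hβ1).congr ?_⟩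
    filter_upwards [hder] with y hy using hy.deriv.symm

/-! ### Singular convolutions and their gain in Hölder regularity. -/

/-- A kernel supported in `|y| < ε`, of class `C²` away from `0`, with a singularity of order
`α - 1` at `0`. -/
structure SingKernel (α ε C : ℝ) (κ : ℝ → ℝ) : Prop where
  nonneg : 0 ≤ C
  supp : ∀ y, ε ≤ |y| → κ y = 0
  diff : ∀ y ≠ 0, DifferentiableAt ℝ κ y
  diff2 : ∀ y ≠ 0, DifferentiableAt ℝ (deriv κ) y
  bound : ∀ y ≠ 0, |κ y| ≤ C * |y| ^ (α - 1)
  bound1 : ∀ y ≠ 0, |deriv κ y| ≤ C * |y| ^ (α - 2)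
  bound2 : ∀ y ≠ 0, |deriv (deriv κ) y| ≤ C * |y| ^ (α - 3)

/-- Convolution with `κ` on the real line. -/
noncomputable def locConv (κ f : ℝ → ℝ) (x : ℝ) : ℝ := ∫ y, κ y * f (x - y)

lemma integrableOn_compl_abs_rpow {s : ℝ} (hs : s < -1) :
    IntegrableOn (fun z : ℝ => |z| ^ s) {z | 2 < |z|} := by
  have h1 : IntegrableOn (fun z : ℝ => |z| ^ s) (Ioi 2) :=
    (integrableOn_Ioi_rpow_of_lt hs two_pos).congr_fun (fun z hz => by
      have h0 : (0 : ℝ) < z := lt_trans two_pos hz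
      simp only [abs_of_pos h0]) measurableSet_Ioi
  have h2 : IntegrableOn (fun z : ℝ => |z| ^ s) (Iio (-2)) := by
    have := (integrable_indicator_iff measurableSet_Ioi).2 h1
    have h3 := this.comp_neg
    rw [← integrable_indicator_iff measurableSet_Iio]
    refine h3.congr (ae_of_all _ fun z => ?_)
    have e : -z ∈ Ioi (2 : ℝ) ↔ z ∈ Iio (-2 : ℝ) := by
      rw [mem_Ioi, mem_Iio]; constructor <;> intro h <;> linarith
    simp only [indicator, e, abs_neg]
  refine (h2.union h1).mono_set fun z hz => ?_
  rcases lt_abs.1 (show 2 < |z| from hz) with h | h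
  · exact Or.inr h
  · exact Or.inl (by simp only [mem_Iio]; linarith)

lemma integrableOn_abs_rpow {s : ℝ} (hs : -1 < s) (R : ℝ) :
    IntegrableOn (fun z : ℝ => |z| ^ s) {z | |z| ≤ R} := by
  rcases lt_or_ge R 0 with hR | hR
  · have : {z : ℝ | |z| ≤ R} = ∅ := by
      ext z; simp only [mem_ofPred_eq, mem_empty_iff_false, iff_false, not_le]
      exact hR.trans_le (abs_nonneg z)
    rw [this]; exact integrableOn_empty
  have h := intervalIntegrable_abs_rpow hs (-R) R
  rw [intervalIntegrable_iff_integrableOn_Icc_of_le (by linarith)] at h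
  exact h.mono_set fun z hz => abs_le.1 hz

lemma measurableSet_abs_le (R : ℝ) : MeasurableSet {z : ℝ | |z| ≤ R} :=
  measurableSet_le (by fun_prop) measurable_const

lemma measurableSet_lt_abs (R : ℝ) : MeasurableSet {z : ℝ | R < |z|} :=
  measurableSet_lt measurable_const (by fun_prop)

/-- A bound that scales like `|h|^{s+1}` after integration. -/
lemma integral_le_of_scaled_bound {Φ F : ℝ → ℝ} {h s : ℝ} (hh : h ≠ 0) (hΦ : Integrable Φ)
    (hF : AEStronglyMeasurable F volume)
    (hb : ∀ᵐ y, |F y| ≤ |h| ^ s * Φ (y / h)) :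
    Integrable F ∧ ∫ y, |F y| ≤ |h| ^ (s + 1) * ∫ z, Φ z := by
  have h1 : Integrable (fun y => |h| ^ s * Φ (y / h)) := (hΦ.comp_div hh).const_mul _
  have h2 : Integrable F := h1.mono' hF hb
  refine ⟨h2, (integral_mono_ae h2.abs h1 hb).trans_eq ?_⟩
  rw [integral_const_mul, Measure.integral_comp_div, smul_eq_mul, ← mul_assoc,
    Real.rpow_add_one (abs_pos.2 hh).ne']

namespace SingKernel

variable {α ε C : ℝ} {κ : ℝ → ℝ}

lemma measurable (hκ : SingKernel α ε C κ) : Measurable κ :=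
  measurable_of_continuousOn_compl_singleton 0 fun y hy =>
    (hκ.diff y hy).continuousAt.continuousWithinAt

lemma integrable (hκ : SingKernel α ε C κ) (hα : 0 < α) : Integrable κ := by
  have h1 := ((integrableOn_abs_rpow (s := α - 1) (by linarith) ε).const_mul C)
  have h2 : IntegrableOn κ {z | |z| ≤ ε} := by
    refine h1.mono' hκ.measurable.aestronglyMeasurable ?_
    refine ae_restrict_of_ae ?_
    filter_upwards [compl_mem_ae_iff.2 (measure_singleton (0 : ℝ))] with y hy using hκ.bound y hy
  refine (integrableOn_iff_integrable_of_support_subset fun y hy => ?_).1 h2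
  by_contra hc
  exact hy (hκ.supp y (le_of_lt (not_le.1 hc)))

/-- On a support inside the unit interval a smaller exponent only weakens the bounds. This freedom
avoids the borderline case in which the Hölder exponents add up to exactly `1`. -/
lemma mono (hκ : SingKernel α ε C κ) {a : ℝ} (ha : a ≤ α) (hε : ε < 1) : SingKernel a ε C κ := by
  have key : ∀ (y : ℝ) (v s : ℝ), y ≠ 0 → |v| ≤ C * |y| ^ (α + s) → (ε < |y| → v = 0) →
      |v| ≤ C * |y| ^ (a + s) := by
    intro y v s hy hv h0
    rcases lt_or_ge ε |y| with h | h
    · rw [h0 h, abs_zero]; have := hκ.nonneg; positivity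
    · refine hv.trans (mul_le_mul_of_nonneg_left ?_ hκ.nonneg)
      exact Real.rpow_le_rpow_of_exponent_ge (abs_pos.2 hy) (by linarith) (by linarith)
  have hz : ∀ y, ε < |y| → κ =ᶠ[𝓝 y] fun _ => 0 := fun y hy => by
    filter_upwards [(isOpen_lt continuous_const continuous_abs).mem_nhds hy] with z hz
    exact hκ.supp z (le_of_lt hz)
  have hz1 : ∀ y, ε < |y| → deriv κ =ᶠ[𝓝 y] fun _ => 0 := fun y hy => by
    have := (hz y hy).deriv
    simpa using this
  exact ⟨hκ.nonneg, hκ.supp, hκ.diff, hκ.diff2,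
    fun y hy => key y _ (-1) hy (hκ.bound y hy) fun h => (hz y h).eq_of_nhds,
    fun y hy => key y _ (-2) hy (hκ.bound1 y hy) fun h => (hz1 y h).eq_of_nhds,
    fun y hy => key y _ (-3) hy (hκ.bound2 y hy) fun h => by
      rw [(hz1 y h).deriv_eq]; simp⟩

lemma segment_bound {y h ξ : ℝ} (hy : 2 * |h| < |y|) (hξ : ξ ∈ segment ℝ y (y + h)) :
    |y| / 2 ≤ |ξ| := by
  have h1 : |ξ - y| ≤ |h| := by
    obtain ⟨a, b, ha, hb, hab, rfl⟩ := hξ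
    have : a • y + b • (y + h) - y = b * h := by
      simp only [smul_eq_mul]; rw [show a = 1 - b by linarith]; ring
    rw [this, abs_mul, abs_of_nonneg hb]
    nlinarith [abs_nonneg h]
  have h2 := abs_sub_abs_le_abs_sub y ξ
  rw [abs_sub_comm] at h2
  linarith [abs_nonneg h]

lemma diff_bound (hκ : SingKernel α ε C κ) (hα : α < 1) {y h : ℝ} (hy : 2 * |h| < |y|) :
    |κ (y + h) - κ y| ≤ C * (|y| / 2) ^ (α - 2) * |h| := by
  have hy0 : 0 < |y| := by linarith [abs_nonneg h]
  have hne : ∀ ξ ∈ segment ℝ y (y + h), ξ ≠ 0 := fun ξ hξ =>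
    abs_pos.1 (by linarith [segment_bound hy hξ])
  have := (convex_segment y (y + h)).norm_image_sub_le_of_norm_deriv_le (f := κ)
    (C := C * (|y| / 2) ^ (α - 2)) (fun ξ hξ => hκ.diff ξ (hne ξ hξ)) (fun ξ hξ => ?_)
    (left_mem_segment ℝ y (y + h)) (right_mem_segment ℝ y (y + h))
  · simpa [Real.norm_eq_abs] using this
  · refine (hκ.bound1 ξ (hne ξ hξ)).trans (mul_le_mul_of_nonneg_left ?_ hκ.nonneg)
    exact Real.rpow_le_rpow_of_nonpos (by positivity) (segment_bound hy hξ) (by linarith)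

lemma taylor_bound (hκ : SingKernel α ε C κ) (hα : α < 1) {y h : ℝ} (hy : 2 * |h| < |y|) :
    |κ (y + h) - κ y - h * deriv κ y| ≤ C * (|y| / 2) ^ (α - 3) * |h| ^ 2 := by
  have hy0 : 0 < |y| := by linarith [abs_nonneg h]
  have hC := hκ.nonneg
  have hne : ∀ ξ ∈ segment ℝ y (y + h), ξ ≠ 0 := fun ξ hξ =>
    abs_pos.1 (by linarith [segment_bound hy hξ])
  have hsub : ∀ ξ ∈ segment ℝ y (y + h), |ξ - y| ≤ |h| := by
    rintro ξ ⟨a, b, ha, hb, hab, rfl⟩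
    have : a • y + b • (y + h) - y = b * h := by
      simp only [smul_eq_mul]; rw [show a = 1 - b by linarith]; ring
    rw [this, abs_mul, abs_of_nonneg hb]
    nlinarith [abs_nonneg h]
  have h1 : ∀ ξ ∈ segment ℝ y (y + h), |deriv κ ξ - deriv κ y| ≤
      C * (|y| / 2) ^ (α - 3) * |h| := by
    intro ξ hξ
    have := (convex_segment y (y + h)).norm_image_sub_le_of_norm_deriv_le (f := deriv κ)
      (C := C * (|y| / 2) ^ (α - 3)) (fun ξ hξ => hκ.diff2 ξ (hne ξ hξ)) (fun ξ hξ => ?_)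
      (left_mem_segment ℝ y (y + h)) hξ
    · refine this.trans ?_
      have := hsub ξ hξ
      rw [Real.norm_eq_abs]
      gcongr
    · refine (hκ.bound2 ξ (hne ξ hξ)).trans (mul_le_mul_of_nonneg_left ?_ hκ.nonneg)
      exact Real.rpow_le_rpow_of_nonpos (by positivity) (segment_bound hy hξ) (by linarith)
  have hder : ∀ ξ ∈ segment ℝ y (y + h), HasDerivAt (fun t => κ t - t * deriv κ y)
      (deriv κ ξ - deriv κ y) ξ := fun ξ hξ => by
    have := (hκ.diff ξ (hne ξ hξ)).hasDerivAt.sub ((hasDerivAt_id ξ).mul_const (deriv κ y))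
    rw [one_mul] at this
    exact this
  have := (convex_segment y (y + h)).norm_image_sub_le_of_norm_hasDerivWithin_le
    (fun ξ hξ => (hder ξ hξ).hasDerivWithinAt) h1
    (left_mem_segment ℝ y (y + h)) (right_mem_segment ℝ y (y + h))
  rw [Real.norm_eq_abs, Real.norm_eq_abs] at this
  calc _ = |κ (y + h) - (y + h) * deriv κ y - (κ y - y * deriv κ y)| := by ring_nf
    _ ≤ _ := this
    _ = _ := by rw [show y + h - y = h by ring]; ring

lemma ae_ne (h : ℝ) : ∀ᵐ y : ℝ, y ≠ 0 ∧ y + h ≠ 0 := by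
  filter_upwards [compl_mem_ae_iff.2 (measure_singleton (0 : ℝ)),
    compl_mem_ae_iff.2 (measure_singleton (-h))] with y h1 h2
  exact ⟨h1, fun h3 => h2 (by simp only [mem_singleton_iff]; linarith)⟩

/-- After the scaling `y = h z` the integrand is dominated by `|h|^(α+β-1)` times a fixed integrable
function, and the Jacobian supplies the missing factor `|h|`. -/
lemma integral_diff_le (hκ : SingKernel α ε C κ) (hα : 0 < α) {β : ℝ} (hβ : 0 ≤ β)
    (hαβ : α + β < 1) : ∃ D ≥ 0, ∀ h ≠ 0,
      Integrable (fun y => (κ (y + h) - κ y) * |y| ^ β) ∧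
      ∫ y, |(κ (y + h) - κ y) * |y| ^ β| ≤ D * |h| ^ (α + β) := by
  have hC := hκ.nonneg
  -- Near the origin the two singularities, at `0` and `-1`, are estimated separately. Far out the
  -- mean value theorem gives the decay `|z|^(α+β-2)`, integrable because `α + β < 1`.
  let Φ : ℝ → ℝ := fun z => {z : ℝ | |z| ≤ 2}.indicator
      (fun z => C * 2 ^ β * (|z + 1| ^ (α - 1) + |z| ^ (α - 1))) z +
    {z : ℝ | 2 < |z|}.indicator (fun z => C * 2 ^ (2 - α) * |z| ^ (α + β - 2)) z
  have hΦ : Integrable Φ := by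
    refine Integrable.add ?_ ?_
    · rw [integrable_indicator_iff (measurableSet_abs_le 2)]
      refine (Integrable.add ?_ ?_).const_mul _
      · have := (integrable_indicator_iff (measurableSet_abs_le 3)).2
          (integrableOn_abs_rpow (s := α - 1) (by linarith) 3)
        have h2 := (this.comp_add_right 1).integrableOn (s := {z : ℝ | |z| ≤ 2})
        refine h2.congr_fun (fun z hz => ?_) (measurableSet_abs_le 2)
        refine indicator_of_mem ?_ _
        have h3 : |z| ≤ 2 := hz
        have := abs_add_le z 1
        rw [abs_one] at this
        simp only [mem_ofPred_eq]; linarith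
      · exact integrableOn_abs_rpow (by linarith) 2
    · rw [integrable_indicator_iff (measurableSet_lt_abs 2)]
      exact (integrableOn_compl_abs_rpow (by linarith)).const_mul _
  have hΦ0 : ∀ z, 0 ≤ Φ z := fun z =>
    add_nonneg (indicator_nonneg (fun _ _ => by positivity) z)
      (indicator_nonneg (fun _ _ => by positivity) z)
  refine ⟨∫ z, Φ z, integral_nonneg hΦ0, fun h hh => ?_⟩
  have hh0 := abs_pos.2 hh
  have := integral_le_of_scaled_bound (F := fun y => (κ (y + h) - κ y) * |y| ^ β)
    (s := α + β - 1) hh hΦ ?_ ?_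
  · refine ⟨this.1, this.2.trans_eq ?_⟩
    rw [show α + β - 1 + 1 = α + β by ring, mul_comm]
  · have := hκ.measurable
    exact Measurable.aestronglyMeasurable (by fun_prop)
  · filter_upwards [ae_ne h] with y hy
    have hyh : |y| = |h| * |y / h| := by rw [← abs_mul]; congr 1; field_simp
    have hyh2 : |y + h| = |h| * |y / h + 1| := by rw [← abs_mul]; congr 1; field_simp
    rw [abs_mul, abs_of_nonneg (by positivity : 0 ≤ |y| ^ β)]
    rcases le_or_gt |y / h| 2 with hz | hz
    · have e : Φ (y / h) = C * 2 ^ β * (|y / h + 1| ^ (α - 1) + |y / h| ^ (α - 1)) := by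
        simp only [Φ]
        rw [indicator_of_mem (by exact hz), indicator_of_notMem (by simpa using hz), add_zero]
      rw [e]
      calc |κ (y + h) - κ y| * |y| ^ β
          ≤ (C * |y + h| ^ (α - 1) + C * |y| ^ (α - 1)) * (|h| * 2) ^ β := by
            gcongr
            · exact (abs_sub _ _).trans (add_le_add (hκ.bound _ hy.2) (hκ.bound _ hy.1))
            · rw [hyh]; gcongr
        _ = (|h| ^ (α - 1) * |h| ^ β) * (C * 2 ^ β *
            (|y / h + 1| ^ (α - 1) + |y / h| ^ (α - 1))) := by
            rw [hyh, hyh2, Real.mul_rpow hh0.le (by positivity), Real.mul_rpow hh0.le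
              (by positivity), Real.mul_rpow hh0.le (by positivity)]
            ring
        _ = _ := by rw [← Real.rpow_add hh0]; ring_nf
    · have e : Φ (y / h) = C * 2 ^ (2 - α) * |y / h| ^ (α + β - 2) := by
        simp only [Φ]
        rw [indicator_of_notMem (by simpa using hz), indicator_of_mem (by exact hz), zero_add]
      have hlt : 2 * |h| < |y| := by rw [hyh]; nlinarith
      have hy0 : 0 < |y| := abs_pos.2 hy.1
      rw [e]
      calc |κ (y + h) - κ y| * |y| ^ β
          ≤ C * (|y| / 2) ^ (α - 2) * |h| * |y| ^ β := by
            gcongr; exact hκ.diff_bound (by linarith) hlt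
        _ = C * 2 ^ (2 - α) * |h| * (|y| ^ (α - 2) * |y| ^ β) := by
            rw [Real.div_rpow hy0.le two_pos.le, show (2 : ℝ) - α = -(α - 2) by ring,
              Real.rpow_neg two_pos.le]
            field_simp
        _ = C * 2 ^ (2 - α) * (|h| * |h| ^ (α + β - 2)) * |y / h| ^ (α + β - 2) := by
            rw [← Real.rpow_add hy0, hyh, Real.mul_rpow hh0.le (by positivity),
              show α - 2 + β = α + β - 2 by ring]
            ring
        _ = _ := by
            rw [show |h| * |h| ^ (α + β - 2) = |h| ^ (α + β - 1) by
              rw [mul_comm, ← Real.rpow_add_one hh0.ne']; ring_nf]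
            ring

/-- The same scaling with one more Taylor term. The term `h κ'(y) |y|^β` is integrable at `0`
because `α + β > 1`, and the remainder decays like `|z|^(α+β-3)`, integrable at infinity because `α
+ β < 2`. -/
lemma integral_taylor_le (hκ : SingKernel α ε C κ) (hα : 0 < α) (hα1 : α < 1) {β : ℝ}
    (hβ1 : β ≤ 1) (hαβ : 1 < α + β) : ∃ D ≥ 0, ∀ h ≠ 0,
      Integrable (fun y => (κ (y + h) - κ y - h * deriv κ y) * |y| ^ β) ∧
      ∫ y, |(κ (y + h) - κ y - h * deriv κ y) * |y| ^ β| ≤ D * |h| ^ (α + β) := by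
  have hC := hκ.nonneg
  have hβ : 0 ≤ β := by linarith
  let Φ : ℝ → ℝ := fun z => {z : ℝ | |z| ≤ 2}.indicator
      (fun z => C * 2 ^ β * (|z + 1| ^ (α - 1) + |z| ^ (α - 1)) + C * |z| ^ (α + β - 2)) z +
    {z : ℝ | 2 < |z|}.indicator (fun z => C * 2 ^ (3 - α) * |z| ^ (α + β - 3)) z
  have hΦ : Integrable Φ := by
    refine Integrable.add ?_ ?_
    · rw [integrable_indicator_iff (measurableSet_abs_le 2)]
      refine Integrable.add ((Integrable.add ?_ ?_).const_mul _) ?_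
      · have := (integrable_indicator_iff (measurableSet_abs_le 3)).2
          (integrableOn_abs_rpow (s := α - 1) (by linarith) 3)
        have h2 := (this.comp_add_right 1).integrableOn (s := {z : ℝ | |z| ≤ 2})
        refine h2.congr_fun (fun z hz => ?_) (measurableSet_abs_le 2)
        refine indicator_of_mem ?_ _
        have h3 : |z| ≤ 2 := hz
        have := abs_add_le z 1
        rw [abs_one] at this
        simp only [mem_ofPred_eq]; linarith
      · exact integrableOn_abs_rpow (by linarith) 2
      · exact (integrableOn_abs_rpow (by linarith) 2).const_mul _
    · rw [integrable_indicator_iff (measurableSet_lt_abs 2)]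
      exact (integrableOn_compl_abs_rpow (by linarith)).const_mul _
  have hΦ0 : ∀ z, 0 ≤ Φ z := fun z =>
    add_nonneg (indicator_nonneg (fun _ _ => by positivity) z)
      (indicator_nonneg (fun _ _ => by positivity) z)
  refine ⟨∫ z, Φ z, integral_nonneg hΦ0, fun h hh => ?_⟩
  have hh0 := abs_pos.2 hh
  have := integral_le_of_scaled_bound
    (F := fun y => (κ (y + h) - κ y - h * deriv κ y) * |y| ^ β)
    (s := α + β - 1) hh hΦ ?_ ?_
  · refine ⟨this.1, this.2.trans_eq ?_⟩
    rw [show α + β - 1 + 1 = α + β by ring, mul_comm]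
  · have := hκ.measurable
    have h2 := measurable_deriv κ
    exact Measurable.aestronglyMeasurable (by fun_prop)
  · filter_upwards [ae_ne h] with y hy
    have hyh : |y| = |h| * |y / h| := by rw [← abs_mul]; congr 1; field_simp
    have hyh2 : |y + h| = |h| * |y / h + 1| := by rw [← abs_mul]; congr 1; field_simp
    have hy0 : 0 < |y| := abs_pos.2 hy.1
    rw [abs_mul, abs_of_nonneg (by positivity : 0 ≤ |y| ^ β)]
    rcases le_or_gt |y / h| 2 with hz | hz
    · have e : Φ (y / h) = C * 2 ^ β * (|y / h + 1| ^ (α - 1) + |y / h| ^ (α - 1)) +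
          C * |y / h| ^ (α + β - 2) := by
        simp only [Φ]
        rw [indicator_of_mem (by exact hz), indicator_of_notMem (by simpa using hz), add_zero]
      rw [e]
      calc |κ (y + h) - κ y - h * deriv κ y| * |y| ^ β
          ≤ (C * |y + h| ^ (α - 1) + C * |y| ^ (α - 1) + |h| * (C * |y| ^ (α - 2))) * |y| ^ β := by
            gcongr
            refine (abs_sub _ _).trans (add_le_add ((abs_sub _ _).trans
              (add_le_add (hκ.bound _ hy.2) (hκ.bound _ hy.1))) ?_)
            rw [abs_mul]
            gcongr
            exact hκ.bound1 _ hy.1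
        _ = (C * |y + h| ^ (α - 1) + C * |y| ^ (α - 1)) * |y| ^ β +
            C * |h| * (|y| ^ (α - 2) * |y| ^ β) := by ring
        _ ≤ (C * |y + h| ^ (α - 1) + C * |y| ^ (α - 1)) * (|h| * 2) ^ β +
            C * |h| * (|y| ^ (α - 2) * |y| ^ β) := by
            have : |y| ≤ |h| * 2 := by rw [hyh]; gcongr
            gcongr
        _ = (|h| ^ (α - 1) * |h| ^ β) * (C * 2 ^ β *
            (|y / h + 1| ^ (α - 1) + |y / h| ^ (α - 1))) +
            C * (|h| * |h| ^ (α + β - 2)) * |y / h| ^ (α + β - 2) := by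
            rw [← Real.rpow_add hy0, hyh, hyh2, Real.mul_rpow hh0.le (by positivity),
              Real.mul_rpow hh0.le (by positivity), Real.mul_rpow hh0.le (by positivity),
              Real.mul_rpow hh0.le (by positivity), show α - 2 + β = α + β - 2 by ring]
            ring
        _ = _ := by
            rw [show |h| * |h| ^ (α + β - 2) = |h| ^ (α + β - 1) by
              rw [mul_comm, ← Real.rpow_add_one hh0.ne']; ring_nf, ← Real.rpow_add hh0,
              show α - 1 + β = α + β - 1 by ring]
            ring
    · have e : Φ (y / h) = C * 2 ^ (3 - α) * |y / h| ^ (α + β - 3) := by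
        simp only [Φ]
        rw [indicator_of_notMem (by simpa using hz), indicator_of_mem (by exact hz), zero_add]
      have hlt : 2 * |h| < |y| := by rw [hyh]; nlinarith
      rw [e]
      calc |κ (y + h) - κ y - h * deriv κ y| * |y| ^ β
          ≤ C * (|y| / 2) ^ (α - 3) * |h| ^ 2 * |y| ^ β := by
            gcongr; exact hκ.taylor_bound hα1 hlt
        _ = C * 2 ^ (3 - α) * |h| ^ 2 * (|y| ^ (α - 3) * |y| ^ β) := by
            rw [Real.div_rpow hy0.le two_pos.le, show (3 : ℝ) - α = -(α - 3) by ring,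
              Real.rpow_neg two_pos.le]
            field_simp
        _ = C * 2 ^ (3 - α) * (|h| ^ 2 * |h| ^ (α + β - 3)) * |y / h| ^ (α + β - 3) := by
            rw [← Real.rpow_add hy0, hyh, Real.mul_rpow hh0.le (by positivity),
              show α - 3 + β = α + β - 3 by ring]
            ring
        _ = _ := by
            rw [show |h| ^ 2 * |h| ^ (α + β - 3) = |h| ^ (α + β - 1) by
              rw [← Real.rpow_natCast, ← Real.rpow_add hh0]; congr 1; push_cast; ring]
            ring

end SingKernel

lemma integrable_mul_bounded {κ F : ℝ → ℝ} {B : ℝ} (hκ : Integrable κ) (hF : Continuous F)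
    (hB : ∀ y, |F y| ≤ B) : Integrable fun y => κ y * F y :=
  hκ.mul_bdd (c := B) hF.aestronglyMeasurable (ae_of_all _ hB)

/-- Since `κ (· + h) - κ` has integral zero, `F x` may be subtracted for free. This brings in the
increments of `F`, where Hölder continuity acts. -/
lemma locConv_add_sub {κ F : ℝ → ℝ} {B : ℝ} (hκ : Integrable κ) (hF : Continuous F)
    (hB : ∀ y, |F y| ≤ B) (x h : ℝ) :
    Integrable (fun y => (κ (y + h) - κ y) * (F (x - y) - F x)) ∧
    locConv κ F (x + h) - locConv κ F x = ∫ y, (κ (y + h) - κ y) * (F (x - y) - F x) := by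
  have hκh : Integrable (fun y => κ (y + h)) := hκ.comp_add_right h
  have hc : Continuous fun y => F (x - y) := by fun_prop
  have i1 : Integrable (fun y => κ (y + h) * F (x - y)) := integrable_mul_bounded hκh hc fun y => hB _
  have i2 : Integrable (fun y => κ y * F (x - y)) := integrable_mul_bounded hκ hc fun y => hB _
  have e : ∀ y, (κ (y + h) - κ y) * (F (x - y) - F x) =
      (κ (y + h) * F (x - y) - κ y * F (x - y)) - (κ (y + h) * F x - κ y * F x) := fun y => by ring
  have e1 : locConv κ F (x + h) = ∫ y, κ (y + h) * F (x - y) := by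
    rw [locConv, ← integral_add_right_eq_self _ h]
    congr 1; ext y; congr 2; ring
  have e2 : ∫ y, κ (y + h) = ∫ y, κ y := integral_add_right_eq_self _ h
  simp only [e]
  have i3 : Integrable (fun y => κ (y + h) * F (x - y) - κ y * F (x - y)) := i1.sub i2
  have i4 : Integrable (fun y => κ (y + h) * F x - κ y * F x) :=
    (hκh.mul_const _).sub (hκ.mul_const _)
  refine ⟨i3.sub i4, ?_⟩
  rw [integral_sub i3 i4, integral_sub i1 i2,
    integral_sub (hκh.mul_const _) (hκ.mul_const _), integral_mul_const, integral_mul_const, e1, e2,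
    locConv]
  ring

lemma SingKernel.holder_locConv {α ε C B M β : ℝ} {κ F : ℝ → ℝ} (hκ : SingKernel α ε C κ)
    (hα : 0 < α) (hβ : 0 ≤ β) (hαβ : α + β < 1) (hF : Continuous F) (hB : ∀ y, |F y| ≤ B)
    (hM : 0 ≤ M) (hH : ∀ y z, |F y - F z| ≤ M * |y - z| ^ β) :
    ∃ D, ∀ x y, |locConv κ F x - locConv κ F y| ≤ D * |x - y| ^ (α + β) := by
  obtain ⟨D, hD0, hD⟩ := hκ.integral_diff_le hα hβ hαβ
  refine ⟨M * D, fun x y => ?_⟩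
  rcases eq_or_ne x y with rfl | hxy
  · simp [Real.zero_rpow (by linarith : α + β ≠ 0)]
  obtain ⟨i1, e1⟩ := locConv_add_sub (hκ.integrable hα) hF hB y (x - y)
  obtain ⟨i2, e2⟩ := hD (x - y) (sub_ne_zero.2 hxy)
  rw [show y + (x - y) = x by ring] at e1
  rw [e1]
  calc _ ≤ ∫ z, |(κ (z + (x - y)) - κ z) * (F (y - z) - F y)| := abs_integral_le_integral_abs
    _ ≤ ∫ z, M * |(κ (z + (x - y)) - κ z) * |z| ^ β| := by
        refine integral_mono i1.abs (i2.abs.const_mul M) fun z => ?_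
        have := hH (y - z) y
        rw [show y - z - y = -z by ring, abs_neg] at this
        simp only [abs_mul]
        rw [abs_of_nonneg (by positivity : 0 ≤ |z| ^ β)]
        calc _ ≤ |κ (z + (x - y)) - κ z| * (M * |z| ^ β) := by gcongr
          _ = _ := by ring
    _ = M * ∫ z, |(κ (z + (x - y)) - κ z) * |z| ^ β| := integral_const_mul _ _
    _ ≤ M * (D * |x - y| ^ (α + β)) := by gcongr
    _ = _ := by ring

lemma SingKernel.taylor_locConv {α ε C B M β : ℝ} {κ F : ℝ → ℝ} (hκ : SingKernel α ε C κ)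
    (hα : 0 < α) (hα1 : α < 1) (hβ1 : β ≤ 1) (hαβ : 1 < α + β) (hF : Continuous F)
    (hB : ∀ y, |F y| ≤ B) (hM : 0 ≤ M) (hH : ∀ y z, |F y - F z| ≤ M * |y - z| ^ β) :
    ∃ (D : ℝ) (l : ℝ → ℝ), ∀ x h, |locConv κ F (x + h) - locConv κ F x - h * l x| ≤
      D * |h| ^ (α + β) := by
  obtain ⟨D, hD0, hD⟩ := hκ.integral_taylor_le hα hα1 hβ1 hαβ
  have hκm := hκ.measurable
  have hκm' := measurable_deriv κ
  have hFm := hF.measurable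
  have hdom : ∀ x h, h ≠ 0 → Integrable (fun y => (κ (y + h) - κ y - h * deriv κ y) *
      (F (x - y) - F x)) ∧ ∫ y, |(κ (y + h) - κ y - h * deriv κ y) * (F (x - y) - F x)| ≤
      M * D * |h| ^ (α + β) := by
    intro x h hh
    obtain ⟨i2, e2⟩ := hD h hh
    have hb : ∀ z, |(κ (z + h) - κ z - h * deriv κ z) * (F (x - z) - F x)| ≤
        M * |(κ (z + h) - κ z - h * deriv κ z) * |z| ^ β| := by
      intro z
      have := hH (x - z) x
      rw [show x - z - x = -z by ring, abs_neg] at this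
      rw [abs_mul, abs_mul, abs_of_nonneg (by positivity : 0 ≤ |z| ^ β)]
      calc _ ≤ |κ (z + h) - κ z - h * deriv κ z| * (M * |z| ^ β) := by gcongr
        _ = _ := by ring
    have i1 : Integrable (fun y => (κ (y + h) - κ y - h * deriv κ y) * (F (x - y) - F x)) :=
      (i2.abs.const_mul M).mono' (Measurable.aestronglyMeasurable (by fun_prop)) (ae_of_all _ hb)
    refine ⟨i1, (integral_mono i1.abs (i2.abs.const_mul M) hb).trans ?_⟩
    rw [integral_const_mul, mul_assoc]
    gcongr
  -- The candidate derivative is regularised by subtracting `F x`, since the available bound on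
  -- `deriv κ` is not integrable at `0`.
  refine ⟨M * D, fun x => ∫ y, deriv κ y * (F (x - y) - F x), fun x h => ?_⟩
  rcases eq_or_ne h 0 with rfl | hh
  · simp [Real.zero_rpow (by linarith : α + β ≠ 0)]
  obtain ⟨i1, e1⟩ := locConv_add_sub (hκ.integrable hα) hF hB x h
  -- At `h = 1`, this integrand is the plain difference minus the Taylor remainder, both known to be
  -- integrable.
  have hl : Integrable (fun y => deriv κ y * (F (x - y) - F x)) := by
    obtain ⟨j1, -⟩ := locConv_add_sub (hκ.integrable hα) hF hB x 1
    refine (j1.sub (hdom x 1 one_ne_zero).1).congr (ae_of_all _ fun y => ?_)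
    simp only [Pi.sub_apply]; ring
  have e3 : locConv κ F (x + h) - locConv κ F x - h * ∫ y, deriv κ y * (F (x - y) - F x) =
      ∫ y, (κ (y + h) - κ y - h * deriv κ y) * (F (x - y) - F x) := by
    rw [e1, ← integral_const_mul, ← integral_sub i1 (hl.const_mul h)]
    congr 1; ext y; ring
  rw [e3]
  exact abs_integral_le_integral_abs.trans (hdom x h hh).2

/-- Expanding `T` from `x` to `y` and from `y` back to `x`, and adding, leaves `(x - y)(l x - l y)`,
so the two remainders control the increments of the derivative. -/
lemma hasDerivAt_of_taylor {T l : ℝ → ℝ} {D s : ℝ} (hs : 1 < s)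
    (h : ∀ x h, |T (x + h) - T x - h * l x| ≤ D * |h| ^ s) :
    (∀ x, HasDerivAt T (l x) x) ∧ ∀ x y, |l x - l y| ≤ 2 * D * |x - y| ^ (s - 1) := by
  constructor
  · intro x
    rw [hasDerivAt_iff_isLittleO_nhds_zero]
    have h1 : (fun h => T (x + h) - T x - h • l x) =O[𝓝 0] fun h : ℝ => |h| ^ s :=
      Asymptotics.IsBigO.of_bound D (Eventually.of_forall fun y => by
        rw [Real.norm_of_nonneg (by positivity : 0 ≤ |y| ^ s)]; exact h x y)
    refine h1.trans_isLittleO ?_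
    rw [Asymptotics.isLittleO_iff_tendsto' (Eventually.of_forall fun y hy => by
      rw [hy, abs_zero, Real.zero_rpow (by linarith)])]
    have h2 : Tendsto (fun y : ℝ => |y| ^ (s - 1)) (𝓝 0) (𝓝 0) := by
      have : ContinuousAt (fun y : ℝ => |y| ^ (s - 1)) 0 :=
        (by fun_prop : ContinuousAt (fun y : ℝ => |y|) 0).rpow_const (Or.inr (by linarith))
      simpa [ContinuousAt, Real.zero_rpow (by linarith : s - 1 ≠ 0)] using this
    refine squeeze_zero_norm (fun y => ?_) h2
    rcases eq_or_ne y 0 with rfl | hy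
    · simp; positivity
    · rw [norm_div, Real.norm_of_nonneg (by positivity : 0 ≤ |y| ^ s), Real.norm_eq_abs,
        Real.rpow_sub_one (abs_pos.2 hy).ne']
  · intro x y
    rcases eq_or_ne x y with rfl | hxy
    · simp [Real.zero_rpow (by linarith : s - 1 ≠ 0)]
    have h1 := h x (y - x)
    have h2 := h y (x - y)
    rw [show x + (y - x) = y by ring, abs_sub_comm y x] at h1
    rw [show y + (x - y) = x by ring] at h2
    have hpos : 0 < |x - y| := abs_pos.2 (sub_ne_zero.2 hxy)
    have h3 : |x - y| * |l x - l y| ≤ 2 * D * |x - y| ^ s := by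
      rw [← abs_mul]
      calc _ = |(T y - T x - (y - x) * l x) + (T x - T y - (x - y) * l y)| := by ring_nf
        _ ≤ _ := (abs_add_le _ _).trans (by linarith)
    rw [Real.rpow_sub_one hpos.ne', ← mul_div_assoc, le_div_iff₀ hpos]
    linarith

/-- Precomposing with the projection onto a closed interval, a contraction, keeps the Hölder
constant. The global convolution estimates then apply, and a kernel of small support does not see
the change. -/
lemma LocHolder.exists_extension {f : ℝ → ℝ} {β x₀ : ℝ} (h : LocHolder 0 β f x₀) (hβ : 0 ≤ β)
    (hc : ContDiffAt ℝ 0 f x₀) : ∃ δ > 0, ∃ (F : ℝ → ℝ) (M B : ℝ), Continuous F ∧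
      (∀ y, |F y| ≤ B) ∧ 0 ≤ M ∧ (∀ y z, |F y - F z| ≤ M * |y - z| ^ β) ∧
      ∀ y, |y - x₀| ≤ δ → F y = f y := by
  obtain ⟨M, hM0, hM⟩ := h.of_zero_nonneg
  obtain ⟨u, hu, hcu⟩ := contDiffAt_zero.1 hc
  rw [← nhds_prod_eq, Metric.eventually_nhds_iff_ball] at hM
  obtain ⟨δ₁, hδ₁, hb⟩ := hM
  obtain ⟨δ₂, hδ₂, hb2⟩ := Metric.mem_nhds_iff.1 hu
  set δ := min δ₁ δ₂ / 2 with hδ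
  have hδ0 : 0 < δ := by positivity
  have hle : x₀ - δ ≤ x₀ + δ := by linarith
  have hmem : ∀ y ∈ Icc (x₀ - δ) (x₀ + δ), y ∈ Metric.ball x₀ δ₁ ∧ y ∈ Metric.ball x₀ δ₂ := by
    intro y hy
    have h1 : |y - x₀| ≤ δ := abs_le.2 ⟨by linarith [hy.1], by linarith [hy.2]⟩
    rw [Metric.mem_ball, Metric.mem_ball, Real.dist_eq]
    constructor
    · linarith [min_le_left δ₁ δ₂]
    · linarith [min_le_right δ₁ δ₂]
  have hfc : ContinuousOn f (Icc (x₀ - δ) (x₀ + δ)) := hcu.mono fun y hy => hb2 (hmem y hy).2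
  obtain ⟨B, hB⟩ := isCompact_Icc.exists_bound_of_continuousOn hfc
  let P : ℝ → ℝ := fun y => projIcc _ _ hle y
  have hP : ∀ y, P y ∈ Icc (x₀ - δ) (x₀ + δ) := fun y => (projIcc _ _ hle y).2
  have hPc : Continuous P := continuous_subtype_val.comp continuous_projIcc
  have hPl : ∀ y z, |P y - P z| ≤ |y - z| := fun y z => by
    have := (LipschitzWith.projIcc hle).dist_le_mul y z
    simpa [Real.dist_eq, Subtype.dist_eq] using this
  refine ⟨δ, hδ0, fun y => f (P y), M, B, hfc.comp_continuous hPc hP, fun y => hB _ (hP y), hM0,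
    fun y z => ?_, fun y hy => ?_⟩
  · refine (hb (P y, P z) ?_).trans ?_
    · rw [← ball_prod_same]; exact ⟨(hmem _ (hP y)).1, (hmem _ (hP z)).1⟩
    · have := hPl y z
      simp only
      gcongr
  · have h1 := abs_le.1 hy
    have : P y = y := by
      simp only [P]
      rw [projIcc_of_mem hle ⟨by linarith, by linarith⟩]
    exact congrArg f this

lemma locConv_congr {κ f F : ℝ → ℝ} {ε δ x₀ x : ℝ} (hκ : ∀ y, ε ≤ |y| → κ y = 0)
    (h : ∀ y, |y - x₀| ≤ δ → F y = f y) (hε : ε ≤ δ / 2) (hx : |x - x₀| ≤ δ / 2) :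
    locConv κ F x = locConv κ f x := by
  refine integral_congr_ae (ae_of_all _ fun y => ?_)
  rcases le_or_gt ε |y| with hy | hy
  · simp [hκ y hy]
  · have : F (x - y) = f (x - y) := h _ (by
      calc |x - y - x₀| = |(x - x₀) - y| := by ring_nf
        _ ≤ |x - x₀| + |y| := abs_sub _ _
        _ ≤ _ := by linarith)
    simp only [this]

lemma eventually_abs_sub_le (x₀ : ℝ) {δ : ℝ} (hδ : 0 < δ) : ∀ᶠ x in 𝓝 x₀, |x - x₀| ≤ δ := by
  filter_upwards [Metric.closedBall_mem_nhds x₀ hδ] with x hx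
  rwa [Metric.mem_closedBall, Real.dist_eq] at hx

lemma LocHolder.locConv_zero {f : ℝ → ℝ} {α β x₀ : ℝ} (h : LocHolder 0 β f x₀) (hα : 0 < α)
    (hβ : 0 ≤ β) (hαβ : α + β < 1) (hc : ContDiffAt ℝ 0 f x₀) :
    ∃ ε₀ > 0, ∀ ε ≤ ε₀, ∀ κ C, SingKernel α ε C κ → LocHolder 0 (α + β) (locConv κ f) x₀ := by
  obtain ⟨δ, hδ, F, M, B, hF, hB, hM, hH, heq⟩ := h.exists_extension hβ hc
  refine ⟨δ / 2, by positivity, fun ε hε κ C hκ => ?_⟩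
  obtain ⟨D, hD⟩ := hκ.holder_locConv hα hβ hαβ hF hB hM hH
  have : LocHolder 0 (α + β) (locConv κ F) x₀ := ⟨D, Eventually.of_forall fun q => hD _ _⟩
  exact this.congr ((eventually_abs_sub_le x₀ (by positivity : 0 < δ / 2)).mono fun x hx =>
    locConv_congr hκ.supp heq hε hx)

lemma LocHolder.locConv_zero_succ {f : ℝ → ℝ} {α β x₀ : ℝ} (h : LocHolder 0 β f x₀) (hα : 0 < α)
    (hα1 : α < 1) (hβ1 : β ≤ 1) (hαβ : 1 < α + β) (hc : ContDiffAt ℝ 0 f x₀) :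
    ∃ ε₀ > 0, ∀ ε ≤ ε₀, ∀ κ C, SingKernel α ε C κ →
      LocHolder 1 (α + β - 1) (locConv κ f) x₀ := by
  obtain ⟨δ, hδ, F, M, B, hF, hB, hM, hH, heq⟩ := h.exists_extension (by linarith) hc
  refine ⟨δ / 2, by positivity, fun ε hε κ C hκ => ?_⟩
  obtain ⟨D, l, hD⟩ := hκ.taylor_locConv hα hα1 hβ1 hαβ hF hB hM hH
  obtain ⟨h1, h2⟩ := hasDerivAt_of_taylor hαβ hD
  have : LocHolder 1 (α + β - 1) (locConv κ F) x₀ := by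
    refine ⟨Eventually.of_forall fun y => (h1 y).differentiableAt, ?_⟩
    rw [show deriv (locConv κ F) = l from funext fun y => (h1 y).deriv]
    exact ⟨2 * D, Eventually.of_forall fun q => h2 _ _⟩
  exact this.congr ((eventually_abs_sub_le x₀ (by positivity : 0 < δ / 2)).mono fun x hx =>
    locConv_congr hκ.supp heq hε hx)

/-- The derivative is put on `f`, so the integrable singularity of `κ` is untouched and `|κ|` times
a local bound for `f'` dominates. -/
lemma hasDerivAt_locConv {f : ℝ → ℝ} {x₀ : ℝ} {α : ℝ} (hα : 0 < α) (hc : ContDiffAt ℝ 1 f x₀) :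
    ∃ ε₀ > 0, ∀ ε ≤ ε₀, ∀ κ C, SingKernel α ε C κ →
      ∀ᶠ x in 𝓝 x₀, HasDerivAt (locConv κ f) (locConv κ (deriv f) x) x := by
  obtain ⟨u, hu, hxu, hcd⟩ := ContDiffWithinAt.contDiffOn' (s := univ) le_rfl (by simp) hc
  rw [insert_eq_of_mem (mem_univ x₀), univ_inter, show (1 : WithTop ℕ∞) = 0 + 1 by simp,
    contDiffOn_succ_iff_deriv_of_isOpen hu, contDiffOn_zero] at hcd
  obtain ⟨hd, -, hdc⟩ := hcd
  obtain ⟨δ, hδ, hb⟩ := Metric.mem_nhds_iff.1 (hu.mem_nhds hxu)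
  have hin : ∀ y, |y - x₀| ≤ δ / 2 → y ∈ u := fun y hy => hb (by
    rw [Metric.mem_ball, Real.dist_eq]; linarith)
  have hcl : {y | |y - x₀| ≤ δ / 2} = Metric.closedBall x₀ (δ / 2) := by
    ext y; rw [Metric.mem_closedBall, Real.dist_eq]; rfl
  obtain ⟨B, hB⟩ := (isCompact_closedBall x₀ (δ / 2)).exists_bound_of_continuousOn
    (hdc.mono fun y hy => hin y (by rwa [Metric.mem_closedBall, Real.dist_eq] at hy))
  refine ⟨δ / 4, by positivity, fun ε hε κ C hκ => ?_⟩
  have hset : ∀ v : ℝ → ℝ, ∀ x, locConv κ v x = ∫ y in Icc (-ε) ε, κ y * v (x - y) := by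
    intro v x
    refine (setIntegral_eq_integral_of_forall_compl_eq_zero fun y hy => ?_).symm
    rw [hκ.supp y ?_, zero_mul]
    by_contra hc
    exact hy (abs_le.1 (not_le.1 hc).le)
  have hsh : ∀ x y, |x - x₀| ≤ δ / 4 → y ∈ Icc (-ε) ε → |x - y - x₀| ≤ δ / 2 := by
    intro x y hx hy
    have h1 : |y| ≤ ε := abs_le.2 hy
    calc |x - y - x₀| = |(x - x₀) - y| := by ring_nf
      _ ≤ |x - x₀| + |y| := abs_sub _ _
      _ ≤ _ := by linarith
  have hcont : ∀ v : ℝ → ℝ, ContinuousOn v u → ∀ x, |x - x₀| ≤ δ / 4 →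
      ContinuousOn (fun y => v (x - y)) (Icc (-ε) ε) := fun v hv x hx =>
    hv.comp (by fun_prop) fun y hy => hin _ (hsh x y hx hy)
  have hint : ∀ v : ℝ → ℝ, ContinuousOn v u → ∀ x, |x - x₀| ≤ δ / 4 →
      IntegrableOn (fun y => κ y * v (x - y)) (Icc (-ε) ε) := fun v hv x hx =>
    (hκ.integrable hα).integrableOn.mul_continuousOn (hcont v hv x hx) isCompact_Icc
  filter_upwards [eventually_abs_sub_le x₀ (by positivity : 0 < δ / 8)] with x hx
  have hnb : ∀ᶠ z in 𝓝 x, |z - x₀| ≤ δ / 4 := by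
    filter_upwards [eventually_abs_sub_le x (by positivity : 0 < δ / 8)] with z hz
    calc |z - x₀| = |(z - x) + (x - x₀)| := by ring_nf
      _ ≤ _ := (abs_add_le _ _).trans (by linarith)
  have key := hasDerivAt_integral_of_dominated_loc_of_deriv_le
    (μ := volume.restrict (Icc (-ε) ε)) (s := {z | |z - x₀| ≤ δ / 4}) (x₀ := x)
    (F := fun x y => κ y * f (x - y)) (F' := fun x y => κ y * deriv f (x - y))
    (bound := fun y => |κ y| * B) hnb
    (hnb.mono fun z hz => (hint f hd.continuousOn z hz).aestronglyMeasurable)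
    (hint f hd.continuousOn x (by linarith))
    (hint _ hdc x (by linarith)).aestronglyMeasurable ?_
    ((hκ.integrable hα).abs.integrableOn.mul_const B) ?_
  · rw [hset]
    refine key.2.congr_of_eventuallyEq (Eventually.of_forall fun z => hset f z)
  · refine (ae_restrict_iff' measurableSet_Icc).2 (ae_of_all _ fun y hy z hz => ?_)
    rw [norm_mul]
    refine mul_le_mul_of_nonneg_left (hB _ ?_) (norm_nonneg _)
    rw [Metric.mem_closedBall, Real.dist_eq]
    exact hsh z y hz hy
  · refine (ae_restrict_iff' measurableSet_Icc).2 (ae_of_all _ fun y hy z hz => ?_)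
    have h1 : HasDerivAt f (deriv f (z - y)) (z - y) :=
      ((hd _ (hin _ (hsh z y hz hy))).differentiableAt
        (hu.mem_nhds (hin _ (hsh z y hz hy)))).hasDerivAt
    exact (h1.comp_sub_const z y).const_mul _

lemma contDiffAt_deriv {f : ℝ → ℝ} {x : ℝ} {m : ℕ} (h : ContDiffAt ℝ (m + 1 : ℕ) f x) :
    ContDiffAt ℝ m (deriv f) x := by
  obtain ⟨u, hu, hxu, hcd⟩ := ContDiffWithinAt.contDiffOn' (s := univ) le_rfl (by simp) h
  rw [insert_eq_of_mem (mem_univ x), univ_inter, Nat.cast_succ,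
    contDiffOn_succ_iff_deriv_of_isOpen hu] at hcd
  exact hcd.2.2.contDiffAt (hu.mem_nhds hxu)

/-- Convolution commutes with derivatives near `x₀`, so the order-zero estimate suffices. Each
differentiation may shrink the admissible support, which is why `ε₀` is chosen from `f` before the
kernel is given. -/
lemma LocHolder.locConv_of_zero {α β γ : ℝ} {k : ℕ} (hα : 0 < α)
    (h0 : ∀ (f : ℝ → ℝ) (x₀ : ℝ), LocHolder 0 β f x₀ → ContDiffAt ℝ 0 f x₀ →
      ∃ ε₀ > 0, ∀ ε ≤ ε₀, ∀ κ C, SingKernel α ε C κ → LocHolder k γ (locConv κ f) x₀)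
    (m : ℕ) {f : ℝ → ℝ} {x₀ : ℝ} (h : LocHolder m β f x₀) (hc : ContDiffAt ℝ m f x₀) :
    ∃ ε₀ > 0, ∀ ε ≤ ε₀, ∀ κ C, SingKernel α ε C κ → LocHolder (k + m) γ (locConv κ f) x₀ := by
  induction m generalizing f with
  | zero => exact h0 f x₀ h (by simpa using hc)
  | succ m ih =>
    obtain ⟨ε₁, hε₁, h1⟩ := ih h.2 (contDiffAt_deriv hc)
    obtain ⟨ε₂, hε₂, h2⟩ := hasDerivAt_locConv hα
      (hc.of_le (by push_cast; exact le_add_self))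
    refine ⟨min ε₁ ε₂, by positivity, fun ε hε κ C hκ => ?_⟩
    have hd := h2 ε (hε.trans (min_le_right _ _)) κ C hκ
    exact ⟨hd.mono fun x hx => hx.differentiableAt,
      (h1 ε (hε.trans (min_le_left _ _)) κ C hκ).congr (hd.mono fun x hx => hx.deriv.symm)⟩

/-! ### Splitting the torus kernel into a singular and a smooth part. -/

/-- First derivative of `fracKernel` away from `2πℤ`. -/
noncomputable def fracKernel₁ (α y : ℝ) : ℝ :=
  1 / (2 * Real.pi * Real.Gamma α) * (kerProfileD α 2 (Real.cos y) * -Real.sin y)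

/-- Second derivative of `fracKernel` away from `2πℤ`. -/
noncomputable def fracKernel₂ (α y : ℝ) : ℝ :=
  1 / (2 * Real.pi * Real.Gamma α) * (2 * kerProfileD α 3 (Real.cos y) * Real.sin y ^ 2 -
    kerProfileD α 2 (Real.cos y) * Real.cos y)

lemma hasDerivAt_fracKernel {α y : ℝ} (hα : 0 < α) (hy : Real.cos y < 1) :
    HasDerivAt (fracKernel α) (fracKernel₁ α y) y :=
  ((hasDerivAt_kerProfile hα hy).comp y (Real.hasDerivAt_cos y)).const_mul _

lemma hasDerivAt_fracKernel₁ {α y : ℝ} (hα : 0 < α) (hy : Real.cos y < 1) :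
    HasDerivAt (fracKernel₁ α) (fracKernel₂ α y) y := by
  have h1 := (hasDerivAt_kerProfileD hα le_rfl hy).comp y (Real.hasDerivAt_cos y)
  refine ((h1.mul (Real.hasDerivAt_sin y).neg).const_mul
    (1 / (2 * Real.pi * Real.Gamma α))).congr_deriv ?_
  rw [fracKernel₂]
  simp only [Function.comp, Pi.neg_apply]
  push_cast
  ring

lemma fracKernel_deriv_bounds {α : ℝ} (hα : 0 < α) (hα1 : α < 1) :
    ∃ C > 0, ∀ y, |y| ≤ Real.pi → y ≠ 0 → |fracKernel₁ α y| ≤ C * |y| ^ (α - 2) ∧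
      |fracKernel₂ α y| ≤ C * |y| ^ (α - 3) := by
  obtain ⟨C, hC, h⟩ := kerProfileD_two_le hα hα1
  have hΓ := Real.Gamma_pos_of_pos hα
  have hπ := Real.pi_pos
  set A := 1 / (2 * Real.pi * Real.Gamma α) with hA
  have hA0 : 0 < A := by positivity
  set B := C * (2 / Real.pi ^ 2) ^ ((α - 3) / 2) with hB
  have hB0 : 0 < B := by positivity
  refine ⟨A * (5 * B), by positivity, fun y hy h0 => ?_⟩
  have hy0 : 0 < |y| := abs_pos.2 h0
  have hc := cos_lt_one_of_abs_le hy h0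
  have hG0 := kerProfileD_nonneg (α := α) hc 2
  have hG3 := kerProfileD_nonneg (α := α) hc 3
  have hG : kerProfileD α 2 (Real.cos y) ≤ B * |y| ^ (α - 3) := by
    refine (h _ (Real.neg_one_le_cos y) hc).trans ?_
    rw [hB, mul_assoc]
    exact mul_le_mul_of_nonneg_left (one_sub_cos_rpow_le (by linarith) hy h0) hC.le
  have e2 : |y| ^ (α - 2) = |y| ^ (α - 3) * |y| := by
    rw [← Real.rpow_add_one hy0.ne']; ring_nf
  constructor
  · rw [fracKernel₁, abs_mul, abs_of_pos hA0, abs_mul, abs_neg, abs_of_nonneg hG0, e2, mul_assoc A]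
    refine mul_le_mul_of_nonneg_left ?_ hA0.le
    calc _ ≤ B * |y| ^ (α - 3) * |y| :=
          mul_le_mul hG Real.abs_sin_le_abs (abs_nonneg _) (by positivity)
      _ ≤ _ := by rw [mul_assoc]; gcongr; linarith
  · rw [fracKernel₂, abs_mul, abs_of_pos hA0, mul_assoc A]
    refine mul_le_mul_of_nonneg_left ?_ hA0.le
    have h3 : kerProfileD α 3 (Real.cos y) * Real.sin y ^ 2 ≤ 2 * kerProfileD α 2 (Real.cos y) := by
      have hs : 0 < 1 - Real.cos y := by linarith
      -- The factor `1 - cos y` cancels the denominator coming from `kerProfileD_three_le`.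
      have e : Real.sin y ^ 2 = (1 - Real.cos y) * (1 + Real.cos y) := by
        have := Real.sin_sq_add_cos_sq y; linarith
      calc _ ≤ kerProfileD α 2 (Real.cos y) / (1 - Real.cos y) * Real.sin y ^ 2 := by
            gcongr; exact kerProfileD_three_le hα hc
        _ = kerProfileD α 2 (Real.cos y) * (1 + Real.cos y) := by rw [e]; field_simp
        _ ≤ kerProfileD α 2 (Real.cos y) * 2 := by gcongr; linarith
        _ = _ := by ring
    calc _ ≤ |2 * kerProfileD α 3 (Real.cos y) * Real.sin y ^ 2| +
          |kerProfileD α 2 (Real.cos y) * Real.cos y| := abs_sub _ _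
      _ ≤ 4 * kerProfileD α 2 (Real.cos y) + kerProfileD α 2 (Real.cos y) * 1 := by
          gcongr
          · rw [abs_of_nonneg (by positivity)]; linarith
          · rw [abs_mul, abs_of_nonneg hG0]; gcongr; exact Real.abs_cos_le_one y
      _ ≤ _ := by linarith

/-- The cut at `|y| < 2` discards the periodic copies of the singularity. It creates no jump,
because `2 ≤ π` and `E` already vanishes for `ε ≤ |y| ≤ π`. The bounds then follow from the product
rule. -/
lemma SingKernel.of_mul_fracKernel {α ε : ℝ} (hα : 0 < α) (hα1 : α < 1) (hε : ε < 1)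
    {E : ℝ → ℝ} (hE : ContDiff ℝ ∞ E)
    (hE0 : ∀ y, ε ≤ |y| → |y| ≤ Real.pi → E y = 0) :
    ∃ C, SingKernel α ε C (fun y => if |y| < 2 then E y * fracKernel α y else 0) := by
  have h2π : (2 : ℝ) ≤ Real.pi := Real.two_le_pi
  set κ : ℝ → ℝ := fun y => if |y| < 2 then E y * fracKernel α y else 0 with hκ
  have hE2 : ContDiff ℝ 2 E := by exact_mod_cast contDiff_infty.1 hE 2
  have hdE : ContDiff ℝ 1 (deriv E) := by
    rw [show (2 : WithTop ℕ∞) = 1 + 1 by norm_num, contDiff_succ_iff_deriv] at hE2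
    exact hE2.2.2
  have hddE : Continuous (deriv (deriv E)) := hdE.continuous_deriv le_rfl
  obtain ⟨B₀, hB₀⟩ := (isCompact_Icc (a := (-2 : ℝ)) (b := 2)).exists_bound_of_continuousOn
    hE2.continuous.continuousOn
  obtain ⟨B₁, hB₁⟩ := (isCompact_Icc (a := (-2 : ℝ)) (b := 2)).exists_bound_of_continuousOn
    hdE.continuous.continuousOn
  obtain ⟨B₂, hB₂⟩ := (isCompact_Icc (a := (-2 : ℝ)) (b := 2)).exists_bound_of_continuousOn
    hddE.continuousOn
  obtain ⟨C₀, hC₀, hK0⟩ := abs_fracKernel_le hα hα1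
  obtain ⟨C₁, hC₁, hK1⟩ := fracKernel_deriv_bounds hα hα1
  have hB0' : 0 ≤ B₀ := (norm_nonneg _).trans (hB₀ 0 (by norm_num))
  have hB1' : 0 ≤ B₁ := (norm_nonneg _).trans (hB₁ 0 (by norm_num))
  have hB2' : 0 ≤ B₂ := (norm_nonneg _).trans (hB₂ 0 (by norm_num))
  have hfar : ∀ y, ε < |y| → κ =ᶠ[𝓝 y] fun _ => 0 := by
    intro y hy
    filter_upwards [(isOpen_lt continuous_const continuous_abs).mem_nhds hy] with z hz
    simp only [hκ]
    split_ifs with h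
    · rw [hE0 z (le_of_lt hz) (by linarith), zero_mul]
    · rfl
  have hfar1 : ∀ y, ε < |y| → deriv κ =ᶠ[𝓝 y] fun _ => 0 := fun y hy => by
    simpa using (hfar y hy).deriv
  have hopen : IsOpen {y : ℝ | |y| < 2 ∧ y ≠ 0} :=
    (isOpen_lt continuous_abs continuous_const).inter isOpen_ne
  have hnear : ∀ y, |y| < 2 → y ≠ 0 → HasDerivAt κ (deriv E y * fracKernel α y +
      E y * fracKernel₁ α y) y := by
    intro y hy h0
    have h1 := (hE2.differentiable (by norm_num) y).hasDerivAt.mul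
      (hasDerivAt_fracKernel hα (cos_lt_one_of_abs_le (by linarith) h0))
    refine h1.congr_of_eventuallyEq ?_
    filter_upwards [hopen.mem_nhds ⟨hy, h0⟩] with z hz
    simp only [hκ, if_pos hz.1, Pi.mul_apply]
  have hnear1 : ∀ y, |y| < 2 → y ≠ 0 → HasDerivAt (deriv κ) (deriv (deriv E) y * fracKernel α y +
      deriv E y * fracKernel₁ α y + (deriv E y * fracKernel₁ α y + E y * fracKernel₂ α y)) y := by
    intro y hy h0
    have hc := cos_lt_one_of_abs_le (by linarith) h0
    have h1 := ((hdE.differentiable one_ne_zero y).hasDerivAt.mul (hasDerivAt_fracKernel hα hc)).add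
      ((hE2.differentiable (by norm_num) y).hasDerivAt.mul (hasDerivAt_fracKernel₁ hα hc))
    refine h1.congr_of_eventuallyEq ?_
    filter_upwards [hopen.mem_nhds ⟨hy, h0⟩] with z hz
    simp only [(hnear z hz.1 hz.2).deriv, Pi.mul_apply, Pi.add_apply]
  set C := B₀ * C₀ + (2 * B₁ * C₀ + B₀ * C₁) + (4 * B₂ * C₀ + 4 * B₁ * C₁ + B₀ * C₁) with hC
  have hC0 : 0 ≤ C := by positivity
  have hp : ∀ y : ℝ, |y| < 2 → y ≠ 0 → ∀ s : ℝ, |y| ^ (s + 1) ≤ 2 * |y| ^ s := by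
    intro y hy h0 s
    rw [Real.rpow_add_one (abs_pos.2 h0).ne', mul_comm]
    gcongr
  have hcase : ∀ y : ℝ, |y| < 2 ∨ ε < |y| := fun y => by
    rcases lt_or_ge |y| 2 with h | h
    · exact Or.inl h
    · exact Or.inr (by linarith)
  have hmem : ∀ y : ℝ, |y| < 2 → y ∈ Icc (-2 : ℝ) 2 := fun y hy => abs_le.1 hy.le
  refine ⟨C, hC0, fun y hy => ?_, fun y h0 => ?_, fun y h0 => ?_, fun y h0 => ?_, fun y h0 => ?_,
    fun y h0 => ?_⟩
  · simp only [hκ]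
    split_ifs with h
    · rw [hE0 y hy (by linarith), zero_mul]
    · rfl
  · rcases hcase y with h | h
    · exact (hnear y h h0).differentiableAt
    · exact ((hfar y h).differentiableAt_iff).2 (differentiableAt_const _)
  · rcases hcase y with h | h
    · exact (hnear1 y h h0).differentiableAt
    · exact ((hfar1 y h).differentiableAt_iff).2 (differentiableAt_const _)
  · have hpos : 0 ≤ |y| ^ (α - 1) := by positivity
    rcases hcase y with h | h
    · simp only [hκ, if_pos h]
      rw [abs_mul]
      calc _ ≤ B₀ * (C₀ * |y| ^ (α - 1)) := by
            gcongr
            · exact hB₀ y (hmem y h)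
            · exact hK0 y (by linarith) h0
        _ = (B₀ * C₀) * |y| ^ (α - 1) := by ring
        _ ≤ _ := by
          gcongr
          rw [hC, add_assoc]
          exact le_add_of_nonneg_right (by positivity)
    · rw [(hfar y h).eq_of_nhds, abs_zero]
      positivity
  · rcases hcase y with h | h
    · rw [(hnear y h h0).deriv]
      have hp1 := hp y h h0 (α - 2)
      rw [show α - 2 + 1 = α - 1 by ring] at hp1
      have hpos : 0 ≤ |y| ^ (α - 2) := by positivity
      calc _ ≤ |deriv E y| * |fracKernel α y| + |E y| * |fracKernel₁ α y| := by
            rw [← abs_mul, ← abs_mul]; exact abs_add_le _ _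
        _ ≤ B₁ * (C₀ * (2 * |y| ^ (α - 2))) + B₀ * (C₁ * |y| ^ (α - 2)) := by
            gcongr
            · exact hB₁ y (hmem y h)
            · exact (hK0 y (by linarith) h0).trans (by gcongr)
            · exact hB₀ y (hmem y h)
            · exact (hK1 y (by linarith) h0).1
        _ = (2 * B₁ * C₀ + B₀ * C₁) * |y| ^ (α - 2) := by ring
        _ ≤ _ := by
          gcongr
          rw [hC]
          have : 0 ≤ B₀ * C₀ := by positivity
          have : 0 ≤ 4 * B₂ * C₀ + 4 * B₁ * C₁ + B₀ * C₁ := by positivity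
          linarith
    · rw [(hfar1 y h).eq_of_nhds, abs_zero]; positivity
  · rcases hcase y with h | h
    · rw [(hnear1 y h h0).deriv]
      have hp1 := hp y h h0 (α - 2)
      rw [show α - 2 + 1 = α - 1 by ring] at hp1
      have hp2 := hp y h h0 (α - 3)
      rw [show α - 3 + 1 = α - 2 by ring] at hp2
      have hpos : 0 ≤ |y| ^ (α - 3) := by positivity
      have hK1' : |fracKernel₁ α y| ≤ C₁ * (2 * |y| ^ (α - 3)) :=
        (hK1 y (by linarith) h0).1.trans (by gcongr)
      calc _ ≤ |deriv (deriv E) y| * |fracKernel α y| + |deriv E y| * |fracKernel₁ α y| +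
            (|deriv E y| * |fracKernel₁ α y| + |E y| * |fracKernel₂ α y|) := by
            rw [← abs_mul, ← abs_mul, ← abs_mul]
            exact (abs_add_le _ _).trans (add_le_add (abs_add_le _ _) (abs_add_le _ _))
        _ ≤ B₂ * (C₀ * (4 * |y| ^ (α - 3))) + B₁ * (C₁ * (2 * |y| ^ (α - 3))) +
            (B₁ * (C₁ * (2 * |y| ^ (α - 3))) + B₀ * (C₁ * |y| ^ (α - 3))) := by
            gcongr
            · exact hB₂ y (hmem y h)
            · exact (hK0 y (by linarith) h0).trans (by gcongr; linarith)
            · exact hB₁ y (hmem y h)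
            · exact hB₁ y (hmem y h)
            · exact hB₀ y (hmem y h)
            · exact (hK1 y (by linarith) h0).2
        _ = (4 * B₂ * C₀ + 4 * B₁ * C₁ + B₀ * C₁) * |y| ^ (α - 3) := by ring
        _ ≤ _ := by
          gcongr
          rw [hC]
          have : 0 ≤ B₀ * C₀ := by positivity
          have : 0 ≤ 2 * B₁ * C₀ + B₀ * C₁ := by positivity
          linarith
    · rw [(hfar1 y h).deriv_eq]; simp; positivity

/-- The operator with kernel `fracKernel` is a local singular convolution up to a smooth one. -/
lemma exists_fracInt_decomposition {α ε : ℝ} (hα : 0 < α) (hα1 : α < 1) (hε0 : 0 < ε)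
    (hε : ε < 1) : ∃ (κ M : ℝ → ℝ) (C : ℝ), SingKernel α ε C κ ∧ ContDiff ℝ ∞ M ∧
      ∀ φ : ℝ → ℝ, Continuous φ → Function.Periodic φ (2 * Real.pi) → ∀ x,
        fracInt α φ x = locConv κ φ x + ∫ z in (-Real.pi)..Real.pi, M (x - z) * φ z := by
  have hπ := Real.pi_pos
  have h2π : (2 : ℝ) ≤ Real.pi := Real.two_le_pi
  set a := Real.cos ε with ha
  have ha1 : a < 1 := cos_lt_one_of_abs_le (by rw [abs_of_pos hε0]; linarith) hε0.ne'
  set b := (1 + a) / 2 with hb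
  have hab : 0 < b - a := by linarith
  -- The cutoff is a function of `w = cos y`, hence automatically even and periodic. It vanishes for
  -- `w ≤ cos ε` and equals `1` from `b < 1` on.
  set ρ : ℝ → ℝ := fun w => Real.smoothTransition ((w - a) / (b - a)) with hρ
  have hρs : ContDiff ℝ ∞ ρ := by
    have h1 : ContDiff ℝ ∞ Real.smoothTransition := Real.smoothTransition.contDiff (n := ⊤)
    exact h1.comp ((contDiff_id.sub contDiff_const).div_const _)
  have hE : ContDiff ℝ ∞ (fun y => ρ (Real.cos y)) := hρs.comp Real.contDiff_cos
  have hE0 : ∀ y, ε ≤ |y| → |y| ≤ Real.pi → ρ (Real.cos y) = 0 := by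
    intro y hy hy2
    refine Real.smoothTransition.zero_of_nonpos (div_nonpos_of_nonpos_of_nonneg ?_ hab.le)
    have := Real.cos_le_cos_of_nonneg_of_le_pi hε0.le hy2 hy
    rw [Real.cos_abs] at this
    linarith
  obtain ⟨C, hC⟩ := SingKernel.of_mul_fracKernel hα hα1 hε hE hE0
  set κ : ℝ → ℝ := fun y => if |y| < 2 then ρ (Real.cos y) * fracKernel α y else 0 with hκ
  set M : ℝ → ℝ := fun y => (1 - ρ (Real.cos y)) * fracKernel α y with hM
  have hMs : ContDiff ℝ ∞ M := by
    have h1 : ContDiff ℝ ∞ (fun w => (1 - ρ w) * kerProfile α w) := by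
      rw [contDiff_iff_contDiffAt]
      intro w
      rcases lt_or_ge w 1 with hw | hw
      · exact (contDiff_const.sub hρs).contDiffAt.mul
          ((contDiffOn_kerProfile hα).contDiffAt (Iio_mem_nhds hw))
      -- Beyond `b` the factor `1 - ρ` is zero, so the values of the profile at `w ≥ 1`, where it is
      -- singular or meaningless, play no role.
      · have : (fun w => (1 - ρ w) * kerProfile α w) =ᶠ[𝓝 w] fun _ => 0 := by
          filter_upwards [Ioi_mem_nhds (by linarith : b < w)] with z hz
          have : ρ z = 1 := by
            refine Real.smoothTransition.one_of_one_le ?_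
            rw [le_div_iff₀ hab]
            have : b < z := hz
            linarith
          rw [this]; ring
        exact contDiffAt_const.congr_of_eventuallyEq this
    have h2 : M = fun y => 1 / (2 * Real.pi * Real.Gamma α) *
        ((1 - ρ (Real.cos y)) * kerProfile α (Real.cos y)) := by
      ext y; simp only [hM, fracKernel]; ring
    rw [h2]
    exact contDiff_const.mul (h1.comp Real.contDiff_cos)
  refine ⟨κ, M, C, hC, hMs, fun φ hφ hp x => ?_⟩
  have hKi := intervalIntegrable_fracKernel hα hα1
  have hφc : Continuous fun y => φ (x - y) := by fun_prop
  have i1 : IntervalIntegrable (fun y => fracKernel α y * (ρ (Real.cos y) * φ (x - y))) volume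
      (-Real.pi) Real.pi := hKi.mul_continuousOn (hE.continuous.mul hφc).continuousOn
  have i2 : IntervalIntegrable (fun y => M y * φ (x - y)) volume (-Real.pi) Real.pi :=
    (hMs.continuous.mul hφc).intervalIntegrable _ _
  have e1 : fracInt α φ x = (∫ y in (-Real.pi)..Real.pi,
      fracKernel α y * (ρ (Real.cos y) * φ (x - y))) +
      ∫ y in (-Real.pi)..Real.pi, M y * φ (x - y) := by
    rw [← intervalIntegral.integral_add i1 i2, fracInt]
    refine intervalIntegral.integral_congr fun y _ => ?_
    simp only [hM]; ring
  have e2 : ∫ y in (-Real.pi)..Real.pi, fracKernel α y * (ρ (Real.cos y) * φ (x - y)) =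
      locConv κ φ x := by
    rw [intervalIntegral.integral_of_le (by linarith), ← integral_Icc_eq_integral_Ioc, locConv,
      ← setIntegral_eq_integral_of_forall_compl_eq_zero (s := Icc (-Real.pi) Real.pi)
        (f := fun y => κ y * φ (x - y))]
    · refine setIntegral_congr_fun measurableSet_Icc fun y hy => ?_
      simp only [hκ]
      split_ifs with h
      · ring
      · rw [hE0 y (by linarith) (abs_le.2 hy)]; ring
    · intro y hy
      have : ε ≤ |y| := by
        by_contra hc
        exact hy (abs_le.1 (by linarith))
      rw [hC.supp y this, zero_mul]
  have e3 : ∫ y in (-Real.pi)..Real.pi, M y * φ (x - y) =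
      ∫ z in (-Real.pi)..Real.pi, M (x - z) * φ z := by
    have hMp : Function.Periodic M (2 * Real.pi) := fun y => by
      simp only [hM, Real.cos_add_two_pi, fracKernel_periodic α y]
    have hper : Function.Periodic (fun z => M (x - z) * φ z) (2 * Real.pi) := by
      intro z
      simp only [hp z]
      rw [← hMp (x - (z + 2 * Real.pi))]
      congr 2; ring
    have h1 := intervalIntegral.integral_comp_sub_left (a := -Real.pi) (b := Real.pi)
      (fun z => M (x - z) * φ z) x
    simp only [sub_sub_cancel] at h1
    rw [h1]
    have h2 := hper.intervalIntegral_add_eq (x - Real.pi) (-Real.pi)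
    rw [show x - Real.pi + 2 * Real.pi = x - -Real.pi by ring,
      show -Real.pi + 2 * Real.pi = Real.pi by ring] at h2
    exact h2
  rw [e1, e2, e3]

lemma contDiff_intervalIntegral_conv {φ : ℝ → ℝ} (hφ : Continuous φ) (a b : ℝ) (n : ℕ) :
    ∀ M : ℝ → ℝ, ContDiff ℝ n M → ContDiff ℝ n fun x => ∫ z in a..b, M (x - z) * φ z := by
  induction n with
  | zero =>
    intro M hM
    have hMc := hM.continuous
    simp only [Nat.cast_zero, contDiff_zero]
    exact intervalIntegral.continuous_parametric_intervalIntegral_of_continuous'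
      (by fun_prop) a b
  | succ n ih =>
    intro M hM
    have hMc := hM.continuous
    rw [Nat.cast_succ, contDiff_succ_iff_deriv] at hM
    obtain ⟨hd, -, hM'⟩ := hM
    have hM'c := hM'.continuous
    have key : ∀ x, HasDerivAt (fun x => ∫ z in a..b, M (x - z) * φ z)
        (∫ z in a..b, deriv M (x - z) * φ z) x := by
      intro x
      obtain ⟨B, hB⟩ := ((isCompact_closedBall x 1).prod (isCompact_uIcc (a := a)
        (b := b))).exists_bound_of_continuousOn
        (f := fun q : ℝ × ℝ => deriv M (q.1 - q.2) * φ q.2) (by fun_prop)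
      refine (intervalIntegral.hasDerivAt_integral_of_dominated_loc_of_deriv_le
        (F' := fun x z => deriv M (x - z) * φ z) (bound := fun _ => B)
        (Metric.closedBall_mem_nhds x one_pos)
        (Eventually.of_forall fun y => Continuous.aestronglyMeasurable (by fun_prop))
        (Continuous.intervalIntegrable (by fun_prop) _ _)
        (Continuous.aestronglyMeasurable (by fun_prop)) (ae_of_all _ fun z hz y hy => ?_)
        (by simp) (ae_of_all _ fun z hz y hy => ?_)).2
      · exact hB (y, z) ⟨hy, uIoc_subset_uIcc hz⟩
      · exact ((hd (y - z)).hasDerivAt.comp_sub_const y z).mul_const _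
    rw [Nat.cast_succ, contDiff_succ_iff_deriv]
    refine ⟨fun x => (key x).differentiableAt, by simp, ?_⟩
    rw [show deriv (fun x => ∫ z in a..b, M (x - z) * φ z) = _ from funext fun x => (key x).deriv]
    exact ih _ hM'

/-! ### Interior regularity by bootstrapping. -/

/-- The smooth part of the kernel is harmless, so the order-zero estimate for singular kernels
transfers to the torus operator. It may be applied with any exponent `a ≤ α`. -/
lemma LocHolder.fracInt_of_zero {α a β γ : ℝ} {k m : ℕ} (hα : 0 < α) (hα1 : α < 1) (ha : 0 < a)
    (haα : a ≤ α) (hγ : γ ≤ 1)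
    (h0 : ∀ (f : ℝ → ℝ) (x₀ : ℝ), LocHolder 0 β f x₀ → ContDiffAt ℝ 0 f x₀ →
      ∃ ε₀ > 0, ∀ ε ≤ ε₀, ∀ κ C, SingKernel a ε C κ → LocHolder k γ (locConv κ f) x₀)
    {φ : ℝ → ℝ} {x₀ : ℝ} (hφ : Continuous φ) (hp : Function.Periodic φ (2 * Real.pi))
    (h : LocHolder m β φ x₀) (hc : ContDiffAt ℝ m φ x₀) :
    LocHolder (k + m) γ (fracInt α φ) x₀ := by
  obtain ⟨ε₀, hε₀, h1⟩ := LocHolder.locConv_of_zero ha h0 m h hc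
  set ε := min ε₀ (1 / 2) with hε
  have hε0 : 0 < ε := by positivity
  have hε1 : ε < 1 := (min_le_right _ _).trans_lt (by norm_num)
  obtain ⟨κ, M, C, hκ, hM, hdec⟩ := exists_fracInt_decomposition hα hα1 hε0 hε1
  have h2 := h1 ε (min_le_left _ _) κ C (hκ.mono haα hε1)
  have h3 : LocHolder (k + m) γ (fun x => ∫ z in (-Real.pi)..Real.pi, M (x - z) * φ z) x₀ :=
    (LocHolder.of_contDiffAt (contDiff_intervalIntegral_conv hφ _ _ (k + m + 1) M
      (contDiff_infty.1 hM _)).contDiffAt).anti hγ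
  exact (h2.add h3).congr (Eventually.of_forall fun x => (hdec φ hφ hp x).symm)

/-- Interior gain: either a fraction of a derivative, or a full derivative. -/
lemma LocHolder.fracInt_gain {α β : ℝ} {m : ℕ} (hα : 0 < α) (hα1 : α < 1) (hβ : 0 ≤ β)
    {φ : ℝ → ℝ} {x₀ : ℝ} (hφ : Continuous φ) (hp : Function.Periodic φ (2 * Real.pi))
    (h : LocHolder m β φ x₀) (hc : ContDiffAt ℝ m φ x₀) (hlt : β + α / 2 < 1) :
    LocHolder m (β + α / 2) (fracInt α φ) x₀ := by
  have := LocHolder.fracInt_of_zero (k := 0) (γ := β + α / 2) hα hα1 (half_pos hα)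
    (by linarith) hlt.le
    (fun f x hf hfc => by
      rw [add_comm β]; exact hf.locConv_zero (half_pos hα) hβ (by linarith) hfc) hφ hp h hc
  rwa [zero_add] at this

lemma LocHolder.fracInt_gain_succ {α β : ℝ} {m : ℕ} (hα : 0 < α) (hα1 : α < 1) (hβ : β ≤ 1)
    {φ : ℝ → ℝ} {x₀ : ℝ} (hφ : Continuous φ) (hp : Function.Periodic φ (2 * Real.pi))
    (h : LocHolder m β φ x₀) (hc : ContDiffAt ℝ m φ x₀) (hlt : 1 < α + β) :
    LocHolder (m + 1) (α + β - 1) (fracInt α φ) x₀ := by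
  have := LocHolder.fracInt_of_zero (k := 1) (γ := α + β - 1) hα hα1 hα le_rfl (by linarith)
    (fun f x hf hfc => hf.locConv_zero_succ hα hα1 hβ hlt hfc) hφ hp h hc
  rwa [add_comm 1 m] at this

/-- Interior regularity for `g ∘ φ = |D|^{-α} φ + A`. -/
theorem LocHolder.of_steady {α A B : ℝ} (hα : 0 < α) (hα1 : α < 1) (hB : 0 < B) (hB1 : B ≤ 1)
    {φ g : ℝ → ℝ} {x₀ : ℝ} (hφ : Continuous φ) (hp : Function.Periodic φ (2 * Real.pi))
    (heq : ∀ x, g (φ x) = fracInt α φ x + A) (hg1 : ContDiffAt ℝ 1 g (φ x₀))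
    (hd : deriv g (φ x₀) ≠ 0) (m : ℕ) (hg : LocHolder m B g (φ x₀)) : LocHolder m B φ x₀ := by
  have solve : ∀ (k : ℕ) (γ : ℝ), 0 < γ → γ ≤ 1 → LocHolder k γ (fracInt α φ) x₀ →
      LocHolder k γ g (φ x₀) → LocHolder k γ φ x₀ := fun k γ h0 h1 h2 h3 =>
    LocHolder.of_comp_eq h0 h1 hφ (h2.add (LocHolder.const k γ A x₀)) heq h3 hg1 hd
  -- At a fixed order `k`, finitely many increments of `α / 2` carry any exponent up to `γ`. The cap
  -- by `γ` is the regularity available from `g`.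
  have climb : ∀ (k : ℕ) (γ : ℝ), 0 < γ → γ ≤ 1 → LocHolder k γ g (φ x₀) →
      (∃ β, 0 ≤ β ∧ LocHolder k β φ x₀ ∧ ContDiffAt ℝ k φ x₀) → LocHolder k γ φ x₀ := by
    intro k γ hγ hγ1 hgk ⟨β, hβ, hφβ, hφc⟩
    have step : ∀ N : ℕ, LocHolder k (min γ (N * (α / 2))) φ x₀ ∧ ContDiffAt ℝ k φ x₀ := by
      intro N
      induction N with
      | zero =>
        refine ⟨hφβ.anti ?_, hφc⟩
        simp only [Nat.cast_zero, zero_mul]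
        exact (min_le_right _ _).trans hβ
      | succ N ih =>
        obtain ⟨ih1, ih2⟩ := ih
        set δ := min γ (N * (α / 2)) with hδ
        have hδ0 : 0 ≤ δ := by positivity
        have hδ1 : δ ≤ 1 := (min_le_left _ _).trans hγ1
        have hle : min γ ((N + 1 : ℕ) * (α / 2)) ≤ δ + α / 2 := by
          rcases min_choice γ (N * (α / 2)) with h | h <;> rw [hδ, h]
          · exact (min_le_left _ _).trans (by linarith)
          · refine (min_le_right _ _).trans ?_
            push_cast; linarith
        have hpos : 0 < min γ ((N + 1 : ℕ) * (α / 2)) := by positivity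
        have hle1 : min γ ((N + 1 : ℕ) * (α / 2)) ≤ 1 := (min_le_left _ _).trans hγ1
        have hgk' := hgk.anti (min_le_left γ ((N + 1 : ℕ) * (α / 2)))
        refine ⟨?_, ih2⟩
        refine solve k _ hpos hle1 ?_ hgk'
        rcases lt_or_ge (δ + α / 2) 1 with hlt | hge
        · exact (LocHolder.fracInt_gain hα hα1 hδ0 hφ hp ih1 ih2 hlt).anti hle
        -- If `δ + α / 2 ≥ 1` then `α + δ > 1`, so a whole derivative is gained; only the Lipschitz
        -- bound at order `k` is kept.
        · exact ((LocHolder.fracInt_gain_succ hα hα1 hδ1 hφ hp ih1 ih2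
            (by linarith)).of_succ (by linarith)).anti hle1
    obtain ⟨N, hN⟩ := exists_nat_gt (γ / (α / 2))
    rw [div_lt_iff₀ (half_pos hα)] at hN
    have := (step N).1
    rwa [min_eq_left hN.le] at this
  have hg0 : LocHolder 0 1 g (φ x₀) := LocHolder.of_contDiffAt (by simpa using hg1)
  -- The climb starts from the exponent `0`, which only asks for bounded increments and so follows
  -- from continuity.
  have h0 : LocHolder 0 1 φ x₀ := by
    refine climb 0 1 one_pos le_rfl hg0 ⟨0, le_rfl, ⟨1, ?_⟩, by
      simpa using contDiffAt_zero.2 ⟨univ, univ_mem, hφ.continuousOn⟩⟩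
    have hc : Continuous fun q : ℝ × ℝ => |φ q.1 - φ q.2| := by fun_prop
    have h1 := hc.tendsto (x₀, x₀)
    simp only [sub_self, abs_zero] at h1
    rw [nhds_prod_eq] at h1
    filter_upwards [h1.eventually (Iio_mem_nhds one_pos)] with q hq
    rw [Real.rpow_zero, mul_one]
    exact le_of_lt hq
  induction m generalizing B with
  | zero => exact h0.anti hB1
  | succ m ih =>
    have hm : LocHolder m 1 φ x₀ := ih one_pos le_rfl (hg.of_succ hB.le)
    -- From order `m` with exponent `1` the operator reaches order `m + 1` with exponent `α`, a
    -- positive starting point for the next climb.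
    have h1 := LocHolder.fracInt_gain_succ hα hα1 le_rfl hφ hp hm (hm.contDiffAt one_pos)
      (by linarith)
    have hpos : 0 < min B (α + 1 - 1) := lt_min hB (by linarith)
    have h2 := solve (m + 1) (min B (α + 1 - 1)) hpos ((min_le_left _ _).trans hB1)
      (h1.anti (min_le_right _ _)) (hg.anti (min_le_left _ _))
    exact climb (m + 1) B hB hB1 hg ⟨_, hpos.le, h2, h2.contDiffAt hpos⟩

/-! ### The symmetrised kernel and estimates for symmetric differences. -/

/-- The odd part of the kernel. -/
noncomputable def kerDiff (α x y : ℝ) : ℝ := fracKernel α (x - y) - fracKernel α (x + y)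

/-- Convexity of the profile: its derivative is monotone, so the mean value lies between the
endpoint values. -/
lemma kerProfile_slope {α w₁ w₂ : ℝ} (hα : 0 < α) (h : w₂ < w₁) (h1 : w₁ < 1) :
    kerProfileD α 2 w₂ * (w₁ - w₂) ≤ kerProfile α w₁ - kerProfile α w₂ ∧
    kerProfile α w₁ - kerProfile α w₂ ≤ kerProfileD α 2 w₁ * (w₁ - w₂) := by
  obtain ⟨ξ, hξ, he⟩ := exists_hasDerivAt_eq_slope (kerProfile α) (kerProfileD α 2) h
    (fun w hw => (hasDerivAt_kerProfile hα (hw.2.trans_lt h1)).continuousAt.continuousWithinAt)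
    (fun w hw => hasDerivAt_kerProfile hα (hw.2.trans h1))
  have hpos : 0 < w₁ - w₂ := by linarith
  rw [eq_div_iff hpos.ne'] at he
  rw [← he]
  constructor
  · gcongr; exact kerProfileD_mono hα (hξ.2.trans h1) hξ.1.le le_rfl
  · gcongr; exact kerProfileD_mono hα h1 hξ.2.le le_rfl

lemma cos_sub_sub_cos_add (x y : ℝ) :
    Real.cos (x - y) - Real.cos (x + y) = 2 * (Real.sin x * Real.sin y) := by
  rw [Real.cos_sub, Real.cos_add]; ring

/-- The arguments of the profile differ by `2 sin x sin y > 0`, so positivity is monotonicity of the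
profile. By convexity the slope is at most the derivative at `cos (x - y)` and at least that at `cos
(x + y)`, whence the powers of `|x - y|` and `x + y`. The lower bound uses Jordan's inequality for
the sines, hence the restriction to `(0, π/2]`. -/
lemma kerDiff_bounds {α : ℝ} (hα : 0 < α) (hα1 : α < 1) :
    ∃ C > 0, ∃ c > 0,
      (∀ x ∈ Ioo 0 Real.pi, ∀ y ∈ Ioo 0 Real.pi, x ≠ y →
        0 < kerDiff α x y ∧ kerDiff α x y ≤ C * |x - y| ^ (α - 1) ∧
        kerDiff α x y ≤ C * |x - y| ^ (α - 3) * (x * y)) ∧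
      ∀ x ∈ Ioc 0 (Real.pi / 2), ∀ y ∈ Ioc 0 (Real.pi / 2), x ≠ y →
        c * (x + y) ^ (α - 3) * (x * y) ≤ kerDiff α x y := by
  obtain ⟨C₀, hC₀, hG⟩ := abs_kerProfile_le hα hα1
  obtain ⟨C₁, hC₁, hD⟩ := kerProfileD_two_le hα hα1
  obtain ⟨c₁, hc₁, hd⟩ := le_kerProfileD_two hα
  have hΓ := Real.Gamma_pos_of_pos hα
  have hπ := Real.pi_pos
  set A := 1 / (2 * Real.pi * Real.Gamma α) with hA
  have hA0 : 0 < A := by positivity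
  have hsub : ∀ x y, kerDiff α x y =
      A * (kerProfile α (Real.cos (x - y)) - kerProfile α (Real.cos (x + y))) := fun x y => by
    rw [kerDiff, fracKernel, fracKernel]; ring
  set b₁ := (2 / Real.pi ^ 2) ^ ((α - 1) / 2) with hb₁
  set b₃ := (2 / Real.pi ^ 2) ^ ((α - 3) / 2) with hb₃
  have hb₁0 : 0 < b₁ := by positivity
  have hb₃0 : 0 < b₃ := by positivity
  set D := C₀ * b₁ + |kerProfile α (-1)| * Real.pi ^ (1 - α) with hDdef
  have hD0 : 0 < D := by positivity
  have hsetup : ∀ x ∈ Ioo 0 Real.pi, ∀ y ∈ Ioo 0 Real.pi, x ≠ y →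
      |x - y| ≤ Real.pi ∧ x - y ≠ 0 ∧ Real.cos (x - y) < 1 ∧ Real.cos (x + y) < Real.cos (x - y) := by
    intro x hx y hy hxy
    have h1 : |x - y| ≤ Real.pi := abs_le.2 ⟨by linarith [hx.1, hy.2], by linarith [hx.2, hy.1]⟩
    have h2 := sub_ne_zero.2 hxy
    refine ⟨h1, h2, cos_lt_one_of_abs_le h1 h2, ?_⟩
    have := cos_sub_sub_cos_add x y
    have := mul_pos (Real.sin_pos_of_mem_Ioo hx) (Real.sin_pos_of_mem_Ioo hy)
    linarith
  refine ⟨max (A * D) (2 * A * C₁ * b₃), lt_max_of_lt_left (by positivity),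
    A * (c₁ * (8 / Real.pi ^ 2)), by positivity, ?_, ?_⟩
  · intro x hx y hy hxy
    obtain ⟨h1, h2, h3, h4⟩ := hsetup x hx y hy hxy
    obtain ⟨hs1, hs2⟩ := kerProfile_slope hα h4 h3
    have hpos : 0 < |x - y| := abs_pos.2 h2
    rw [hsub]
    refine ⟨?_, ?_, ?_⟩
    · refine mul_pos hA0 (lt_of_lt_of_le ?_ hs1)
      refine mul_pos (lt_of_lt_of_le ?_ (hd _ (Real.neg_one_le_cos _) (h4.trans h3))) (by linarith)
      have : 0 < 1 - Real.cos (x + y) := by linarith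
      positivity
    · calc _ ≤ A * (D * |x - y| ^ (α - 1)) := by
            refine mul_le_mul_of_nonneg_left ?_ hA0.le
            have e1 := (le_abs_self _).trans (hG _ (Real.neg_one_le_cos (x - y)) h3)
            have e2 := one_sub_cos_rpow_le (a := α - 1) (by linarith) h1 h2
            have e3 : kerProfile α (-1) ≤ kerProfile α (Real.cos (x + y)) := by
              rcases (Real.neg_one_le_cos (x + y)).eq_or_lt with h | h
              · rw [← h]
              · have := (kerProfile_slope hα h (h4.trans h3)).1
                have h5 := kerProfileD_nonneg (α := α) (w := -1) (by norm_num) 2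
                have h6 := mul_nonneg h5 (by linarith : 0 ≤ Real.cos (x + y) - -1)
                linarith
            have e4 : 1 ≤ Real.pi ^ (1 - α) * |x - y| ^ (α - 1) := by
              rw [show (1 : ℝ) - α = -(α - 1) by ring, Real.rpow_neg hπ.le]
              have : Real.pi ^ (α - 1) ≤ |x - y| ^ (α - 1) :=
                Real.rpow_le_rpow_of_nonpos hpos h1 (by linarith)
              rw [inv_mul_eq_div, one_le_div (by positivity)]
              exact this
            have e5 : |kerProfile α (-1)| ≤
                |kerProfile α (-1)| * (Real.pi ^ (1 - α) * |x - y| ^ (α - 1)) :=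
              le_mul_of_one_le_right (abs_nonneg _) e4
            have e6 := mul_le_mul_of_nonneg_left e2 hC₀.le
            rw [hDdef, add_mul]
            have := neg_abs_le (kerProfile α (-1))
            linarith
        _ = A * D * |x - y| ^ (α - 1) := by ring
        _ ≤ _ := by gcongr; exact le_max_left _ _
    · calc _ ≤ A * ((C₁ * (b₃ * |x - y| ^ (α - 3))) * (2 * (x * y))) := by
            refine mul_le_mul_of_nonneg_left (hs2.trans ?_) hA0.le
            rw [cos_sub_sub_cos_add]
            have hsx := Real.sin_pos_of_mem_Ioo hx
            have hsy := Real.sin_pos_of_mem_Ioo hy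
            have h5 := (Real.sin_lt hx.1).le
            have h6 := (Real.sin_lt hy.1).le
            have h7 : kerProfileD α 2 (Real.cos (x - y)) ≤ C₁ * (b₃ * |x - y| ^ (α - 3)) :=
              (hD _ (Real.neg_one_le_cos _) h3).trans
                (mul_le_mul_of_nonneg_left (one_sub_cos_rpow_le (by linarith) h1 h2) hC₁.le)
            have h8 := hx.1
            gcongr
        _ = 2 * A * C₁ * b₃ * |x - y| ^ (α - 3) * (x * y) := by ring
        _ ≤ _ := by
          have h8 := hx.1
          have h9 := hy.1
          gcongr
          exact le_max_right _ _
  · intro x hx y hy hxy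
    have hx' : x ∈ Ioo 0 Real.pi := ⟨hx.1, by linarith [hx.2]⟩
    have hy' : y ∈ Ioo 0 Real.pi := ⟨hy.1, by linarith [hy.2]⟩
    obtain ⟨h1, h2, h3, h4⟩ := hsetup x hx' y hy' hxy
    obtain ⟨hs1, hs2⟩ := kerProfile_slope hα h4 h3
    have hx0 := hx.1
    have hy0 := hy.1
    rw [hsub]
    have h5 : c₁ * (x + y) ^ (α - 3) ≤ kerProfileD α 2 (Real.cos (x + y)) := by
      refine le_trans ?_ (hd _ (Real.neg_one_le_cos _) (h4.trans h3))
      refine mul_le_mul_of_nonneg_left ?_ hc₁.le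
      have := le_one_sub_cos_rpow (a := α - 3) (x := x + y) (by linarith)
        (by rw [abs_of_pos (by linarith)]; linarith [hx.2, hy.2]) (by linarith)
      rwa [abs_of_pos (by linarith)] at this
    have h6 : 2 / Real.pi * x ≤ Real.sin x := Real.mul_le_sin hx.1.le hx.2
    have h7 : 2 / Real.pi * y ≤ Real.sin y := Real.mul_le_sin hy.1.le hy.2
    calc _ = A * (c₁ * (x + y) ^ (α - 3) * (2 * ((2 / Real.pi * x) * (2 / Real.pi * y)))) := by
          field_simp; ring
      _ ≤ A * (kerProfileD α 2 (Real.cos (x + y)) * (2 * (Real.sin x * Real.sin y))) := by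
          have : 0 ≤ kerProfileD α 2 (Real.cos (x + y)) := kerProfileD_nonneg (h4.trans h3) 2
          have : 0 ≤ Real.sin x := le_trans (by positivity) h6
          gcongr
      _ ≤ _ := by
          rw [← cos_sub_sub_cos_add]
          exact mul_le_mul_of_nonneg_left hs1 hA0.le

lemma intervalIntegrable_fracKernel' {α : ℝ} (hα : 0 < α) (hα1 : α < 1) (a b : ℝ) :
    IntervalIntegrable (fracKernel α) volume a b :=
  (fracKernel_periodic α).intervalIntegrable (t := -Real.pi) (by positivity)
    (by rw [show -Real.pi + 2 * Real.pi = Real.pi by ring]; exact intervalIntegrable_fracKernel hα hα1)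
    a b

lemma intervalIntegrable_kerDiff_mul {α : ℝ} (hα : 0 < α) (hα1 : α < 1) (x a b : ℝ) {d : ℝ → ℝ}
    (hd : Continuous d) : IntervalIntegrable (fun y => kerDiff α x y * d y) volume a b := by
  have h1 : IntervalIntegrable (fun y => fracKernel α (x - y)) volume a b := by
    have := (intervalIntegrable_fracKernel' hα hα1 (x - a) (x - b)).comp_sub_left x
    simpa using this
  have h2 : IntervalIntegrable (fun y => fracKernel α (x + y)) volume a b := by
    have := (intervalIntegrable_fracKernel' hα hα1 (x + a) (x + b)).comp_add_left x
    simpa using this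
  exact (h1.sub h2).mul_continuousOn hd.continuousOn

/-- Symmetrisation of the difference of `|D|^{-α} φ` at two points. -/
lemma fracInt_sub_fracInt {α : ℝ} (hα : 0 < α) (hα1 : α < 1) {φ : ℝ → ℝ} (hφ : Continuous φ)
    (hp : Function.Periodic φ (2 * Real.pi)) (he : Function.Even φ) (x h : ℝ) :
    fracInt α φ (x - h) - fracInt α φ (x + h) =
      ∫ y in (0 : ℝ)..Real.pi, kerDiff α x y * (φ (y - h) - φ (y + h)) := by
  set d : ℝ → ℝ := fun y => φ (y - h) - φ (y + h) with hd
  have hdc : Continuous d := by rw [hd]; fun_prop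
  have hdp : Function.Periodic d (2 * Real.pi) := fun y => by
    simp only [hd]
    rw [show y + 2 * Real.pi - h = y - h + 2 * Real.pi by ring,
      show y + 2 * Real.pi + h = y + h + 2 * Real.pi by ring, hp, hp]
  have hdo : ∀ y, d (-y) = -d y := fun y => by
    simp only [hd]
    rw [← he (-y - h), ← he (-y + h)]
    ring_nf
  have hK := intervalIntegrable_fracKernel hα hα1
  have i : ∀ z, IntervalIntegrable (fun y => fracKernel α y * φ (z - y)) volume (-Real.pi) Real.pi :=
    fun z => hK.mul_continuousOn (by fun_prop : Continuous fun y => φ (z - y)).continuousOn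
  have e1 : fracInt α φ (x - h) - fracInt α φ (x + h) =
      ∫ y in (-Real.pi)..Real.pi, fracKernel α y * d (x - y) := by
    rw [fracInt, fracInt, ← intervalIntegral.integral_sub (i _) (i _)]
    refine intervalIntegral.integral_congr fun y _ => ?_
    simp only [hd]
    rw [show x - h - y = x - y - h by ring, show x + h - y = x - y + h by ring]; ring
  have e2 : ∫ y in (-Real.pi)..Real.pi, fracKernel α y * d (x - y) =
      ∫ z in (-Real.pi)..Real.pi, fracKernel α (x - z) * d z := by
    have hper : Function.Periodic (fun z => fracKernel α (x - z) * d z) (2 * Real.pi) := by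
      intro z
      simp only [hdp z]
      rw [← fracKernel_periodic α (x - (z + 2 * Real.pi))]
      congr 2; ring
    have h1 := intervalIntegral.integral_comp_sub_left (a := -Real.pi) (b := Real.pi)
      (fun z => fracKernel α (x - z) * d z) x
    simp only [sub_sub_cancel] at h1
    rw [h1]
    have h2 := hper.intervalIntegral_add_eq (x - Real.pi) (-Real.pi)
    rw [show x - Real.pi + 2 * Real.pi = x - -Real.pi by ring,
      show -Real.pi + 2 * Real.pi = Real.pi by ring] at h2
    exact h2
  have j1 : ∀ a b, IntervalIntegrable (fun z => fracKernel α (x - z) * d z) volume a b := by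
    intro a b
    have := (intervalIntegrable_fracKernel' hα hα1 (x - a) (x - b)).comp_sub_left x
    simp only [sub_sub_cancel] at this
    exact this.mul_continuousOn hdc.continuousOn
  have j2 : ∀ a b, IntervalIntegrable (fun z => fracKernel α (x + z) * d z) volume a b := by
    intro a b
    have := (intervalIntegrable_fracKernel' hα hα1 (x + a) (x + b)).comp_add_left x
    simp only [add_sub_cancel_left] at this
    exact this.mul_continuousOn hdc.continuousOn
  -- Oddness of `d`, which comes from evenness of `φ`, folds the negative half of the period onto
  -- the positive half with the opposite sign.
  have e3 : ∫ z in (-Real.pi)..0, fracKernel α (x - z) * d z =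
      -∫ z in (0 : ℝ)..Real.pi, fracKernel α (x + z) * d z := by
    have h1 := intervalIntegral.integral_comp_neg (a := 0) (b := Real.pi)
      (fun z => fracKernel α (x - z) * d z)
    simp only [sub_neg_eq_add, hdo, mul_neg, neg_zero, intervalIntegral.integral_neg] at h1
    exact h1.symm
  rw [e1, e2, ← intervalIntegral.integral_add_adjacent_intervals (j1 _ 0) (j1 0 _), e3,
    neg_add_eq_sub, ← intervalIntegral.integral_sub (j1 _ _) (j2 _ _)]
  refine intervalIntegral.integral_congr fun y _ => ?_
  simp only [kerDiff]; ring

/-- Both points are folded into `[0, π]`. There `y - h` becomes `|y - h|`, which is at most both `y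
+ h` and `2π - (y + h)`. -/
lemma even_periodic_antitone_le {φ : ℝ → ℝ} (hp : Function.Periodic φ (2 * Real.pi))
    (he : Function.Even φ) (ha : AntitoneOn φ (Icc 0 Real.pi)) {y h : ℝ} (hy : y ∈ Icc 0 Real.pi)
    (hh : h ∈ Icc 0 Real.pi) : φ (y + h) ≤ φ (y - h) := by
  have e1 : φ (y - h) = φ |y - h| := by
    rcases abs_choice (y - h) with h | h <;> rw [h]
    exact (he _).symm
  have hm : |y - h| ∈ Icc 0 Real.pi :=
    ⟨abs_nonneg _, abs_le.2 ⟨by linarith [hy.1, hh.2], by linarith [hy.2, hh.1]⟩⟩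
  rw [e1]
  rcases le_total (y + h) Real.pi with hle | hge
  · refine ha hm ⟨by linarith [hy.1, hh.1], hle⟩ (abs_le.2 ⟨?_, ?_⟩) <;> linarith [hy.1, hh.1]
  · have e2 : φ (y + h) = φ (2 * Real.pi - (y + h)) := by
      rw [← he (2 * Real.pi - (y + h)), ← hp (-(2 * Real.pi - (y + h)))]; ring_nf
    rw [e2]
    refine ha hm ⟨by linarith [hy.2, hh.2], by linarith⟩ (abs_le.2 ⟨?_, ?_⟩) <;>
      linarith [hy.2, hh.2]

/-- Compactness makes the local constants and radii uniform, and distant pairs are handled by the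
bound `B`. The second point need not lie in `s`, which is what periodic functions require later. -/
lemma exists_holder_of_compact {f : ℝ → ℝ} {s : Set ℝ} {γ B : ℝ} (hs : IsCompact s) (hγ : 0 < γ)
    (hB : ∀ x, |f x| ≤ B) (h : ∀ x ∈ s, LocHolder 0 γ f x) :
    ∃ C, 0 ≤ C ∧ ∀ x ∈ s, ∀ y, |f x - f y| ≤ C * |x - y| ^ γ := by
  have hB0 : 0 ≤ B := (abs_nonneg _).trans (hB 0)
  have key : ∃ C ≥ 0, ∃ ε > 0, ∀ x ∈ s, ∀ y, |x - y| < ε → |f x - f y| ≤ C * |x - y| ^ γ := by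
    refine hs.induction_on (p := fun s => ∃ C ≥ 0, ∃ ε > 0, ∀ x ∈ s, ∀ y, |x - y| < ε →
      |f x - f y| ≤ C * |x - y| ^ γ) ⟨0, le_rfl, 1, one_pos, by simp⟩ ?_ ?_ ?_
    · rintro s t hst ⟨C, hC, ε, hε, H⟩
      exact ⟨C, hC, ε, hε, fun x hx => H x (hst hx)⟩
    · rintro s t ⟨C, hC, ε, hε, H⟩ ⟨C', hC', ε', hε', H'⟩
      refine ⟨max C C', le_max_of_le_left hC, min ε ε', lt_min hε hε', fun x hx y hxy => ?_⟩
      rcases hx with hx | hx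
      · exact (H x hx y (hxy.trans_le (min_le_left _ _))).trans (by gcongr; exact le_max_left _ _)
      · exact (H' x hx y (hxy.trans_le (min_le_right _ _))).trans
          (by gcongr; exact le_max_right _ _)
    · intro x hx
      obtain ⟨C, hC, H⟩ := (h x hx).of_zero_nonneg
      rw [← nhds_prod_eq, Metric.eventually_nhds_iff_ball] at H
      obtain ⟨δ, hδ, H⟩ := H
      refine ⟨Metric.ball x (δ / 2), mem_nhdsWithin_of_mem_nhds (Metric.ball_mem_nhds x (by positivity)),
        C, hC, δ / 2, by positivity, fun z hz y hzy => H (z, y) ?_⟩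
      rw [Metric.mem_ball, Real.dist_eq] at hz
      rw [← ball_prod_same]
      refine ⟨?_, ?_⟩
      · simp only [Metric.mem_ball, Real.dist_eq]; linarith
      · simp only [Metric.mem_ball, Real.dist_eq]
        calc |y - x| = |(z - x) - (z - y)| := by ring_nf
          _ ≤ |z - x| + |z - y| := abs_sub _ _
          _ < _ := by linarith
  obtain ⟨C, hC, ε, hε, H⟩ := key
  refine ⟨C + 2 * B / ε ^ γ, by positivity, fun x hx y => ?_⟩
  have h0 : 0 ≤ |x - y| ^ γ := by positivity
  rcases lt_or_ge |x - y| ε with hlt | hge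
  · refine (H x hx y hlt).trans ?_
    have : 0 ≤ 2 * B / ε ^ γ := by positivity
    nlinarith
  · have h1 : |f x - f y| ≤ 2 * B := (abs_sub _ _).trans (by linarith [hB x, hB y])
    have h2 : ε ^ γ ≤ |x - y| ^ γ := by gcongr
    have h3 : 2 * B ≤ 2 * B / ε ^ γ * |x - y| ^ γ := by
      rw [div_mul_eq_mul_div, le_div_iff₀ (by positivity)]; gcongr
    have h4 : 0 ≤ C * |x - y| ^ γ := by positivity
    linarith

/-- Mean value theorem: since `h ≤ X` and `h ≤ y`, the intermediate point is at least `(X + y) / 2`.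
The constant is `2 · 2³ · 2`, from the exponent, the halving and the length `2h`. -/
lemma rpow_sub_two_diff_le {α X y h : ℝ} (hα : 0 < α) (hα1 : α < 1) (hh : 0 < h) (hX : h ≤ X)
    (hy : h ≤ y) :
    (X + (y - h)) ^ (α - 2) - (X + (y + h)) ^ (α - 2) ≤ 32 * h * (X + y) ^ (α - 3) := by
  have h0 : 0 < X + (y - h) := by linarith
  obtain ⟨ξ, hξ, he⟩ := exists_hasDerivAt_eq_slope (fun t : ℝ => t ^ (α - 2))
    (fun t => (α - 2) * t ^ (α - 2 - 1)) (show X + (y - h) < X + (y + h) by linarith)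
    (fun t ht => (Real.continuousAt_rpow_const _ _ (Or.inl (h0.trans_le ht.1).ne')).continuousWithinAt)
    (fun t ht => Real.hasDerivAt_rpow_const (Or.inl (h0.trans ht.1).ne'))
  rw [eq_div_iff (by linarith)] at he
  have hle : ξ ^ (α - 3) ≤ (1 / 2 : ℝ) ^ (α - 3) * (X + y) ^ (α - 3) := by
    rw [← Real.mul_rpow (by norm_num) (by linarith)]
    refine Real.rpow_le_rpow_of_nonpos (by linarith) ?_ (by linarith)
    have := hξ.1
    rcases le_total y X with h | h <;> linarith
  have h8 : (1 / 2 : ℝ) ^ (α - 3) ≤ 8 := by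
    calc (1 / 2 : ℝ) ^ (α - 3) ≤ (1 / 2 : ℝ) ^ (-3 : ℝ) :=
          Real.rpow_le_rpow_of_exponent_ge (by norm_num) (by norm_num) (by linarith)
      _ = 8 := by
        rw [Real.rpow_neg (by norm_num)]; norm_num
  have e : (X + (y - h)) ^ (α - 2) - (X + (y + h)) ^ (α - 2) = (2 - α) * ξ ^ (α - 3) * (2 * h) := by
    have e1 : α - 2 - 1 = α - 3 := by ring
    rw [e1] at he
    linear_combination he
  have hp : 0 < (X + y) ^ (α - 3) := Real.rpow_pos_of_pos (by linarith) _
  rw [e]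
  calc (2 - α) * ξ ^ (α - 3) * (2 * h) ≤ 2 * (8 * (X + y) ^ (α - 3)) * (2 * h) := by
        have h1 : 0 < ξ ^ (α - 3) := Real.rpow_pos_of_pos (h0.trans hξ.1) _
        gcongr
        · linarith
        · exact hle.trans (by gcongr)
    _ = _ := by ring

lemma continuousOn_add_rpow {X a b : ℝ} (s : ℝ) (h : 0 < X + a) :
    ContinuousOn (fun y : ℝ => (X + y) ^ s) (Icc a b) := fun y hy =>
  ((continuousAt_const.add (continuousAt_id' y)).rpow_const
    (Or.inl (show X + y ≠ 0 by have := hy.1; linarith))).continuousWithinAt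

/-- Far contribution of a symmetric difference, by discrete integration by parts. -/
lemma integral_far_le {α : ℝ} (hα : 0 < α) (hα1 : α < 1) {u : ℝ → ℝ} (hu : Continuous u)
    (hu0 : ∀ x, 0 ≤ u x) {X h N : ℝ} (hh : 0 < h) (hX : h ≤ X) (hX1 : X ≤ 1 / 2) (hN : 0 ≤ N)
    (huN : ∀ y ∈ Icc 0 (2 * Real.pi), u y ≤ N * (X + y) ^ α) :
    ∫ y in (0 : ℝ)..Real.pi, (X + y) ^ (α - 2) * (u (y + h) - u (y - h)) ≤
      (32 / (2 - 2 * α) + 10) * N * h * X ^ (2 * α - 2) := by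
  have hπ := Real.pi_gt_three
  have hX0 : 0 < X := hh.trans_le hX
  have ii : ∀ (s c : ℝ) {a b : ℝ} (w : ℝ → ℝ), Continuous w → 0 < X + (a + c) → a ≤ b →
      IntervalIntegrable (fun y => (X + (y + c)) ^ s * w y) volume a b := by
    intro s c a b w hw hpos hab
    refine ContinuousOn.intervalIntegrable ?_
    rw [uIcc_of_le hab]
    have := continuousOn_add_rpow (X := X + c) (a := a) (b := b) s (by linarith)
    refine ContinuousOn.mul (this.congr fun y _ => ?_) hw.continuousOn
    simp only; ring_nf
  have e1 : ∫ y in (0 : ℝ)..Real.pi, (X + y) ^ (α - 2) * u (y + h) =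
      ∫ y in h..(Real.pi + h), (X + (y + -h)) ^ (α - 2) * u y := by
    have := intervalIntegral.integral_comp_add_right (a := 0) (b := Real.pi)
      (fun y => (X + (y + -h)) ^ (α - 2) * u y) h
    simpa using this
  have e2 : ∫ y in (0 : ℝ)..Real.pi, (X + y) ^ (α - 2) * u (y - h) =
      ∫ y in (-h)..(Real.pi - h), (X + (y + h)) ^ (α - 2) * u y := by
    have := intervalIntegral.integral_comp_sub_right (a := 0) (b := Real.pi)
      (fun y => (X + (y + h)) ^ (α - 2) * u y) h
    simpa using this
  -- Shifting variables moves the difference from `u` to the weight. On the common range `[h, π -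
  -- h]` this gains a factor `h`; the piece on `[-h, h]` has a favourable sign, and the one on `[π -
  -- h, π + h]` is short with a bounded integrand.
  have e3 : ∫ y in (0 : ℝ)..Real.pi, (X + y) ^ (α - 2) * (u (y + h) - u (y - h)) =
      (∫ y in h..(Real.pi + h), (X + (y + -h)) ^ (α - 2) * u y) -
      ∫ y in (-h)..(Real.pi - h), (X + (y + h)) ^ (α - 2) * u y := by
    rw [← e1, ← e2, ← intervalIntegral.integral_sub]
    · refine intervalIntegral.integral_congr fun y _ => ?_
      ring
    · simpa using ii (α - 2) 0 (a := 0) (b := Real.pi) (fun y => u (y + h)) (by fun_prop)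
        (by linarith) (by linarith)
    · simpa using ii (α - 2) 0 (a := 0) (b := Real.pi) (fun y => u (y - h)) (by fun_prop)
        (by linarith) (by linarith)
  have i1 := ii (α - 2) (-h) (a := h) (b := Real.pi - h) u hu (by linarith) (by linarith)
  have i2 := ii (α - 2) (-h) (a := Real.pi - h) (b := Real.pi + h) u hu (by linarith) (by linarith)
  have i3 := ii (α - 2) h (a := -h) (b := h) u hu (by linarith) (by linarith)
  have i4 := ii (α - 2) h (a := h) (b := Real.pi - h) u hu (by linarith) (by linarith)
  have e4 : 0 ≤ ∫ y in (-h)..h, (X + (y + h)) ^ (α - 2) * u y :=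
    intervalIntegral.integral_nonneg (by linarith) fun y hy =>
      mul_nonneg (Real.rpow_nonneg (by linarith [hy.1]) _) (hu0 y)
  have e5 : (∫ y in h..(Real.pi - h), (X + (y + -h)) ^ (α - 2) * u y) -
      (∫ y in h..(Real.pi - h), (X + (y + h)) ^ (α - 2) * u y) ≤
      32 * h * N * (X ^ (2 * α - 2) / (2 - 2 * α)) := by
    rw [← intervalIntegral.integral_sub i1 i4]
    calc _ ≤ ∫ y in h..(Real.pi - h), 32 * h * N * (X + y) ^ (2 * α - 3) := by
          refine intervalIntegral.integral_mono_on (by linarith) (i1.sub i4) ?_ fun y hy => ?_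
          · refine ContinuousOn.intervalIntegrable ?_
            rw [uIcc_of_le (by linarith)]
            exact continuousOn_const.mul (continuousOn_add_rpow _ (by linarith))
          · have h1 := rpow_sub_two_diff_le hα hα1 hh hX hy.1
            have hp : 0 < X + y := by linarith [hy.1]
            have h2 := huN y ⟨by linarith [hy.1], by linarith [hy.2]⟩
            have h3 : (X + y) ^ (2 * α - 3) = (X + y) ^ (α - 3) * (X + y) ^ α := by
              rw [← Real.rpow_add hp]; ring_nf
            calc _ = ((X + (y - h)) ^ (α - 2) - (X + (y + h)) ^ (α - 2)) * u y := by ring_nf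
              _ ≤ (32 * h * (X + y) ^ (α - 3)) * (N * (X + y) ^ α) := by
                  have := hu0 y
                  gcongr
              _ = _ := by rw [h3]; ring
      _ ≤ _ := by
          rw [intervalIntegral.integral_const_mul]
          refine mul_le_mul_of_nonneg_left ?_ (by positivity)
          have h1 := intervalIntegral.integral_comp_add_left (a := h) (b := Real.pi - h)
            (fun y : ℝ => y ^ (2 * α - 3)) X
          rw [h1, integral_rpow (Or.inr ⟨by linarith, by
            rw [uIcc_of_le (by linarith)]; intro h; linarith [h.1]⟩),
            show 2 * α - 3 + 1 = -(2 - 2 * α) by ring, div_neg, ← neg_div, neg_sub]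
          gcongr
          · linarith
          · have h2 : 0 ≤ (X + (Real.pi - h)) ^ (-(2 - 2 * α)) :=
              Real.rpow_nonneg (by linarith) _
            have h3 : (X + h) ^ (-(2 - 2 * α)) ≤ X ^ (-(2 - 2 * α)) :=
              Real.rpow_le_rpow_of_nonpos hX0 (by linarith) (by linarith)
            rw [show 2 * α - 2 = -(2 - 2 * α) by ring]
            linarith
  have e6 : ∫ y in (Real.pi - h)..(Real.pi + h), (X + (y + -h)) ^ (α - 2) * u y ≤
      10 * N * h * X ^ (2 * α - 2) := by
    have hb : ∀ y ∈ Icc (Real.pi - h) (Real.pi + h), (X + (y + -h)) ^ (α - 2) * u y ≤ 5 * N := by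
      intro y hy
      have h1 : (X + (y + -h)) ^ (α - 2) ≤ 1 :=
        Real.rpow_le_one_of_one_le_of_nonpos (by linarith [hy.1]) (by linarith)
      have h2 := huN y ⟨by linarith [hy.1], by linarith [hy.2]⟩
      have h3 : (X + y) ^ α ≤ 5 := by
        calc (X + y) ^ α ≤ (X + y) ^ (1 : ℝ) :=
              Real.rpow_le_rpow_of_exponent_le (by linarith [hy.1]) hα1.le
          _ ≤ 5 := by rw [Real.rpow_one]; linarith [hy.2, Real.pi_lt_d2]
      calc _ ≤ 1 * (N * 5) := by
            have := hu0 y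
            gcongr
            exact h2.trans (by gcongr)
        _ = _ := by ring
    calc _ ≤ ∫ _ in (Real.pi - h)..(Real.pi + h), 5 * N :=
          intervalIntegral.integral_mono_on (by linarith) i2 (by simp) hb
      _ = 10 * N * h * 1 := by
          rw [intervalIntegral.integral_const, smul_eq_mul]; ring
      _ ≤ _ := by
          gcongr
          exact Real.one_le_rpow_of_pos_of_le_one_of_nonpos hX0 (by linarith) (by linarith)
  rw [e3, ← intervalIntegral.integral_add_adjacent_intervals i1 i2,
    ← intervalIntegral.integral_add_adjacent_intervals i3 i4]
  have : (32 / (2 - 2 * α) + 10) * N * h * X ^ (2 * α - 2) =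
    32 * h * N * (X ^ (2 * α - 2) / (2 - 2 * α)) + 10 * N * h * X ^ (2 * α - 2) := by ring
  linarith

lemma integral_abs_sub_rpow {α : ℝ} (hα : 0 < α) (X : ℝ) {r : ℝ} (hr : 0 ≤ r) :
    ∫ y in (X - r)..(X + r), |X - y| ^ (α - 1) = 2 * (r ^ α / α) := by
  have h1 := intervalIntegral.integral_comp_sub_left (a := X - r) (b := X + r)
    (fun t : ℝ => |t| ^ (α - 1)) X
  rw [h1, show X - (X + r) = -r by ring, show X - (X - r) = r by ring]
  have hi := fun a b => intervalIntegrable_abs_rpow (a := α - 1) (by linarith) a b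
  have h2 : ∫ t in (0 : ℝ)..r, |t| ^ (α - 1) = r ^ α / α := by
    rw [intervalIntegral.integral_congr (g := fun t : ℝ => t ^ (α - 1)) fun t ht => ?_,
      integral_rpow (Or.inl (by linarith))]
    · rw [sub_add_cancel, Real.zero_rpow hα.ne', sub_zero]
    · rw [uIcc_of_le hr] at ht
      simp only [abs_of_nonneg ht.1]
  have h3 : ∫ t in (-r)..0, |t| ^ (α - 1) = r ^ α / α := by
    rw [← h2]
    have := intervalIntegral.integral_comp_neg (a := 0) (b := r) (fun t : ℝ => |t| ^ (α - 1))
    simpa using this.symm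
  rw [← intervalIntegral.integral_add_adjacent_intervals (hi (-r) 0) (hi 0 r), h2, h3]
  ring

/-- Near and far parts of the symmetrised integral. -/
lemma exists_integral_kerDiff_le {α : ℝ} (hα : 0 < α) (hα1 : α < 1) :
    ∃ C₁ > 0, ∀ θ > 0, θ ≤ 1 / 2 → ∃ C₂ > 0, ∀ u : ℝ → ℝ, Continuous u → (∀ x, 0 ≤ u x) →
      ∀ X h N S : ℝ, 0 < h → h ≤ X → X ≤ 1 / 2 → 0 ≤ N → 0 ≤ S →
      (∀ y ∈ Icc 0 Real.pi, u (y - h) ≤ u (y + h)) →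
      (∀ y ∈ Icc 0 (2 * Real.pi), u y ≤ N * (X + y) ^ α) →
      (∀ y, |X - y| ≤ θ * X → u (y + h) - u (y - h) ≤ S) →
      ∫ y in (0 : ℝ)..Real.pi, kerDiff α X y * (u (y + h) - u (y - h)) ≤
        C₁ * S * (θ * X) ^ α + C₂ * N * h * X ^ (2 * α - 1) := by
  obtain ⟨C, hC, -, -, hk, -⟩ := kerDiff_bounds hα hα1
  -- The near constant is fixed before `θ`, so the near term can later be made small by shrinking
  -- `θ`.
  refine ⟨C * (2 / α), by positivity, fun θ hθ hθ2 => ?_⟩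
  have hL : 0 < 32 / (2 - 2 * α) + 10 := by
    have : 0 < 2 - 2 * α := by linarith
    positivity
  refine ⟨C * (θ / 3) ^ (α - 3) * (32 / (2 - 2 * α) + 10), by positivity, ?_⟩
  intro u hu hu0 X h N S hh hX hX1 hN hS hmono huN hS'
  have hπ := Real.pi_gt_three
  have hX0 : 0 < X := hh.trans_le hX
  set d : ℝ → ℝ := fun y => u (y + h) - u (y - h) with hd
  have hdc : Continuous d := by rw [hd]; fun_prop
  set a := X - θ * X with ha
  set b := X + θ * X with hb
  have ha0 : 0 < a := by rw [ha]; nlinarith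
  have hbπ : b < Real.pi := by rw [hb]; nlinarith
  have hab : a ≤ b := by rw [ha, hb]; nlinarith
  set K := C * (θ / 3) ^ (α - 3) * X with hK
  have hK0 : 0 < K := by positivity
  have iN : IntervalIntegrable (fun y => |X - y| ^ (α - 1)) volume a b := by
    have := (intervalIntegrable_abs_rpow (a := α - 1) (by linarith) (X - a) (X - b)).comp_sub_left X
    simpa using this
  have iN' : IntervalIntegrable ((Icc a b).indicator fun y => |X - y| ^ (α - 1)) volume 0 Real.pi := by
    rw [intervalIntegrable_iff_integrableOn_Ioc_of_le (by linarith)]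
    refine Integrable.integrableOn ?_
    rw [integrable_indicator_iff measurableSet_Icc, integrableOn_Icc_iff_integrableOn_Ioc,
      ← intervalIntegrable_iff_integrableOn_Ioc_of_le hab]
    exact iN
  have iF : IntervalIntegrable (fun y => (X + y) ^ (α - 2) * d y) volume 0 Real.pi := by
    refine ContinuousOn.intervalIntegrable ?_
    rw [uIcc_of_le (by linarith)]
    exact (continuousOn_add_rpow _ (by linarith)).mul hdc.continuousOn
  have eN : ∫ y in (0 : ℝ)..Real.pi, (Icc a b).indicator (fun y => |X - y| ^ (α - 1)) y =
      2 * ((θ * X) ^ α / α) := by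
    rw [intervalIntegral.integral_of_le (by linarith), setIntegral_indicator measurableSet_Icc,
      inter_eq_self_of_subset_right (show Icc a b ⊆ Ioc 0 Real.pi from
        fun y hy => ⟨ha0.trans_le hy.1, hy.2.trans hbπ.le⟩),
      integral_Icc_eq_integral_Ioc, ← intervalIntegral.integral_of_le hab,
      integral_abs_sub_rpow hα X (by positivity)]
  have hne : ∀ z : ℝ, ∀ᵐ y ∂(volume.restrict (Icc 0 Real.pi)), y ≠ z := fun z =>
    ae_restrict_of_ae (by simp [ae_iff])
  calc _ ≤ ∫ y in (0 : ℝ)..Real.pi, (C * S * (Icc a b).indicator (fun y => |X - y| ^ (α - 1)) y +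
          K * ((X + y) ^ (α - 2) * d y)) := by
        refine intervalIntegral.integral_mono_ae_restrict (by linarith)
          (intervalIntegrable_kerDiff_mul hα hα1 X 0 Real.pi hdc)
          ((iN'.const_mul _).add (iF.const_mul _)) ?_
        filter_upwards [hne 0, hne Real.pi, hne X, ae_restrict_mem measurableSet_Icc]
          with y h1 h2 h3 hy
        have hy' : y ∈ Ioo 0 Real.pi := ⟨lt_of_le_of_ne hy.1 h1.symm, lt_of_le_of_ne hy.2 h2⟩
        obtain ⟨-, k1, k2⟩ := hk X ⟨hX0, by linarith⟩ y hy' h3.symm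
        have hd0 : 0 ≤ d y := by simp only [hd]; linarith [hmono y hy]
        have hy0 := hy'.1
        have hF : 0 ≤ (X + y) ^ (α - 2) * d y := by positivity
        by_cases hm : y ∈ Icc a b
        · rw [indicator_of_mem hm]
          have hdS : d y ≤ S := hS' y (abs_le.2 ⟨by linarith [hm.2], by linarith [hm.1]⟩)
          have : kerDiff α X y * d y ≤ (C * |X - y| ^ (α - 1)) * S := by gcongr
          have h5 := mul_nonneg hK0.le hF
          linarith
        · rw [indicator_of_notMem hm, mul_zero, zero_add]
          -- Outside the window `|X - y| ≤ θ X`, the distance `|X - y|` is comparable to `X + y`;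
          -- since `θ ≤ 1/2`, the factor `θ / 3` suffices.
          have hfar : θ / 3 * (X + y) ≤ |X - y| := by
            by_contra hcon
            push Not at hcon
            rw [abs_lt] at hcon
            refine hm ⟨?_, ?_⟩ <;> simp only [ha, hb] <;> nlinarith [hcon.1, hcon.2]
          have h6 : |X - y| ^ (α - 3) ≤ (θ / 3) ^ (α - 3) * (X + y) ^ (α - 3) := by
            rw [← Real.mul_rpow (by positivity) (by positivity)]
            exact Real.rpow_le_rpow_of_nonpos (by positivity) hfar (by linarith)
          have h7 : (X + y) ^ (α - 2) = (X + y) ^ (α - 3) * (X + y) := by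
            rw [← Real.rpow_add_one (by positivity)]; ring_nf
          calc kerDiff α X y * d y ≤
                (C * ((θ / 3) ^ (α - 3) * (X + y) ^ (α - 3)) * (X * (X + y))) * d y := by
                refine mul_le_mul_of_nonneg_right (k2.trans ?_) hd0
                gcongr
                linarith
            _ = _ := by rw [h7, hK]; ring
    _ = C * S * (2 * ((θ * X) ^ α / α)) + K * ∫ y in (0 : ℝ)..Real.pi, (X + y) ^ (α - 2) * d y := by
        rw [intervalIntegral.integral_add (iN'.const_mul _) (iF.const_mul _),
          intervalIntegral.integral_const_mul, intervalIntegral.integral_const_mul, eN]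
    _ ≤ C * S * (2 * ((θ * X) ^ α / α)) +
          K * ((32 / (2 - 2 * α) + 10) * N * h * X ^ (2 * α - 2)) := by
        gcongr
        exact integral_far_le hα hα1 hu hu0 hh hX hX1 hN huN
    _ = _ := by
        have : X ^ (2 * α - 1) = X ^ (2 * α - 2) * X := by
          rw [← Real.rpow_add_one hX0.ne']; ring_nf
        rw [this, hK]; ring

/-! ### Exact Hölder behaviour at a crest. -/

/-- `φ` is a profile with a crest at `0` solving `g ∘ φ = |D|^{-α} φ + const`, where `g` is
quadratically degenerate at the height `φ 0` of the crest. -/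
structure IsCrest (α m M η : ℝ) (φ g : ℝ → ℝ) : Prop where
  continuous : Continuous φ
  periodic : Function.Periodic φ (2 * Real.pi)
  even : Function.Even φ
  antitone : AntitoneOn φ (Icc 0 Real.pi)
  steady : ∃ A, ∀ x, g (φ x) = fracInt α φ x + A
  lt : ∀ x ∈ Ioc 0 Real.pi, φ x < φ 0
  m_pos : 0 < m
  M_pos : 0 < M
  η_pos : 0 < η
  lower : ∀ a b, φ 0 - η ≤ b → b ≤ a → a ≤ φ 0 → m * (a - b) * (φ 0 - b) ≤ g a - g b
  upper : ∀ b, φ 0 - η ≤ b → b ≤ φ 0 → g (φ 0) - g b ≤ M * (φ 0 - b) ^ 2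

lemma even_periodic_antitone_le_zero {φ : ℝ → ℝ} (hp : Function.Periodic φ (2 * Real.pi))
    (he : Function.Even φ) (ha : AntitoneOn φ (Icc 0 Real.pi)) (x : ℝ) : φ x ≤ φ 0 := by
  obtain ⟨y, hy, hxy⟩ := hp.exists_mem_Ico₀ (by positivity) x
  rw [hxy]
  have h : y / 2 ∈ Icc 0 Real.pi := ⟨by linarith [hy.1], by linarith [hy.2]⟩
  simpa using even_periodic_antitone_le hp he ha h h

lemma even_apply_abs {φ : ℝ → ℝ} (he : Function.Even φ) (x : ℝ) : φ |x| = φ x := by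
  rcases abs_choice x with h | h <;> rw [h]
  exact he x

namespace IsCrest

variable {α m M η : ℝ} {φ g : ℝ → ℝ}

lemma le (h : IsCrest α m M η φ g) (x : ℝ) : φ x ≤ φ 0 :=
  even_periodic_antitone_le_zero h.periodic h.even h.antitone x

lemma sub_eq_integral (H : IsCrest α m M η φ g) (hα : 0 < α) (hα1 : α < 1) (x h : ℝ) :
    g (φ (x - h)) - g (φ (x + h)) =
      ∫ y in (0 : ℝ)..Real.pi, kerDiff α x y * ((φ 0 - φ (y + h)) - (φ 0 - φ (y - h))) := by
  obtain ⟨A, hA⟩ := H.steady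
  rw [hA, hA, add_sub_add_right_eq_sub,
    fracInt_sub_fracInt hα hα1 H.continuous H.periodic H.even]
  refine intervalIntegral.integral_congr fun y _ => ?_
  ring

lemma exists_near (H : IsCrest α m M η φ g) :
    ∃ r > 0, r ≤ 1 / 2 ∧ ∀ x ∈ Icc 0 r, φ 0 - η ≤ φ x := by
  have h1 : ∀ᶠ x in 𝓝 (0 : ℝ), φ 0 - η < φ x :=
    H.continuous.continuousAt.eventually (Ioi_mem_nhds (by linarith [H.η_pos]))
  obtain ⟨ε, hε, h2⟩ := Metric.eventually_nhds_iff.1 h1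
  refine ⟨min (ε / 2) (1 / 2), by positivity, min_le_right _ _, fun x hx => (h2 ?_).le⟩
  rw [Real.dist_eq, sub_zero, abs_of_nonneg hx.1]
  linarith [hx.2.trans (min_le_left (ε / 2) (1 / 2))]

/-- The symmetrised identity at centre and step `x / 2`, with only `3x/4 ≤ y ≤ 3x/2` kept. There `y
- x/2 ≤ x` and `y + x/2 ≥ 5x/4`, so monotonicity bounds the difference below, while the kernel is at
least of order `x ^ (α - 1)`. -/
lemma integral_lower (H : IsCrest α m M η φ g) (hα : 0 < α) (hα1 : α < 1) :
    ∃ c > 0, ∀ x ∈ Ioc (0 : ℝ) (1 / 2),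
      c * x ^ α * (φ x - φ (5 / 4 * x)) ≤ g (φ 0) - g (φ x) := by
  obtain ⟨_, _, c, hc, hk, hk2⟩ := kerDiff_bounds hα hα1
  have hπ := Real.pi_gt_three
  refine ⟨c * 2 ^ (α - 3) * (9 / 32), by positivity, fun x hx => ?_⟩
  have hx0 := hx.1
  have hx1 := hx.2
  have h1 := H.sub_eq_integral hα hα1 (x / 2) (x / 2)
  rw [sub_self, add_halves] at h1
  rw [h1]
  set d : ℝ → ℝ := fun y => (φ 0 - φ (y + x / 2)) - (φ 0 - φ (y - x / 2)) with hd
  have hdc : Continuous d := by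
    have := H.continuous
    rw [hd]; fun_prop
  have hd0 : ∀ y ∈ Icc 0 Real.pi, 0 ≤ d y := fun y hy => by
    have := even_periodic_antitone_le H.periodic H.even H.antitone hy
      (h := x / 2) ⟨by linarith, by linarith⟩
    simp only [hd]; linarith
  have hi := intervalIntegrable_kerDiff_mul hα hα1 (x / 2) 0 Real.pi hdc
  have hi' := intervalIntegrable_kerDiff_mul hα hα1 (x / 2) (3 / 4 * x) (3 / 2 * x) hdc
  have e : c * 2 ^ (α - 3) * (9 / 32) * x ^ α = (3 / 4 * x) * (c * (2 * x) ^ (α - 3) * (3 / 8 * x ^ 2)) := by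
    rw [Real.mul_rpow (by norm_num) hx0.le, Real.rpow_sub hx0 α 3]
    have : x ^ (3 : ℝ) = x ^ 3 := by norm_cast
    rw [this]; field_simp; norm_num
  calc _ = ∫ y in (3 / 4 * x)..(3 / 2 * x),
        c * (2 * x) ^ (α - 3) * (3 / 8 * x ^ 2) * (φ x - φ (5 / 4 * x)) := by
        rw [intervalIntegral.integral_const, smul_eq_mul, e]; ring
    _ ≤ ∫ y in (3 / 4 * x)..(3 / 2 * x), kerDiff α (x / 2) y * d y := by
        refine intervalIntegral.integral_mono_on (by linarith) (by simp) hi' fun y hy => ?_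
        have hy0 : 0 < y := by linarith [hy.1]
        have k1 := hk2 (x / 2) ⟨by linarith, by linarith⟩ y ⟨hy0, by linarith [hy.2]⟩
          (by linarith [hy.1])
        have k2 : c * (2 * x) ^ (α - 3) * (3 / 8 * x ^ 2) ≤ kerDiff α (x / 2) y := by
          refine le_trans ?_ k1
          have h2 : (2 * x) ^ (α - 3) ≤ (x / 2 + y) ^ (α - 3) :=
            Real.rpow_le_rpow_of_nonpos (by linarith) (by linarith [hy.2]) (by linarith)
          have h3 : 3 / 8 * x ^ 2 ≤ x / 2 * y := by nlinarith [hy.1]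
          gcongr
        have d1 : φ (y + x / 2) ≤ φ (5 / 4 * x) := H.antitone ⟨by linarith, by linarith⟩
          ⟨by linarith, by linarith [hy.2]⟩ (by linarith [hy.1])
        have d2 : φ x ≤ φ (y - x / 2) := H.antitone ⟨by linarith [hy.1], by linarith [hy.2]⟩
          ⟨by linarith, by linarith⟩ (by linarith [hy.2])
        have d3 : φ (5 / 4 * x) ≤ φ x := H.antitone ⟨by linarith, by linarith⟩
          ⟨by linarith, by linarith⟩ (by linarith)
        refine mul_le_mul k2 ?_ (by linarith) (le_trans (by positivity) k2)
        simp only [hd]; linarith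
    _ ≤ _ := by
        refine intervalIntegral.integral_mono_interval (by linarith) (by linarith) (by linarith)
          ?_ hi
        rw [← restrict_Ioo_eq_restrict_Ioc]
        filter_upwards [ae_restrict_mem measurableSet_Ioo,
          ae_restrict_of_ae (show ∀ᵐ y, y ≠ x / 2 by simp [ae_iff])] with y hy hyx
        exact mul_nonneg (hk (x / 2) ⟨by linarith, by linarith⟩ y hy hyx.symm).1.le
          (hd0 y ⟨hy.1.le, hy.2.le⟩)

lemma continuousOn_div (H : IsCrest α m M η φ g) {a b : ℝ} (ha : 0 < a) :
    ContinuousOn (fun y => (φ 0 - φ y) / y ^ α) (Icc a b) := by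
  have := H.continuous
  refine ContinuousOn.div (by fun_prop) (fun y hy => ?_) fun y hy =>
    (Real.rpow_pos_of_pos (ha.trans_le hy.1) _).ne'
  exact (Real.continuousAt_rpow_const _ _ (Or.inl (ha.trans_le hy.1).ne')).continuousWithinAt

/-- Let `u = φ 0 - φ` and let `y` minimise `u / y^α` on `[x, 5r/4]`. If `y < r`, then `5y/4` is
still admissible, so `u (5y/4) ≥ (5/4)^α u y`. Combined with `integral_lower` and the quadratic
upper bound, this gives `M u² ≥ c ((5/4)^α - 1) y^α u` at `y`, a lower bound independent of `x`. -/
lemma exists_lower (H : IsCrest α m M η φ g) (hα : 0 < α) (hα1 : α < 1) :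
    ∃ r > 0, ∃ c > 0, ∀ x ∈ Ioc 0 r, c * x ^ α ≤ φ 0 - φ x := by
  obtain ⟨r, hr, hr1, hη⟩ := H.exists_near
  obtain ⟨c, hc, hk⟩ := H.integral_lower hα hα1
  have hπ := Real.pi_gt_three
  have hM := H.M_pos
  have hq : 0 < (5 / 4 : ℝ) ^ α - 1 := by
    have : (1 : ℝ) < (5 / 4 : ℝ) ^ α := Real.one_lt_rpow (by norm_num) hα
    linarith
  have hur : 0 < φ 0 - φ r := by linarith [H.lt r ⟨hr, by linarith⟩]
  -- This is the value that the inequality at an interior minimum forces on `u / y^α`; the other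
  -- entry of `v₀` covers a minimum at `y ≥ r`.
  set ε := c * ((5 / 4 : ℝ) ^ α - 1) / M with hε
  set v₀ := min ε ((φ 0 - φ r) / (5 / 4 * r) ^ α) with hv₀
  refine ⟨r, hr, v₀, by positivity, fun x hx => ?_⟩
  obtain ⟨y, hy, hmin⟩ := isCompact_Icc.exists_isMinOn ⟨x, le_rfl, by linarith [hx.1, hx.2]⟩
    (H.continuousOn_div hx.1 (b := 5 / 4 * r))
  rw [isMinOn_iff] at hmin
  have hy0 : 0 < y := hx.1.trans_le hy.1
  have hyα : 0 < y ^ α := Real.rpow_pos_of_pos hy0 _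
  have hxα : 0 < x ^ α := Real.rpow_pos_of_pos hx.1 _
  have key : v₀ ≤ (φ 0 - φ y) / y ^ α := by
    rcases le_or_gt r y with hry | hyr
    · refine (min_le_right _ _).trans ?_
      have h1 := H.antitone ⟨hr.le, by linarith⟩ ⟨hy0.le, by linarith [hy.2]⟩ hry
      have h2 : y ^ α ≤ (5 / 4 * r) ^ α := Real.rpow_le_rpow hy0.le hy.2 hα.le
      gcongr
      linarith
    · by_contra! hlt
      have h1 : (φ 0 - φ y) < ε * y ^ α := (div_lt_iff₀ hyα).1 (hlt.trans_le (min_le_left _ _))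
      have hu : 0 < φ 0 - φ y := by linarith [H.lt y ⟨hy0, by linarith⟩]
      have h2 := hmin (5 / 4 * y) ⟨by linarith [hy.1], by linarith⟩
      rw [Real.mul_rpow (by norm_num) hy0.le, div_le_div_iff₀ hyα (by positivity)] at h2
      have h3 : (5 / 4 : ℝ) ^ α * (φ 0 - φ y) ≤ φ 0 - φ (5 / 4 * y) :=
        le_of_mul_le_mul_right (by linarith) hyα
      have h4 := hk y ⟨hy0, by linarith⟩
      have h5 := H.upper (φ y) (hη y ⟨hy0.le, hyr.le⟩) (H.le y)
      have h6 : c * y ^ α * (((5 / 4 : ℝ) ^ α - 1) * (φ 0 - φ y)) ≤ c * y ^ α * (φ y - φ (5 / 4 * y)) := by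
        gcongr; linarith
      have h7 : M * (φ 0 - φ y) * (φ 0 - φ y) < M * (ε * y ^ α) * (φ 0 - φ y) := by gcongr
      have h8 : M * (ε * y ^ α) * (φ 0 - φ y) = c * y ^ α * (((5 / 4 : ℝ) ^ α - 1) * (φ 0 - φ y)) := by
        rw [hε]; field_simp
      nlinarith
  have := key.trans (hmin x ⟨le_rfl, by linarith [hx.1, hx.2]⟩)
  rwa [le_div_iff₀ hxα] at this

/-- Monotonicity extends the bound below `ε`, and reflection at `π` extends it to a full period, as
the far estimate needs. -/
lemma reflect_le {N ε : ℝ} (H : IsCrest α m M η φ g) (hα : 0 < α) (hε : 0 < ε) (hεπ : ε ≤ Real.pi)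
    (hN : 0 ≤ N) (h : ∀ y ∈ Icc ε Real.pi, φ 0 - φ y ≤ N * y ^ α) {y : ℝ}
    (hy : y ∈ Icc 0 (2 * Real.pi)) : φ 0 - φ y ≤ N * (max y ε) ^ α := by
  have base : ∀ z ∈ Icc 0 Real.pi, φ 0 - φ z ≤ N * (max z ε) ^ α := by
    intro z hz
    have hm : max z ε ∈ Icc ε Real.pi := ⟨le_max_right _ _, max_le hz.2 hεπ⟩
    have h1 := H.antitone hz ⟨hε.le.trans hm.1, hm.2⟩ (le_max_left z ε)
    linarith [h _ hm]
  rcases le_total y Real.pi with hle | hge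
  · exact base y ⟨hy.1, hle⟩
  · have e : φ y = φ (2 * Real.pi - y) := by
      rw [← H.even (2 * Real.pi - y), ← H.periodic (-(2 * Real.pi - y))]; ring_nf
    rw [e]
    refine (base _ ⟨by linarith [hy.2], by linarith⟩).trans ?_
    have hp : 0 ≤ max (2 * Real.pi - y) ε := hε.le.trans (le_max_right _ _)
    have : max (2 * Real.pi - y) ε ≤ max y ε := max_le_max (by linarith) le_rfl
    gcongr

/-- The maximum `N` of `u / y^α`, where `u = φ 0 - φ`, is taken on `[ε, π]`, since boundedness near
`0` is not yet known. At a maximiser close to `0`, quadratic degeneracy gives at least `m N²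
y^(2α)`, while the near and far parts are linear in `N` with the same power of `y`. Dividing by `N`
bounds it independently of `ε`. -/
lemma exists_upper (H : IsCrest α m M η φ g) (hα : 0 < α) (hα1 : α < 1) :
    ∃ C > 0, ∀ x ∈ Icc 0 Real.pi, φ 0 - φ x ≤ C * x ^ α := by
  obtain ⟨r, hr, hr1, hη⟩ := H.exists_near
  obtain ⟨C₁, hC₁, hk⟩ := exists_integral_kerDiff_le hα hα1
  obtain ⟨C₂, hC₂, hk⟩ := hk (1 / 2) (by norm_num) le_rfl
  have hπ := Real.pi_gt_three
  have hm := H.m_pos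
  have hφ := H.continuous
  have hbig : 0 < φ 0 - φ Real.pi := by linarith [H.lt Real.pi ⟨by linarith, le_rfl⟩]
  set K := max ((φ 0 - φ Real.pi) / r ^ α) ((8 * C₁ + 2 * C₂) / m) with hK
  have hK0 : 0 < K := lt_max_of_lt_left (by positivity)
  have main : ∀ ε ∈ Ioc 0 r, ∀ x ∈ Icc ε Real.pi, φ 0 - φ x ≤ K * x ^ α := by
    intro ε hε x hx
    obtain ⟨y, hy, hmax⟩ := isCompact_Icc.exists_isMaxOn ⟨x, hx⟩
      (H.continuousOn_div hε.1 (b := Real.pi))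
    rw [isMaxOn_iff] at hmax
    have hε0 := hε.1
    have hy0 : 0 < y := hε.1.trans_le hy.1
    have hyα : 0 < y ^ α := Real.rpow_pos_of_pos hy0 _
    have hxα : 0 < x ^ α := Real.rpow_pos_of_pos (hε.1.trans_le hx.1) _
    rw [← div_le_iff₀ hxα]
    refine (hmax x hx).trans ?_
    set N := (φ 0 - φ y) / y ^ α with hN
    have hN0 : 0 ≤ N := div_nonneg (by linarith [H.le y]) hyα.le
    rcases le_or_gt r y with hry | hyr
    · refine le_max_of_le_left ?_
      have h1 := H.antitone ⟨hy0.le, hy.2⟩ ⟨by linarith, le_rfl⟩ hy.2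
      have h2 : r ^ α ≤ y ^ α := Real.rpow_le_rpow hr.le hry hα.le
      rw [hN]
      gcongr
    · refine le_max_of_le_right ?_
      rcases hN0.eq_or_lt with h0 | hNpos
      · rw [← h0]; positivity
      have hNb : ∀ z ∈ Icc ε Real.pi, φ 0 - φ z ≤ N * z ^ α := fun z hz => by
        rw [← div_le_iff₀ (Real.rpow_pos_of_pos (hε.1.trans_le hz.1) _)]; exact hmax z hz
      set X := y / 2 with hX
      have hX0 : 0 < X := by positivity
      have hyX : y = 2 * X := by rw [hX]; ring
      -- As `ε ≤ y = 2X`, the truncated argument `max z ε` is at most `2 (X + z)`, and `2^α ≤ 2`.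
      have hr2 : ∀ z ∈ Icc 0 (2 * Real.pi), φ 0 - φ z ≤ 2 * N * (X + z) ^ α := by
        intro z hz
        refine (H.reflect_le hα hε.1 (by linarith [hε.2]) hN0 hNb hz).trans ?_
        have h1 : max z ε ≤ 2 * (X + z) := max_le (by linarith [hz.1]) (by linarith [hz.1, hy.1])
        have h2 : (max z ε) ^ α ≤ 2 * (X + z) ^ α := by
          calc (max z ε) ^ α ≤ (2 * (X + z)) ^ α :=
                Real.rpow_le_rpow (hε.1.le.trans (le_max_right _ _)) h1 hα.le
            _ = 2 ^ α * (X + z) ^ α := Real.mul_rpow (by norm_num) (by linarith [hz.1])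
            _ ≤ 2 ^ (1 : ℝ) * (X + z) ^ α := by
                have : 0 ≤ X + z := by linarith [hz.1]
                gcongr; norm_num
            _ = _ := by rw [Real.rpow_one]
        nlinarith
      have hb := hk (fun z => φ 0 - φ z) (by fun_prop) (fun z => by linarith [H.le z]) X X (2 * N)
        (8 * N * X ^ α) hX0 le_rfl (by linarith) (by positivity) (by positivity)
        (fun z hz => by
          have := even_periodic_antitone_le H.periodic H.even H.antitone hz
            (h := X) ⟨hX0.le, by linarith⟩
          linarith) hr2
        (fun z hz => by
          rw [abs_le] at hz
          have h1 := hr2 (z + X) ⟨by linarith [hz.2], by linarith [hz.1]⟩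
          have h2 : (X + (z + X)) ^ α ≤ 4 * X ^ α := by
            calc (X + (z + X)) ^ α ≤ (4 * X) ^ α :=
                  Real.rpow_le_rpow (by linarith [hz.2]) (by linarith [hz.1]) hα.le
              _ = 4 ^ α * X ^ α := Real.mul_rpow (by norm_num) hX0.le
              _ ≤ 4 ^ (1 : ℝ) * X ^ α := by
                gcongr; norm_num
              _ = _ := by rw [Real.rpow_one]
          have h3 := mul_le_mul_of_nonneg_left h2 (by positivity : 0 ≤ 2 * N)
          linarith [H.le (z - X)])
      have he := H.sub_eq_integral hα hα1 X X
      rw [← he, sub_self, ← two_mul, ← hyX] at hb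
      have hl := H.lower (φ 0) (φ y) (hη y ⟨hy0.le, hyr.le⟩) (H.le y) le_rfl
      have huy : φ 0 - φ y = N * y ^ α := by rw [hN]; field_simp
      have hXy : X ^ α ≤ y ^ α := Real.rpow_le_rpow hX0.le (by linarith) hα.le
      have hθ : (1 / 2 * X) ^ α ≤ X ^ α := Real.rpow_le_rpow (by positivity) (by linarith) hα.le
      have hXα : 0 < X ^ α := Real.rpow_pos_of_pos hX0 _
      have e2 : X * X ^ (2 * α - 1) = X ^ α * X ^ α := by
        rw [mul_comm, ← Real.rpow_add_one hX0.ne', ← Real.rpow_add hX0]; ring_nf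
      rw [le_div_iff₀ hm]
      rw [huy] at hl
      have h1 : m * N * N * (X ^ α * X ^ α) ≤ m * (N * y ^ α) * (N * y ^ α) := by
        calc _ ≤ m * N * N * (y ^ α * y ^ α) := by gcongr
          _ = _ := by ring
      have h2 : C₁ * (8 * N * X ^ α) * (1 / 2 * X) ^ α ≤ C₁ * (8 * N * X ^ α) * X ^ α := by gcongr
      have h3 : C₂ * (2 * N) * X * X ^ (2 * α - 1) = 2 * C₂ * N * (X ^ α * X ^ α) := by
        rw [mul_assoc, e2]; ring
      have h4 : (N * m) * (N * (X ^ α * X ^ α)) ≤ (8 * C₁ + 2 * C₂) * (N * (X ^ α * X ^ α)) := by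
        nlinarith
      exact le_of_mul_le_mul_right h4 (by positivity)
  refine ⟨K, hK0, fun x hx => ?_⟩
  rcases hx.1.eq_or_lt with h0 | h0
  · rw [← h0, Real.zero_rpow hα.ne']; simp
  · exact main (min x r) ⟨lt_min h0 hr, min_le_right _ _⟩ x ⟨min_le_left _ _, hx.2⟩

/-- The symmetric difference is maximised over its centre `y`. Centres away from `0` are Lipschitz
points, and centres with `y ≤ 2h` follow from `exists_upper`. For the remaining ones, the lower
growth of `φ 0 - φ` makes the degenerate coefficient at least of order `y^α`, which absorbs the near
part of the integral. -/
lemma exists_sub_le (H : IsCrest α m M η φ g) (hα : 0 < α) (hα1 : α < 1) {δ₀ : ℝ} (hδ₀ : 0 < δ₀)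
    (hlip : ∀ x ∈ Ioc 0 δ₀, LocHolder 0 1 φ x) :
    ∃ δ > 0, ∃ K ≥ 0, ∀ h ∈ Ioc 0 (δ / 2), ∀ y ∈ Icc 0 (2 * δ),
      φ (y - h) - φ (y + h) ≤ K * h ^ α := by
  obtain ⟨r, hr, hr1, hη⟩ := H.exists_near
  obtain ⟨r', hr', c, hc, hlow⟩ := H.exists_lower hα hα1
  obtain ⟨C, hC, hup⟩ := H.exists_upper hα hα1
  obtain ⟨C₁, hC₁, hk⟩ := exists_integral_kerDiff_le hα hα1
  have hπ := Real.pi_gt_three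
  have hm := H.m_pos
  have hφ := H.continuous
  -- With this `θ` the near part takes up at most half of the coercive term `m c D y^α`.
  obtain ⟨θ, hθ, hθ2, hθC⟩ : ∃ θ > 0, θ ≤ 1 / 2 ∧ C₁ * θ ^ α ≤ m * c / 2 := by
    have h1 : Tendsto (fun t : ℝ => C₁ * t ^ α) (𝓝 0) (𝓝 (C₁ * 0 ^ α)) :=
      ((Real.continuousAt_rpow_const 0 α (Or.inr hα.le)).const_mul C₁)
    rw [Real.zero_rpow hα.ne', mul_zero] at h1
    obtain ⟨ε, hε, h2⟩ := Metric.eventually_nhds_iff.1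
      (h1.eventually (Iio_mem_nhds (show (0 : ℝ) < m * c / 2 by positivity)))
    refine ⟨min (ε / 2) (1 / 2), by positivity, min_le_right _ _, (h2 ?_).le⟩
    rw [Real.dist_eq, sub_zero, abs_of_nonneg (by positivity)]
    linarith [min_le_left (ε / 2) (1 / 2)]
  obtain ⟨C₂, hC₂, hk⟩ := hk θ hθ hθ2
  set R := min r (min r' δ₀) with hR
  have hR0 : 0 < R := by positivity
  have hRr : R ≤ r := min_le_left _ _
  have hRr' : R ≤ r' := (min_le_right _ _).trans (min_le_left _ _)
  have hRδ : R ≤ δ₀ := (min_le_right _ _).trans (min_le_right _ _)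
  set δ := R / 3 with hδ
  have hδ0 : 0 < δ := by positivity
  obtain ⟨B, -, hB⟩ := exists_bound_of_periodic hφ H.periodic
  obtain ⟨L, hL, hLip⟩ := exists_holder_of_compact (s := Icc (δ / 2) (3 * δ)) (γ := 1)
    isCompact_Icc one_pos hB
    (fun x hx => hlip x ⟨by linarith [hx.1], by linarith [hx.2]⟩)
  refine ⟨δ, hδ0, 2 * L + 3 * C + C₂ * C / (m * c / 2), by positivity, fun h hh => ?_⟩
  have hh0 := hh.1
  have hhδ := hh.2
  have hhα : 0 < h ^ α := Real.rpow_pos_of_pos hh0 _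
  obtain ⟨y, hy, hmax⟩ := isCompact_Icc.exists_isMaxOn (s := Icc 0 (2 * δ))
    ⟨0, le_rfl, by positivity⟩
    (show ContinuousOn (fun y => φ (y - h) - φ (y + h)) _ by fun_prop)
  rw [isMaxOn_iff] at hmax
  intro z hz
  refine (hmax z hz).trans ?_
  have t1 : 0 ≤ L * h ^ α := by positivity
  have t2 : 0 ≤ C * h ^ α := by positivity
  have t3 : 0 ≤ C₂ * C / (m * c / 2) * h ^ α := by positivity
  have hexp : (2 * L + 3 * C + C₂ * C / (m * c / 2)) * h ^ α =
    2 * (L * h ^ α) + 3 * (C * h ^ α) + C₂ * C / (m * c / 2) * h ^ α := by ring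
  rw [hexp]
  rcases le_or_gt δ y with hδy | hyδ
  · have h1 := hLip (y - h) ⟨by linarith, by linarith [hy.2]⟩ (y + h)
    rw [show y - h - (y + h) = -(2 * h) by ring, abs_neg, abs_of_pos (show 0 < 2 * h by linarith),
      Real.rpow_one] at h1
    have h2 : h ≤ h ^ α := by
      calc h = h ^ (1 : ℝ) := (Real.rpow_one h).symm
        _ ≤ h ^ α := Real.rpow_le_rpow_of_exponent_ge hh0 (by linarith) hα1.le
    have h3 := le_abs_self (φ (y - h) - φ (y + h))
    have h4 := mul_le_mul_of_nonneg_left h2 hL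
    linarith
  rcases le_or_gt y (2 * h) with hyh | hyh
  · have h1 := hup (y + h) ⟨by linarith [hy.1], by linarith⟩
    have h2 : (y + h) ^ α ≤ 3 * h ^ α := by
      calc (y + h) ^ α ≤ (3 * h) ^ α :=
            Real.rpow_le_rpow (by linarith [hy.1]) (by linarith) hα.le
        _ = 3 ^ α * h ^ α := Real.mul_rpow (by norm_num) hh0.le
        _ ≤ 3 ^ (1 : ℝ) * h ^ α := by gcongr; norm_num
        _ = _ := by rw [Real.rpow_one]
    have h3 := mul_le_mul_of_nonneg_left h2 hC.le
    linarith [H.le (y - h)]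
  set D := φ (y - h) - φ (y + h) with hD
  have hy0 : 0 < y := by linarith
  have hDnn : 0 ≤ D := by
    have := even_periodic_antitone_le H.periodic H.even H.antitone (y := y) (h := h)
      ⟨hy0.le, by linarith⟩ ⟨hh0.le, by linarith⟩
    linarith
  have hupy : ∀ z ∈ Icc 0 (2 * Real.pi), φ 0 - φ z ≤ C * (y + z) ^ α := by
    intro z hz
    refine (H.reflect_le hα hy0 (by linarith) hC.le
      (fun w hw => hup w ⟨hy0.le.trans hw.1, hw.2⟩) hz).trans ?_
    have h1 : max z y ≤ y + z := max_le (by linarith) (by linarith [hz.1])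
    have h2 : 0 ≤ max z y := hy0.le.trans (le_max_right _ _)
    gcongr
  -- Here `S = D`: since `θ ≤ 1/2` and `y < δ`, the near window stays inside `[0, 2δ]`, where `D` is
  -- the maximum.
  have hb := hk (fun z => φ 0 - φ z) (by fun_prop) (fun z => by linarith [H.le z]) y h C D hh0
    (by linarith) (by linarith) hC.le hDnn
    (fun z hz => by
      have := even_periodic_antitone_le H.periodic H.even H.antitone hz
        (h := h) ⟨hh0.le, by linarith⟩
      linarith) hupy
    (fun z hz => by
      rw [abs_le] at hz
      have h5 : θ * y ≤ 1 / 2 * y := by gcongr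
      have := hmax z ⟨by linarith [hz.2], by linarith [hz.1]⟩
      linarith)
  rw [← H.sub_eq_integral hα hα1 y h] at hb
  have hmono : φ (y + h) ≤ φ (y - h) := by linarith
  have hl := H.lower (φ (y - h)) (φ (y + h)) (hη _ ⟨by linarith, by linarith⟩) hmono (H.le _)
  have hlow' := hlow (y + h) ⟨by linarith, by linarith⟩
  have hyα : 0 < y ^ α := Real.rpow_pos_of_pos hy0 _
  have h1 : m * D * (c * y ^ α) ≤ m * D * (φ 0 - φ (y + h)) := by
    refine mul_le_mul_of_nonneg_left (le_trans ?_ hlow') (by positivity)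
    have : y ^ α ≤ (y + h) ^ α := Real.rpow_le_rpow hy0.le (by linarith) hα.le
    gcongr
  have h2 : C₁ * D * (θ * y) ^ α ≤ m * c / 2 * (D * y ^ α) := by
    rw [Real.mul_rpow hθ.le hy0.le]
    calc _ = C₁ * θ ^ α * (D * y ^ α) := by ring
      _ ≤ _ := by gcongr
  have h3 : h * y ^ (2 * α - 1) ≤ h ^ α * y ^ α := by
    have e1 : y ^ (2 * α - 1) = y ^ (α - 1) * y ^ α := by
      rw [← Real.rpow_add hy0]; ring_nf
    have e2 : h * h ^ (α - 1) = h ^ α := by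
      rw [mul_comm, ← Real.rpow_add_one hh0.ne']; ring_nf
    have e3 : y ^ (α - 1) ≤ h ^ (α - 1) :=
      Real.rpow_le_rpow_of_nonpos hh0 (by linarith) (by linarith)
    rw [e1, ← e2, mul_assoc]
    gcongr
  have h4 : C₂ * C * h * y ^ (2 * α - 1) ≤ C₂ * C * h ^ α * y ^ α := by
    calc _ = C₂ * C * (h * y ^ (2 * α - 1)) := by ring
      _ ≤ C₂ * C * (h ^ α * y ^ α) := by gcongr
      _ = _ := by ring
  have h5 : (m * c / 2 * D) * y ^ α ≤ (C₂ * C * h ^ α) * y ^ α := by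
    linarith
  have h6 := le_of_mul_le_mul_right h5 hyα
  have h7 : D ≤ C₂ * C / (m * c / 2) * h ^ α := by
    rw [div_mul_eq_mul_div, le_div_iff₀ (by positivity)]
    linarith
  linarith

/-- At a crest the profile is locally `α`-Hölder continuous. -/
lemma locHolder (H : IsCrest α m M η φ g) (hα : 0 < α) (hα1 : α < 1) {δ₀ : ℝ} (hδ₀ : 0 < δ₀)
    (hlip : ∀ x ∈ Ioc 0 δ₀, LocHolder 0 1 φ x) : LocHolder 0 α φ 0 := by
  obtain ⟨δ, hδ, K, hK, hD⟩ := H.exists_sub_le hα hα1 hδ₀ hlip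
  have key : ∀ a b, 0 ≤ a → a ≤ b → b ≤ δ → a ≤ Real.pi → b ≤ Real.pi →
      |φ a - φ b| ≤ K * (b - a) ^ α := by
    intro a b ha hab hb haπ hbπ
    rcases hab.eq_or_lt with h | h
    · rw [h]; simp [Real.zero_rpow hα.ne']
    have h1 := hD ((b - a) / 2) ⟨by linarith, by linarith⟩ ((a + b) / 2) ⟨by linarith, by linarith⟩
    rw [show (a + b) / 2 - (b - a) / 2 = a by ring,
      show (a + b) / 2 + (b - a) / 2 = b by ring] at h1
    rw [abs_of_nonneg (by linarith [H.antitone ⟨ha, haπ⟩ ⟨ha.trans hab, hbπ⟩ hab])]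
    refine h1.trans ?_
    have : 0 < (b - a) / 2 := by linarith
    gcongr
    linarith
  refine ⟨K, ?_⟩
  have hev : ∀ᶠ z in 𝓝 (0 : ℝ), |z| < min δ Real.pi := by
    have := (continuous_abs (G := ℝ)).tendsto 0
    rw [abs_zero] at this
    exact this.eventually (Iio_mem_nhds (lt_min hδ Real.pi_pos))
  filter_upwards [hev.prod_mk hev] with q hq
  have h1 := hq.1.trans_le (min_le_left _ _)
  have h2 := hq.1.trans_le (min_le_right _ _)
  have h3 := hq.2.trans_le (min_le_left _ _)
  have h4 := hq.2.trans_le (min_le_right _ _)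
  rw [← even_apply_abs H.even q.1, ← even_apply_abs H.even q.2]
  have hab := abs_abs_sub_abs_le_abs_sub q.1 q.2
  rcases le_total |q.1| |q.2| with h | h
  · refine (key _ _ (abs_nonneg _) h h3.le h2.le h4.le).trans ?_
    have : |q.2| - |q.1| ≤ |q.1 - q.2| := by linarith [neg_abs_le (|q.1| - |q.2|)]
    have h0 := sub_nonneg.2 h
    gcongr
  · rw [abs_sub_comm]
    refine (key _ _ (abs_nonneg _) h h1.le h4.le h2.le).trans ?_
    have : |q.1| - |q.2| ≤ |q.1 - q.2| := by linarith [le_abs_self (|q.1| - |q.2|)]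
    have h0 := sub_nonneg.2 h
    gcongr

end IsCrest

/-! ### Strict monotonicity. -/

/-- Equal values at `a < b` make the symmetrised integral about the midpoint vanish. Positivity of
the kernel kills the symmetric difference on `[0, π]`, and oddness with periodicity kills it
everywhere. Then `φ` has period `b - a ≤ π`, so monotonicity makes it constant and the mean makes it
zero. -/
lemma strictAntiOn_of_steady {α A : ℝ} (hα : 0 < α) (hα1 : α < 1) {φ g : ℝ → ℝ}
    (hφ : IsEvenZeroMeanContinuous φ) (h0 : φ ≠ 0) (ha : AntitoneOn φ (Icc 0 Real.pi))
    (heq : ∀ x, g (φ x) = fracInt α φ x + A) : StrictAntiOn φ (Icc 0 Real.pi) := by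
  intro a haa b hbb hab
  have hπ := Real.pi_pos
  refine lt_of_le_of_ne (ha haa hbb hab.le) fun hcon => h0 ?_
  set x := (a + b) / 2 with hx
  set h := (b - a) / 2 with hh
  have hxI : x ∈ Ioo 0 Real.pi := ⟨by linarith [haa.1], by linarith [hbb.2]⟩
  have hhI : h ∈ Icc 0 Real.pi := ⟨by linarith, by linarith [haa.1, hbb.2]⟩
  have hφc := hφ.continuous
  set d : ℝ → ℝ := fun y => φ (y - h) - φ (y + h) with hd
  have hdc : Continuous d := by rw [hd]; fun_prop
  have hd0 : ∀ y ∈ Icc 0 Real.pi, 0 ≤ d y := fun y hy => sub_nonneg.2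
    (even_periodic_antitone_le hφ.periodic hφ.even ha hy hhI)
  obtain ⟨_, _, _, _, hk, -⟩ := kerDiff_bounds hα hα1
  have hI : ∫ y in (0 : ℝ)..Real.pi, kerDiff α x y * d y = 0 := by
    have h1 := fracInt_sub_fracInt hα hα1 hφ.continuous hφ.periodic hφ.even x h
    have h2 := heq (x - h)
    have h3 := heq (x + h)
    rw [show x - h = a by rw [hx, hh]; ring] at h1 h2
    rw [show x + h = b by rw [hx, hh]; ring] at h1 h3
    rw [hcon] at h3
    rw [← h1]; linarith
  have hint := intervalIntegrable_kerDiff_mul hα hα1 x 0 Real.pi hdc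
  have hmem : ∀ᵐ y ∂(volume.restrict (Ioc 0 Real.pi)), y ∈ Ioo 0 Real.pi ∧ x ≠ y := by
    rw [← restrict_Ioo_eq_restrict_Ioc]
    filter_upwards [ae_restrict_mem measurableSet_Ioo,
      ae_restrict_of_ae (show ∀ᵐ y, y ≠ x by simp [ae_iff])] with y hy hyx using ⟨hy, hyx.symm⟩
  rw [intervalIntegral.integral_eq_zero_iff_of_le_of_nonneg_ae hπ.le (by
    filter_upwards [hmem] with y hy
    exact mul_nonneg (hk x hxI y hy.1 hy.2).1.le (hd0 y ⟨hy.1.1.le, hy.1.2.le⟩)) hint] at hI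
  have hz : EqOn d 0 (Icc 0 Real.pi) := by
    refine Measure.eqOn_Icc_of_ae_eq (μ := volume) hπ.ne ?_ hdc.continuousOn
      continuousOn_const
    rw [← restrict_Ioc_eq_restrict_Icc]
    filter_upwards [hI, hmem] with y h1 h2
    exact (mul_eq_zero.1 h1).resolve_left (hk x hxI y h2.1 h2.2).1.ne'
  have hdo : ∀ y, d (-y) = -d y := fun y => by
    simp only [hd]
    rw [← hφ.even (-y - h), ← hφ.even (-y + h)]
    ring_nf
  have hdp : Function.Periodic d (2 * Real.pi) := fun y => by
    simp only [hd]
    rw [show y + 2 * Real.pi - h = y - h + 2 * Real.pi by ring,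
      show y + 2 * Real.pi + h = y + h + 2 * Real.pi by ring, hφ.periodic, hφ.periodic]
  have hall : ∀ y, d y = 0 := by
    intro y
    obtain ⟨z, hz', hyz⟩ := hdp.exists_mem_Ico (by positivity) y (-Real.pi)
    rw [hyz]
    rcases le_total 0 z with h1 | h1
    · exact hz ⟨h1, by linarith [hz'.2]⟩
    · have := hz (x := -z) ⟨by linarith, by linarith [hz'.1]⟩
      rw [hdo] at this
      simpa using this
  have hper : Function.Periodic φ (2 * h) := fun y => by
    have := hall (y + h)
    simp only [hd] at this
    rw [show y + h - h = y by ring, show y + h + h = y + 2 * h by ring] at this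
    linarith
  have hconst : ∀ y, φ y = φ 0 := by
    intro y
    obtain ⟨z, hz', hyz⟩ := hper.exists_mem_Ico₀ (by linarith) y
    rw [hyz]
    have h2 : 2 * h ≤ Real.pi := by linarith [haa.1, hbb.2]
    have h3 := ha (left_mem_Icc.2 hπ.le) ⟨hz'.1, by linarith [hz'.2]⟩ hz'.1
    have h4 := ha ⟨hz'.1, by linarith [hz'.2]⟩ ⟨by linarith, h2⟩ hz'.2.le
    have h5 := hper 0
    rw [zero_add] at h5
    linarith
  have hm := hφ.zero_mean
  rw [intervalIntegral.integral_congr (g := fun _ => φ 0) fun y _ => hconst y,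
    intervalIntegral.integral_const, smul_eq_mul] at hm
  have h6 : φ 0 = 0 := (mul_eq_zero.1 hm).resolve_left (by linarith)
  funext y
  rw [hconst y, h6, Pi.zero_apply]

lemma antitoneOn_Icc_of_monotoneOn {φ : ℝ → ℝ} (hc : Continuous φ) (he : Function.Even φ)
    (hm : MonotoneOn φ (Ioo (-Real.pi) 0)) : AntitoneOn φ (Icc 0 Real.pi) := by
  have h1 : AntitoneOn φ (Ioo 0 Real.pi) := by
    intro x hx y hy hxy
    rw [← he x, ← he y]
    exact hm ⟨by linarith [hy.2], by linarith [hy.1]⟩ ⟨by linarith [hx.2], by linarith [hx.1]⟩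
      (by linarith)
  have hπ := Real.pi_pos
  set s : Set (ℝ × ℝ) := {q | φ q.2 ≤ φ q.1} with hs
  have hsc : IsClosed s := isClosed_le (by fun_prop) (by fun_prop)
  intro x hx y hy hxy
  rcases hxy.eq_or_lt with rfl | hlt
  · exact le_rfl
  -- Both points are contracted towards `π / 2`, which moves them into the open interval and
  -- preserves their order.
  have hlim : Tendsto (fun t : ℝ => (x + t * (Real.pi / 2 - x), y + t * (Real.pi / 2 - y)))
      (𝓝[>] 0) (𝓝 (x, y)) := by
    have : Continuous fun t : ℝ => (x + t * (Real.pi / 2 - x), y + t * (Real.pi / 2 - y)) := by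
      fun_prop
    have := this.tendsto 0
    simp only [zero_mul, add_zero] at this
    exact this.mono_left nhdsWithin_le_nhds
  refine hsc.mem_of_tendsto hlim ?_
  filter_upwards [Ioo_mem_nhdsGT one_pos] with t ht
  have e : ∀ z ∈ Icc 0 Real.pi, z + t * (Real.pi / 2 - z) ∈ Ioo 0 Real.pi := fun z hz => by
    have h2 : 0 ≤ (1 - t) * z := mul_nonneg (by linarith [ht.2]) hz.1
    have h3 : 0 ≤ (1 - t) * (Real.pi - z) := mul_nonneg (by linarith [ht.2]) (by linarith [hz.2])
    have h4 := mul_pos ht.1 hπ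
    constructor <;> linarith
  refine h1 (e x hx) (e y hy) ?_
  have : 0 < (1 - t) * (y - x) := mul_pos (by linarith [ht.2]) (by linarith)
  simp only
  linarith

/-! ### The nonlinearity and its degeneracy at the highest value. -/

lemma hasDerivAt_id_mul_abs_rpow {p : ℝ} (hp : 1 < p) (x : ℝ) :
    HasDerivAt (fun x : ℝ => x * |x| ^ (p - 1)) (p * |x| ^ (p - 1)) x := by
  rcases eq_or_ne x 0 with rfl | hx
  · rw [abs_zero, Real.zero_rpow (by linarith), mul_zero, hasDerivAt_iff_tendsto_slope]
    have h1 : Tendsto (fun t : ℝ => |t| ^ (p - 1)) (𝓝[≠] 0) (𝓝 0) := by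
      have : ContinuousAt (fun t : ℝ => |t| ^ (p - 1)) 0 :=
        (continuous_abs.continuousAt).rpow_const (Or.inr (by linarith))
      have := this.tendsto
      rw [abs_zero, Real.zero_rpow (by linarith)] at this
      exact this.mono_left nhdsWithin_le_nhds
    refine h1.congr' ?_
    filter_upwards [self_mem_nhdsWithin] with t ht
    have ht : t ≠ 0 := ht
    rw [slope_def_field]
    field_simp
    simp
  · have h1 := (hasDerivAt_abs hx).rpow_const (p := p - 1) (Or.inl (abs_ne_zero.2 hx))
    have h2 := (hasDerivAt_id x).mul h1
    refine h2.congr_deriv ?_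
    have h3 : |x| ^ (p - 1) = |x| ^ (p - 1 - 1) * |x| := by
      rw [← Real.rpow_add_one (abs_ne_zero.2 hx)]; ring_nf
    have h4 : x * (SignType.sign x : ℝ) = |x| := self_mul_sign x
    simp only [id]
    linear_combination (p - 1) * |x| ^ (p - 1 - 1) * h4 - (p - 1) * h3

lemma contDiff_one_nonlinearity (κ : NonlinearityKind) {p : ℝ} (hp : 1 < p) :
    ContDiff ℝ 1 (nonlinearity κ p) := by
  cases κ with
  | abs => exact contDiff_norm_rpow (E := ℝ) hp
  | sgn =>
    have h : ∀ x, HasDerivAt (nonlinearity .sgn p) (p * |x| ^ (p - 1)) x :=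
      hasDerivAt_id_mul_abs_rpow hp
    refine contDiff_one_iff_deriv.2 ⟨fun x => (h x).differentiableAt, ?_⟩
    rw [funext fun x => (h x).deriv]
    exact continuous_const.mul (continuous_abs.rpow_const fun _ => Or.inr (by linarith))

lemma contDiffAt_nonlinearity (κ : NonlinearityKind) (p : ℝ) {x : ℝ} (hx : x ≠ 0) :
    ContDiffAt ℝ ∞ (nonlinearity κ p) x := by
  cases κ with
  | abs => exact (contDiffAt_abs hx).rpow_const_of_ne (abs_ne_zero.2 hx)
  | sgn => exact contDiffAt_id.mul ((contDiffAt_abs hx).rpow_const_of_ne (abs_ne_zero.2 hx))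

lemma deriv_nonlinearity_sgn {p : ℝ} (hp : 1 < p) (x : ℝ) :
    deriv (nonlinearity .sgn p) x = p * |x| ^ (p - 1) :=
  (hasDerivAt_id_mul_abs_rpow hp x).deriv

lemma deriv_nonlinearity_abs_nonpos {p : ℝ} (hp : 1 < p) {x : ℝ} (hx : x ≤ 0) :
    deriv (nonlinearity .abs p) x ≤ 0 := by
  have : HasDerivAt (nonlinearity .abs p) _ x := hasDerivAt_abs_rpow x hp
  rw [this.deriv]
  exact mul_nonpos_of_nonneg_of_nonpos (by positivity) hx

lemma nonlinearity_of_nonneg (κ : NonlinearityKind) {p x : ℝ} (hp : 1 < p) (hx : 0 ≤ x) :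
    nonlinearity κ p x = x ^ p := by
  cases κ with
  | abs => simp only [nonlinearity, abs_of_nonneg hx]
  | sgn =>
    simp only [nonlinearity, abs_of_nonneg hx]
    rcases hx.eq_or_lt with rfl | h
    · rw [Real.zero_rpow (by linarith : p ≠ 0), zero_mul]
    · rw [mul_comm, ← Real.rpow_add_one h.ne', sub_add_cancel]

lemma hasDerivAt_nonlinearity_of_pos (κ : NonlinearityKind) {p x : ℝ} (hp : 1 < p) (hx : 0 < x) :
    HasDerivAt (nonlinearity κ p) (p * x ^ (p - 1)) x := by
  refine (Real.hasDerivAt_rpow_const (Or.inl hx.ne')).congr_of_eventuallyEq ?_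
  filter_upwards [Ioi_mem_nhds hx] with y hy using nonlinearity_of_nonneg κ hp (le_of_lt hy)

lemma highestValue_pos {p c : ℝ} (hp : 1 < p) (hc : 0 < c) : 0 < highestValue p c :=
  Real.rpow_pos_of_pos (by positivity) _

lemma highestValue_rpow {p c : ℝ} (hp : 1 < p) (hc : 0 < c) :
    p * highestValue p c ^ (p - 1) = c := by
  have : p - 1 ≠ 0 := by linarith
  rw [highestValue, ← Real.rpow_mul (by positivity), one_div, inv_mul_cancel₀ this, Real.rpow_one]
  field_simp

/-- Where the linearised coefficient `c - n'` does not vanish. -/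
lemma deriv_nonlinearity_lt {κ : NonlinearityKind} {p c x : ℝ} (hp : 1 < p) (hc : 0 < c)
    (hx : x < highestValue p c) (hx' : κ = .sgn → -highestValue p c < x) :
    deriv (nonlinearity κ p) x < c := by
  cases κ with
  | abs =>
    rcases le_or_gt x 0 with h | h
    · exact (deriv_nonlinearity_abs_nonpos hp h).trans_lt hc
    · rw [(hasDerivAt_nonlinearity_of_pos .abs hp h).deriv, ← highestValue_rpow hp hc]
      have : x ^ (p - 1) < highestValue p c ^ (p - 1) := Real.rpow_lt_rpow h.le hx (by linarith)
      gcongr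
  | sgn =>
    rw [deriv_nonlinearity_sgn hp, ← highestValue_rpow hp hc]
    have : |x| ^ (p - 1) < highestValue p c ^ (p - 1) :=
      Real.rpow_lt_rpow (abs_nonneg _) (abs_lt.2 ⟨hx' rfl, hx⟩) (by linarith)
    gcongr

/-- Quadratic degeneracy of `c t - n(t)` at the highest value. -/
lemma exists_degenerate_bounds (κ : NonlinearityKind) {p c : ℝ} (hp : 1 < p) (hc : 0 < c) :
    ∃ m > 0, ∃ M > 0, ∃ η > 0,
      (∀ a b, highestValue p c - η ≤ b → b ≤ a → a ≤ highestValue p c →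
        m * (a - b) * (highestValue p c - b) ≤
          (c * a - nonlinearity κ p a) - (c * b - nonlinearity κ p b)) ∧
      ∀ b, highestValue p c - η ≤ b → b ≤ highestValue p c →
        (c * highestValue p c - nonlinearity κ p (highestValue p c)) -
          (c * b - nonlinearity κ p b) ≤ M * (highestValue p c - b) ^ 2 := by
  have hμ := highestValue_pos hp hc
  have hμc := highestValue_rpow hp hc
  set μ := highestValue p c with hμdef
  -- Extrema of `t ^ (p - 2)` away from `0` bound the second derivative on both sides, whatever the
  -- sign of `p - 2`. Hence `c - n'(t)` is comparable to `μ - t`.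
  have hcont : ContinuousOn (fun t : ℝ => t ^ (p - 1 - 1)) (Icc (μ / 2) μ) := fun t ht =>
    (Real.continuousAt_rpow_const _ _ (Or.inl (by linarith [ht.1]))).continuousWithinAt
  have hne : (Icc (μ / 2) μ).Nonempty := ⟨μ, by linarith, le_rfl⟩
  obtain ⟨y₁, hy₁, hmin⟩ := isCompact_Icc.exists_isMinOn hne hcont
  obtain ⟨y₂, hy₂, hmax⟩ := isCompact_Icc.exists_isMaxOn hne hcont
  rw [isMinOn_iff] at hmin
  rw [isMaxOn_iff] at hmax
  set k₁ := y₁ ^ (p - 1 - 1) with hk₁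
  set k₂ := y₂ ^ (p - 1 - 1) with hk₂
  have hk₁0 : 0 < k₁ := Real.rpow_pos_of_pos (by linarith [hy₁.1]) _
  have hk₂0 : 0 < k₂ := Real.rpow_pos_of_pos (by linarith [hy₂.1]) _
  have hp1 : 0 < p - 1 := by linarith
  have hg : ∀ t ∈ Icc (μ / 2) μ,
      HasDerivAt (fun s => c * s - nonlinearity κ p s) (c - p * t ^ (p - 1)) t := fun t ht => by
    refine (((hasDerivAt_id t).const_mul c).sub
      (hasDerivAt_nonlinearity_of_pos κ hp (by linarith [ht.1] : 0 < t))).congr_deriv ?_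
    rw [mul_one]
  have hslope : ∀ t ∈ Icc (μ / 2) μ, p * ((p - 1) * k₁) * (μ - t) ≤ c - p * t ^ (p - 1) ∧
      c - p * t ^ (p - 1) ≤ p * ((p - 1) * k₂) * (μ - t) := by
    intro t ht
    rcases ht.2.eq_or_lt with rfl | hlt
    · rw [hμc]; simp
    obtain ⟨ξ, hξ, he⟩ := exists_hasDerivAt_eq_slope (fun s : ℝ => s ^ (p - 1))
      (fun s => (p - 1) * s ^ (p - 1 - 1)) hlt
      (fun s hs => (Real.continuousAt_rpow_const _ _
        (Or.inl (by linarith [hs.1, ht.1]))).continuousWithinAt)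
      (fun s hs => Real.hasDerivAt_rpow_const (Or.inl (by linarith [hs.1, ht.1])))
    rw [eq_div_iff (by linarith)] at he
    have hξm : ξ ∈ Icc (μ / 2) μ := ⟨by linarith [hξ.1, ht.1], hξ.2.le⟩
    have h1 := hmin ξ hξm
    have h2 := hmax ξ hξm
    have e : c - p * t ^ (p - 1) = p * ((p - 1) * ξ ^ (p - 1 - 1)) * (μ - t) := by
      rw [← hμc]; linear_combination -p * he
    have h3 : 0 ≤ μ - t := by linarith
    rw [e]
    constructor <;> gcongr
  refine ⟨p * ((p - 1) * k₁) / 2, by positivity, p * ((p - 1) * k₂), by positivity, μ / 2,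
    by positivity, ?_, ?_⟩
  · intro a b hb hba ha
    set K := p * ((p - 1) * k₁) with hK
    have hK0 : 0 < K := by positivity
    -- Monotonicity of this corrected function gives the lower bound, since `(μ - b)² - (μ - a)² =
    -- (a - b)((μ - a) + (μ - b)) ≥ (a - b)(μ - b)`.
    have hmono : MonotoneOn (fun s => c * s - nonlinearity κ p s + K / 2 * (μ - s) ^ 2)
        (Icc (μ / 2) μ) := by
      have hder : ∀ t ∈ Icc (μ / 2) μ,
          HasDerivAt (fun s => c * s - nonlinearity κ p s + K / 2 * (μ - s) ^ 2)
            (c - p * t ^ (p - 1) - K * (μ - t)) t := fun t ht => by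
        have h1 := (((hasDerivAt_id t).const_sub μ).pow 2).const_mul (K / 2)
        refine ((hg t ht).add h1).congr_deriv ?_
        simp only [id]
        norm_num
        ring
      refine monotoneOn_of_hasDerivWithinAt_nonneg (convex_Icc _ _)
        (fun t ht => (hder t ht).continuousAt.continuousWithinAt)
        (fun t ht => (hder t (interior_subset ht)).hasDerivWithinAt) fun t ht => ?_
      linarith [(hslope t (interior_subset ht)).1]
    have h1 := hmono ⟨by linarith, by linarith⟩ ⟨by linarith, ha⟩ hba
    simp only at h1
    have h2 : 0 ≤ K / 2 * ((a - b) * (μ - a)) :=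
      mul_nonneg (by positivity) (mul_nonneg (by linarith) (by linarith))
    nlinarith
  · intro b hb hbμ
    rcases hbμ.eq_or_lt with rfl | hlt
    · simp
    obtain ⟨ξ, hξ, he⟩ := exists_hasDerivAt_eq_slope (fun s => c * s - nonlinearity κ p s)
      (fun s => c - p * s ^ (p - 1)) hlt
      (fun s hs => (hg s ⟨by linarith [hs.1], hs.2⟩).continuousAt.continuousWithinAt)
      (fun s hs => hg s ⟨by linarith [hs.1], hs.2.le⟩)
    rw [eq_div_iff (by linarith)] at he
    rw [← he, sq, ← mul_assoc]
    have h3 : 0 ≤ μ - b := by linarith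
    refine mul_le_mul_of_nonneg_right ((hslope ξ ⟨by linarith [hξ.1], hξ.2.le⟩).2.trans ?_) h3
    have := hξ.1.le
    gcongr

/-! ### Regularity of solutions at ordinary points and at crests. -/

lemma deriv_sub_nonlinearity {κ : NonlinearityKind} {p : ℝ} (hp : 1 < p) (c x : ℝ) :
    deriv (fun t => c * t - nonlinearity κ p t) x = c - deriv (nonlinearity κ p) x := by
  have h := ((contDiff_one_nonlinearity κ hp).differentiable one_ne_zero x).hasDerivAt
  have := ((hasDerivAt_id x).const_mul c).sub h
  rw [mul_one] at this
  exact this.deriv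

lemma contDiff_one_sub_nonlinearity (κ : NonlinearityKind) {p : ℝ} (hp : 1 < p) (c : ℝ) :
    ContDiff ℝ 1 (fun t => c * t - nonlinearity κ p t) :=
  (contDiff_const.mul contDiff_id).sub (contDiff_one_nonlinearity κ hp)

/-- Regularity of the profile where the steady equation is not degenerate. -/
lemma LocHolder.of_steady_nonlinearity {κ : NonlinearityKind} {α p c A B : ℝ} (hα : 0 < α)
    (hα1 : α < 1) (hp : 1 < p) (hc : 0 < c) (hB : 0 < B) (hB1 : B ≤ 1) {φ : ℝ → ℝ}
    (hφ : Continuous φ) (hper : Function.Periodic φ (2 * Real.pi))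
    (heq : ∀ x, c * φ x - nonlinearity κ p (φ x) = fracInt α φ x + A) {x : ℝ}
    (hx : φ x < highestValue p c) (hx' : κ = .sgn → -highestValue p c < φ x) (m : ℕ)
    (hg : LocHolder m B (fun t => c * t - nonlinearity κ p t) (φ x)) : LocHolder m B φ x := by
  refine LocHolder.of_steady hα hα1 hB hB1 (g := fun t => c * t - nonlinearity κ p t) hφ hper heq
    (contDiff_one_sub_nonlinearity κ hp c).contDiffAt ?_ m hg
  rw [deriv_sub_nonlinearity hp]
  exact (sub_pos.2 (deriv_nonlinearity_lt hp hc hx hx')).ne'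

lemma exists_isCrest (κ : NonlinearityKind) {α p c A : ℝ} (hp : 1 < p) (hc : 0 < c) {φ : ℝ → ℝ}
    (hφ : Continuous φ) (hper : Function.Periodic φ (2 * Real.pi)) (he : Function.Even φ)
    (ha : StrictAntiOn φ (Icc 0 Real.pi))
    (heq : ∀ x, c * φ x - nonlinearity κ p (φ x) = fracInt α φ x + A)
    (h0 : φ 0 = highestValue p c) :
    ∃ m M η, IsCrest α m M η φ (fun t => c * t - nonlinearity κ p t) := by
  obtain ⟨m, hm, M, hM, η, hη, h1, h2⟩ := exists_degenerate_bounds κ hp hc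
  rw [← h0] at h1 h2
  exact ⟨m, M, η, hφ, hper, he, ha.antitoneOn, ⟨A, heq⟩,
    fun x hx => ha (left_mem_Icc.2 Real.pi_pos.le) ⟨hx.1.le, hx.2⟩ hx.1, hm, hM, hη, h1, h2⟩

/-- Just beside the crest `0 < φ < μ`, so the equation is nondegenerate there and `φ` is locally
Lipschitz; this is the remaining hypothesis of `IsCrest.locHolder`. -/
lemma locHolder_crest (κ : NonlinearityKind) {α p c A : ℝ} (hα : 0 < α) (hα1 : α < 1) (hp : 1 < p)
    (hc : 0 < c) {φ : ℝ → ℝ}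
    (hφ : Continuous φ) (hper : Function.Periodic φ (2 * Real.pi)) (he : Function.Even φ)
    (ha : StrictAntiOn φ (Icc 0 Real.pi))
    (heq : ∀ x, c * φ x - nonlinearity κ p (φ x) = fracInt α φ x + A)
    (h0 : φ 0 = highestValue p c) : LocHolder 0 α φ 0 := by
  obtain ⟨m, M, η, H⟩ := exists_isCrest κ hp hc hφ hper he ha heq h0
  have hμ := highestValue_pos hp hc
  have hpos : ∀ᶠ x in 𝓝 (0 : ℝ), 0 < φ x :=
    hφ.continuousAt.eventually (Ioi_mem_nhds (by rwa [h0]))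
  obtain ⟨ε, hε, h1⟩ := Metric.eventually_nhds_iff.1 hpos
  refine H.locHolder hα hα1 (δ₀ := min (ε / 2) Real.pi) (lt_min (by positivity) Real.pi_pos)
    fun x hx => ?_
  have hx1 := hx.2.trans (min_le_left _ _)
  have hx2 := hx.2.trans (min_le_right _ _)
  have h2 : 0 < φ x := h1 (by rw [Real.dist_eq, sub_zero, abs_of_pos hx.1]; linarith)
  refine LocHolder.of_steady_nonlinearity hα hα1 hp hc one_pos le_rfl hφ hper heq ?_
    (fun _ => by linarith) 0 ?_
  · rw [← h0]; exact H.lt x ⟨hx.1, hx2⟩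
  · exact LocHolder.of_contDiffAt (by
      simpa using (contDiff_one_sub_nonlinearity κ hp c).contDiffAt)

lemma LocHolder.neg_shift {β : ℝ} {f : ℝ → ℝ} {x a : ℝ} (h : LocHolder 0 β f (x + a)) (hβ : 0 ≤ β)
    (hβ1 : β ≤ 1) : LocHolder 0 β (fun y => -f (y + a)) x := by
  have h1 : LocHolder 0 1 (fun y : ℝ => y + a) x :=
    LocHolder.of_contDiffAt (contDiffAt_id.add contDiffAt_const)
  have h2 : LocHolder 0 β (fun y => f (y + a)) x := LocHolder.comp h (h1.anti hβ1) h1 hβ hβ1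
  exact (h2.const_mul (-1)).congr (Eventually.of_forall fun y => by simp)

lemma fracInt_neg_shift (α : ℝ) (φ : ℝ → ℝ) (a x : ℝ) :
    fracInt α (fun y => -φ (y + a)) x = -fracInt α φ (x + a) := by
  rw [fracInt, fracInt, ← intervalIntegral.integral_neg]
  refine intervalIntegral.integral_congr fun y _ => ?_
  rw [show x - y + a = x + a - y by ring]; ring

/-- At an inverted crest of height `-μ` (for the odd nonlinearity). -/
lemma locHolder_inverted_crest {α p c A : ℝ} (hα : 0 < α) (hα1 : α < 1) (hp : 1 < p)
    (hc : 0 < c) {φ : ℝ → ℝ}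
    (hφ : Continuous φ) (hper : Function.Periodic φ (2 * Real.pi)) (he : Function.Even φ)
    (ha : StrictAntiOn φ (Icc 0 Real.pi))
    (heq : ∀ x, c * φ x - nonlinearity .sgn p (φ x) = fracInt α φ x + A)
    (h0 : φ Real.pi = -highestValue p c) : LocHolder 0 α (fun y => -φ (y + Real.pi)) 0 := by
  have hrefl : ∀ y, φ (y + Real.pi) = φ (Real.pi - y) := fun y => by
    rw [← he (Real.pi - y), ← hper (-(Real.pi - y))]; ring_nf
  -- Because this nonlinearity is odd, `y ↦ -φ (y + π)` satisfies the same equation with the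
  -- opposite constant, and has an upright crest at `0`.
  refine locHolder_crest .sgn (A := -A) hα hα1 hp hc (by fun_prop) (fun y => ?_) (fun y => ?_) ?_
    (fun x => ?_) (by simp [h0])
  · rw [← hper (y + Real.pi)]; ring_nf
  · rw [hrefl y]; ring_nf
  · intro x hx y hy hxy
    simp only [hrefl]
    have := ha (a := Real.pi - y) (b := Real.pi - x) ⟨by linarith [hy.2], by linarith [hy.1]⟩
      ⟨by linarith [hx.2], by linarith [hx.1]⟩ (by linarith)
    linarith
  · rw [fracInt_neg_shift]
    have := heq (x + Real.pi)
    simp only [nonlinearity, abs_neg] at this ⊢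
    linarith

/-! ### Global consequences and the main theorem. -/

lemma exists_int_abs_sub_le (x : ℝ) : ∃ k : ℤ, |x - k * (2 * Real.pi)| ≤ Real.pi := by
  have hπ := Real.pi_pos
  refine ⟨round (x / (2 * Real.pi)), ?_⟩
  have h1 := abs_sub_round (x / (2 * Real.pi))
  have h2 : x - round (x / (2 * Real.pi)) * (2 * Real.pi) =
      (x / (2 * Real.pi) - round (x / (2 * Real.pi))) * (2 * Real.pi) := by
    field_simp
  rw [h2, abs_mul, abs_of_pos (by positivity : 0 < 2 * Real.pi)]
  calc _ ≤ 1 / 2 * (2 * Real.pi) := by gcongr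
    _ = _ := by ring

lemma holder_of_periodic {φ : ℝ → ℝ} {γ : ℝ} (hγ : 0 < γ) (hφ : Continuous φ)
    (hper : Function.Periodic φ (2 * Real.pi))
    (h : ∀ x ∈ Icc (-Real.pi) Real.pi, LocHolder 0 γ φ x) :
    ∃ C : ℝ, ∀ x y, |φ x - φ y| ≤ C * |x - y| ^ γ := by
  obtain ⟨B, -, hB⟩ := exists_bound_of_periodic hφ hper
  obtain ⟨C, -, hC⟩ := exists_holder_of_compact isCompact_Icc hγ hB h
  refine ⟨C, fun x y => ?_⟩
  obtain ⟨k, hk⟩ := exists_int_abs_sub_le x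
  have := hC (x - k * (2 * Real.pi)) (abs_le.1 hk) (y - k * (2 * Real.pi))
  rwa [hper.sub_int_mul_eq, hper.sub_int_mul_eq, sub_sub_sub_cancel_right] at this

lemma apply_lt_of_strictAntiOn {φ : ℝ → ℝ} (hper : Function.Periodic φ (2 * Real.pi))
    (he : Function.Even φ) (ha : StrictAntiOn φ (Icc 0 Real.pi)) {x : ℝ}
    (hx : ∀ k : ℤ, x ≠ 2 * Real.pi * k) : φ x < φ 0 := by
  obtain ⟨k, hk⟩ := exists_int_abs_sub_le x
  rw [← hper.sub_int_mul_eq k, ← even_apply_abs he]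
  refine ha (left_mem_Icc.2 Real.pi_pos.le) ⟨abs_nonneg _, hk⟩ (abs_pos.2 fun h => hx k ?_)
  linarith

/-- If `φ (-π)` were nonnegative, strict monotonicity would make `φ` positive on `(-π, π)`, against
the zero mean. Existence is then the intermediate value theorem, and uniqueness is injectivity. -/
lemma existsUnique_zero {φ : ℝ → ℝ} (hφ : IsEvenZeroMeanContinuous φ)
    (ha : StrictAntiOn φ (Icc 0 Real.pi)) (h0 : 0 < φ 0) :
    ∃! x₀, x₀ ∈ Ioo (-Real.pi) 0 ∧ φ x₀ = 0 := by
  have hπ := Real.pi_pos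
  have hneg : φ (-Real.pi) < 0 := by
    by_contra! hcon
    have hpos : 0 < ∫ x in (-Real.pi)..Real.pi, φ x := by
      refine intervalIntegral.intervalIntegral_pos_of_pos_on (hφ.continuous.intervalIntegrable _ _)
        (fun x hx => ?_) (by linarith)
      rw [← even_apply_abs hφ.even]
      rw [hφ.even] at hcon
      have h1 : |x| < Real.pi := abs_lt.2 hx
      exact hcon.trans_lt (ha ⟨abs_nonneg _, h1.le⟩ (right_mem_Icc.2 hπ.le) h1)
    exact hpos.ne' hφ.zero_mean
  obtain ⟨z, hz, hz0⟩ := intermediate_value_Ioo (by linarith : -Real.pi ≤ 0)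
    hφ.continuous.continuousOn ⟨hneg, h0⟩
  refine ⟨z, ⟨hz, hz0⟩, fun w hw => ?_⟩
  have h1 : -w = -z := ha.injOn ⟨by linarith [hw.1.2], by linarith [hw.1.1]⟩
    ⟨by linarith [hz.2], by linarith [hz.1]⟩ (by rw [hφ.even, hφ.even, hw.2, hz0])
  linarith

theorem mainTheorem2 (κ : NonlinearityKind) (α p c : ℝ) (hα₀ : 0 < α) (hα₁ : α < 1)
    (hp : 1 < p) (hc : 0 < c) (φ : ℝ → ℝ)
    (hφ : IsEvenZeroMeanContinuous φ)
    (hsol : IsSteadySolution κ α p c φ)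
    (hnontrivial : φ ≠ 0)
    (hmono : MonotoneOn φ (Set.Ioo (-Real.pi) 0))
    (hn : ∀ x, deriv (nonlinearity κ p) (φ x) ≤ c)
    (hmax : ∀ x, φ x ≤ φ 0)
    (hμ : φ 0 = highestValue p c) :
    -- strict monotonicity, and a single zero in the half-period
    StrictMonoOn φ (Set.Ioo (-Real.pi) 0) ∧
    (∃! x₀, x₀ ∈ Set.Ioo (-Real.pi) 0 ∧ φ x₀ = 0) ∧
    -- smoothness away from the crests, the zeros and possible inverted crests of height `-μ`
    (∀ x, (∀ k : ℤ, x ≠ 2 * Real.pi * k) → φ x ≠ 0 →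
      (κ = NonlinearityKind.sgn → φ x ≠ -highestValue p c) → ContDiffAt ℝ ∞ φ x) ∧
    -- around its zeros, `φ` has every Hölder regularity that `n` has around `0`
    (∀ (m : ℕ) (β : ℝ), 0 < β → β ≤ 1 → IsHolderNear m β (nonlinearity κ p) 0 →
      ∀ x, φ x = 0 → IsHolderNear m β φ x) ∧
    -- global Hölder regularity
    (∃ C : ℝ, ∀ x y, |φ x - φ y| ≤ C * |x - y| ^ α) ∧
    -- exact Hölder regularity at the crest
    (∃ r > 0, ∃ C₁ > 0, ∃ C₂ > 0, ∀ x, |x| < r →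
      C₁ * |x| ^ α ≤ highestValue p c - φ x ∧ highestValue p c - φ x ≤ C₂ * |x| ^ α) := by
  have hπ := Real.pi_pos
  have hμ0 := highestValue_pos hp hc
  obtain ⟨hcont, hper, he, hmean⟩ := id hφ
  set A : ℝ := -((1 / (2 * Real.pi)) * ∫ y in (-Real.pi)..Real.pi, nonlinearity κ p (φ y)) with hA
  have heq : ∀ x, c * φ x - nonlinearity κ p (φ x) = fracInt α φ x + A := fun x => by
    rw [← congrFun (IsInvFracD.eq_fracInt hα₀ hα₁ hcont hper hsol) x, hA]; ring
  have hanti := strictAntiOn_of_steady hα₀ hα₁ (g := fun t => c * t - nonlinearity κ p t) hφ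
    hnontrivial (antitoneOn_Icc_of_monotoneOn hcont he hmono) heq
  -- For the odd nonlinearity, `n'(φ) ≤ c` means `|φ| ≤ μ`, so the only degenerate value besides `μ`
  -- is the extreme value `-μ`.
  have hlow : κ = .sgn → ∀ x, -highestValue p c ≤ φ x := by
    rintro rfl x
    have h1 := hn x
    rw [deriv_nonlinearity_sgn hp, ← highestValue_rpow hp hc] at h1
    have h2 := le_of_mul_le_mul_left h1 (by linarith)
    exact (abs_le.1 ((Real.rpow_le_rpow_iff (abs_nonneg _) hμ0.le (by linarith)).1 h2)).1
  have reg : ∀ x, φ x < highestValue p c → (κ = .sgn → φ x ≠ -highestValue p c) →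
      ∀ (m : ℕ) (B : ℝ), 0 < B → B ≤ 1 →
      LocHolder m B (fun t => c * t - nonlinearity κ p t) (φ x) → LocHolder m B φ x :=
    fun x h1 h2 m B hB hB1 => LocHolder.of_steady_nonlinearity hα₀ hα₁ hp hc hB hB1 hcont hper heq
      h1 (fun hκ => lt_of_le_of_ne (hlow hκ x) (h2 hκ).symm) m
  refine ⟨?_, existsUnique_zero hφ hanti (hμ ▸ hμ0), ?_, ?_, ?_, ?_⟩
  · intro x hx y hy hxy
    rw [← he x, ← he y]
    exact hanti ⟨by linarith [hy.2], by linarith [hy.1]⟩ ⟨by linarith [hx.2], by linarith [hx.1]⟩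
      (by linarith)
  · intro x hx h0 hsgn
    rw [contDiffAt_infty]
    intro m
    have h1 : ContDiffAt ℝ ∞ (fun t => c * t - nonlinearity κ p t) (φ x) :=
      (contDiffAt_const.mul contDiffAt_id).sub (contDiffAt_nonlinearity κ p h0)
    exact (reg x (hμ ▸ apply_lt_of_strictAntiOn hper he hanti hx) hsgn m 1 one_pos le_rfl
      (LocHolder.of_contDiffAt (contDiffAt_infty.1 h1 (m + 1)))).contDiffAt one_pos
  · intro m β hβ hβ1 hnear x hx
    refine (reg x (hx ▸ hμ0) (fun _ => by rw [hx]; linarith) m β hβ hβ1 ?_).isHolderNear hβ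
    rw [hx]
    -- At height `0` the function `c t - n(t)` has the Hölder regularity of `n`, since the linear
    -- term is smooth.
    have h1 : LocHolder m β (fun t : ℝ => c * t) 0 :=
      (LocHolder.of_contDiffAt (contDiffAt_const.mul contDiffAt_id)).anti hβ1
    exact (h1.add (hnear.locHolder.const_mul (-1))).congr
      (Eventually.of_forall fun t => by ring)
  · refine holder_of_periodic hα₀ hcont hper fun x hx => ?_
    have hxπ := abs_le.2 hx
    rcases eq_or_ne x 0 with rfl | hx0
    · exact locHolder_crest κ hα₀ hα₁ hp hc hcont hper he hanti heq hμ
    by_cases hsgn : κ = .sgn ∧ φ x = -highestValue p c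
    · obtain ⟨rfl, hxμ⟩ := hsgn
      -- Strict monotonicity allows the minimal height `-μ` only at the end of the half-period.
      have hxabs : |x| = Real.pi := by
        by_contra hne
        have h1 := hanti ⟨abs_nonneg x, hxπ⟩ (right_mem_Icc.2 hπ.le) (lt_of_le_of_ne hxπ hne)
        rw [even_apply_abs he, hxμ] at h1
        exact absurd (hlow rfl Real.pi) (not_le.2 h1)
      have hinv := locHolder_inverted_crest hα₀ hα₁ hp hc hcont hper he hanti heq
        (by rw [← hxabs, even_apply_abs he, hxμ])
      rcases (abs_eq hπ.le).1 hxabs with rfl | rfl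
      · have := LocHolder.neg_shift (x := Real.pi) (a := -Real.pi)
          (by rwa [add_neg_cancel]) hα₀.le hα₁.le
        exact this.congr (Eventually.of_forall fun y => by simp)
      · have := LocHolder.neg_shift (x := -Real.pi) (a := Real.pi)
          (by rwa [neg_add_cancel]) hα₀.le hα₁.le
        refine this.congr (Eventually.of_forall fun y => ?_)
        simp only [neg_neg]
        rw [← hper y]; ring_nf
    · refine (reg x ?_ (fun hκ h => hsgn ⟨hκ, h⟩) 0 1 one_pos le_rfl
        (LocHolder.of_contDiffAt (by
          simpa using (contDiff_one_sub_nonlinearity κ hp c).contDiffAt))).anti hα₁.le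
      rw [← hμ, ← even_apply_abs he]
      exact hanti (left_mem_Icc.2 hπ.le) ⟨abs_nonneg x, hxπ⟩ (abs_pos.2 hx0)
  · obtain ⟨m, M, η, H⟩ := exists_isCrest κ hp hc hcont hper he hanti heq hμ
    obtain ⟨r, hr, C₁, hC₁, h1⟩ := H.exists_lower hα₀ hα₁
    obtain ⟨C₂, hC₂, h2⟩ := H.exists_upper hα₀ hα₁
    refine ⟨min r Real.pi, lt_min hr hπ, C₁, hC₁, C₂, hC₂, fun x hx => ?_⟩
    rw [← hμ, ← even_apply_abs he x]
    refine ⟨?_, h2 _ ⟨abs_nonneg x, (hx.trans_le (min_le_right _ _)).le⟩⟩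
    rcases eq_or_ne x 0 with rfl | hx0
    · simp [Real.zero_rpow hα₀.ne']
    · exact h1 _ ⟨abs_pos.2 hx0, (hx.trans_le (min_le_left _ _)).le⟩
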